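/- Let $d\ge 2$ and let $D\subset\mathbb{R}^d$ be a bounded domain with $\partial D\in C^2$ and outward unit normal $\nu$. Let $v_1,v_2\in L^\infty(D)$ (real- or complex-valued), and let $E,\alpha\in\mathbb{R}$. A *regular solution* of $$-\Delta\psi+v\psi=E\psi\quad\text{in } D \qquad (1)$$ is a function $\psi\in H^1(D)$ that satisfies (1) almost everywhere, with the weak Laplacian $\Delta\psi\in L^2(D)$, and whose trace $\psi|_{\partial D}$ and normal derivative $\frac{\partial\psi}{\partial\nu}|_{\partial D}$ belong to $L^2(\partial D)$; here the trace is the $L^2(\partial D)$-limit of $\varphi_n|_{\partial D}$ for functions $\varphi_n\in C^\infty(\bar D)$ with $\varphi_n\to\psi$ in $H^1(D)$, and $\frac{\partial\psi}{\partial\nu}$ is understood in the sense of Green's formula, $\int_D(\nabla\psi\cdot\nabla\varphi+\varphi\,\Delta\psi)\,dx=\int_{\partial D}\frac{\partial\psi}{\partial\nu}\,\varphi\,dx$ for all $\varphi\in C^\infty(\bar D)$. For such $\psi$ put $$[\psi]_\alpha=\cos\alpha\,\psi|_{\partial D}-\sin\alpha\,\frac{\partial\psi}{\partial\nu}\Big|_{\partial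 D}.$$ Assume that, for $j=1,2$, $E$ is not an eigenvalue of $-\Delta+v_j$ in $D$ with the boundary condition $\cos\alpha\,\psi|_{\partial D}-\sin\alpha\,\frac{\partial\psi}{\partial\nu}|_{\partial D}=0$, i.e. that (1) with $v=v_j$ has no regular solution $\psi\neq0$ with $[\psi]_\alpha=0$. Let $\hat M_{\alpha,v_j}=\hat M_{\alpha,v_j}(E)$ be the impedance boundary map, that is, the linear operator in $L^2(\partial D)$ with domain $\{[\psi]_\alpha:\psi\text{ a regular solution of (1) with }v=v_j\}$ given by $\hat M_{\alpha,v_j}[\psi]_\alpha=[\psi]_{\alpha-\pi/2}$. Then for all regular solutions $\psi_1$, $\psi_2$ of (1) with $v=v_1$ and $v=v_2$, respectively, $[\psi_2]_\alpha$ lies in the domains of both $\hat M_{\alpha,v_1}$ and $\hat M_{\alpha,v_2}$, and $$\int_D (v_1-v_2)\,\psi_1\psi_2\,dx=\int_{\partial D}[\psi_1]_\alpha\,\bigl(\hat M_{\alpha,v_1}-\hat M_{\alpha,v_2}\bigr)[\psi_2]_\alpha\,dx .$$ -/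

import Mathlib

open MeasureTheory Filter Topology
open scoped ContDiff ENNReal

noncomputable section

namespace Impedance

/-- The Euclidean space `ℝ^d`. -/
abbrev Eu (d : ℕ) : Type := EuclideanSpace ℝ (Fin d)

/-- `D` is a bounded domain (nonempty, connected, open) in `ℝ^d` whose boundary is of class `C²`:
near each boundary point, `D` is the set of points lying, in the direction of some unit vector `e`,
strictly above the graph of a `C²` function `γ` of the component orthogonal to `e`. -/
structure IsC2Domain {d : ℕ} (D : Set (Eu d)) : Prop where
  isOpen : IsOpen D
  isConnected : IsConnected D
  isBounded : Bornology.IsBounded D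
  boundary : ∀ x₀ ∈ frontier D, ∃ e : Eu d, ‖e‖ = 1 ∧ ∃ γ : Eu d → ℝ, ContDiff ℝ 2 γ ∧
    ∃ r > 0, ∀ x ∈ Metric.ball x₀ r,
      (x ∈ D ↔ γ (x - (inner ℝ e x) • e) < inner ℝ e x)

/-- Lebesgue measure on `D`. -/
abbrev vol {d : ℕ} (D : Set (Eu d)) : Measure (Eu d) := volume.restrict D

/-- The surface measure on `∂D`: the `(d-1)`-dimensional Hausdorff measure, normalized as in
Euclidean geometry, restricted to the boundary. -/
def surf {d : ℕ} (D : Set (Eu d)) : Measure (Eu d) :=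
  (Measure.euclideanHausdorffMeasure (d - 1)).restrict (frontier D)

/-- The complex Hilbert space `L²(∂D)`. -/
abbrev BdryL2 {d : ℕ} (D : Set (Eu d)) : Type := Lp ℂ 2 (surf D)

/-- The partial derivative `∂φ/∂x_i`. -/
def pderiv {d : ℕ} (i : Fin d) (φ : Eu d → ℂ) (x : Eu d) : ℂ :=
  fderiv ℝ φ x (EuclideanSpace.single i 1)

/-- Compactly supported smooth functions on `ℝ^d`. Their restrictions to the closure of a bounded
set are the functions that are smooth up to the boundary. -/
structure IsTest {d : ℕ} (φ : Eu d → ℂ) : Prop where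
  smooth : ContDiff ℝ ∞ φ
  compact : HasCompactSupport φ

/-- `g` is the weak gradient of `u` in `D`. -/
def HasWeakGradient {d : ℕ} (D : Set (Eu d)) (u : Eu d → ℂ) (g : Fin d → Eu d → ℂ) : Prop :=
  ∀ φ : Eu d → ℂ, IsTest φ → tsupport φ ⊆ D → ∀ i : Fin d,
    ∫ x, u x * pderiv i φ x ∂(vol D) = - ∫ x, g i x * φ x ∂(vol D)

/-- `w` is the weak Laplacian in `D` of a function with weak gradient `g`. -/
def HasWeakLaplacian {d : ℕ} (D : Set (Eu d)) (g : Fin d → Eu d → ℂ) (w : Eu d → ℂ) : Prop :=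
  ∀ φ : Eu d → ℂ, IsTest φ → tsupport φ ⊆ D →
    ∑ i, ∫ x, g i x * pderiv i φ x ∂(vol D) = - ∫ x, w x * φ x ∂(vol D)

/-- `τ` is the boundary trace `u|_{∂D}` of the `H¹` function `u` with weak gradient `g`: there are
functions `φ n`, smooth up to the boundary, with `φ n → u` in `H¹(D)` and `φ n → τ` in `L²(∂D)`. -/
def HasTrace {d : ℕ} (D : Set (Eu d)) (u : Eu d → ℂ) (g : Fin d → Eu d → ℂ)
    (τ : Eu d → ℂ) : Prop :=
  ∃ φ : ℕ → Eu d → ℂ, (∀ n, IsTest (φ n)) ∧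
    Tendsto (fun n => eLpNorm (φ n - u) 2 (vol D)) atTop (𝓝 0) ∧
    (∀ i, Tendsto (fun n => eLpNorm (pderiv i (φ n) - g i) 2 (vol D)) atTop (𝓝 0)) ∧
    Tendsto (fun n => eLpNorm (φ n - τ) 2 (surf D)) atTop (𝓝 0)

/-- `h` is the derivative `∂u/∂ν` along the outward normal of `∂D`, for `u` with weak gradient `g`
and weak Laplacian `w`. It is defined as usual by Green's first formula
`∫_D (∇u · ∇φ + φ Δu) dx = ∫_{∂D} (∂u/∂ν) φ dx`, for all `φ` smooth up to the boundary. -/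
def HasNormalDeriv {d : ℕ} (D : Set (Eu d)) (g : Fin d → Eu d → ℂ) (w : Eu d → ℂ)
    (h : Eu d → ℂ) : Prop :=
  ∀ φ : Eu d → ℂ, IsTest φ → Integrable (fun x => h x * φ x) (surf D) ∧
    (∑ i, ∫ x, g i x * pderiv i φ x ∂(vol D)) + ∫ x, w x * φ x ∂(vol D)
      = ∫ x, h x * φ x ∂(surf D)

/-- A regular solution `ψ` of `-Δψ + vψ = Eψ` in `D`: `ψ ∈ H¹(D)` with `Δψ ∈ L²(D)`, the equation
holds almost everywhere in `D`, and both `ψ|_{∂D}` and `∂ψ/∂ν` belong to `L²(∂D)`. -/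
structure RegularSolution {d : ℕ} (D : Set (Eu d)) (v : Eu d → ℂ) (E : ℝ) where
  toFun : Eu d → ℂ
  grad : Fin d → Eu d → ℂ
  lap : Eu d → ℂ
  trace : BdryL2 D
  normalDeriv : BdryL2 D
  memLp_toFun : MemLp toFun 2 (vol D)
  memLp_grad : ∀ i, MemLp (grad i) 2 (vol D)
  memLp_lap : MemLp lap 2 (vol D)
  hasWeakGradient : HasWeakGradient D toFun grad
  hasWeakLaplacian : HasWeakLaplacian D grad lap
  hasTrace : HasTrace D toFun grad trace
  hasNormalDeriv : HasNormalDeriv D grad lap normalDeriv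
  equation : ∀ᵐ x ∂(vol D), - lap x + v x * toFun x = (E : ℂ) * toFun x

/-- `[ψ]_α = cos α ψ|_{∂D} - sin α ∂ψ/∂ν`. -/
def RegularSolution.bracket {d : ℕ} {D : Set (Eu d)} {v : Eu d → ℂ} {E : ℝ}
    (ψ : RegularSolution D v E) (α : ℝ) : BdryL2 D :=
  (Real.cos α : ℂ) • ψ.trace - (Real.sin α : ℂ) • ψ.normalDeriv

/-- `E` is an eigenvalue of `-Δ + v` in `D` with boundary condition
`cos α ψ|_{∂D} - sin α ∂ψ/∂ν = 0`. -/
def IsImpedanceEigenvalue {d : ℕ} (D : Set (Eu d)) (v : Eu d → ℂ) (α E : ℝ) : Prop :=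
  ∃ ψ : RegularSolution D v E, ψ.bracket α = 0 ∧ ¬ (ψ.toFun =ᵐ[vol D] 0)

/-! ### The regular solutions form a vector space -/

lemma IsTest.continuous {d : ℕ} {φ : Eu d → ℂ} (h : IsTest φ) : Continuous φ :=
  h.smooth.continuous

lemma IsTest.continuous_pderiv {d : ℕ} {φ : Eu d → ℂ} (h : IsTest φ) (i : Fin d) :
    Continuous (pderiv i φ) :=
  (h.smooth.continuous_fderiv (by simp)).clm_apply continuous_const

lemma IsTest.memLp {d : ℕ} {φ : Eu d → ℂ} (h : IsTest φ) (D : Set (Eu d)) :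
    MemLp φ 2 (vol D) :=
  h.continuous.memLp_of_hasCompactSupport h.compact

lemma IsTest.memLp_pderiv {d : ℕ} {φ : Eu d → ℂ} (h : IsTest φ) (i : Fin d) (D : Set (Eu d)) :
    MemLp (pderiv i φ) 2 (vol D) :=
  (h.continuous_pderiv i).memLp_of_hasCompactSupport
    (h.compact.fderiv_apply (𝕜 := ℝ) (EuclideanSpace.single i 1))

lemma isTest_zero {d : ℕ} : IsTest (0 : Eu d → ℂ) :=
  ⟨contDiff_const, HasCompactSupport.zero⟩

lemma IsTest.comb {d : ℕ} {φ φ' : Eu d → ℂ} (h : IsTest φ) (h' : IsTest φ') (c : ℂ) :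
    IsTest (c • φ + φ') :=
  ⟨(contDiff_const.smul h.smooth).add h'.smooth,
    (h.compact.smul_left (f := fun _ => c)).add h'.compact⟩

lemma pderiv_comb {d : ℕ} {φ φ' : Eu d → ℂ} (h : IsTest φ) (h' : IsTest φ') (c : ℂ) (i : Fin d) :
    pderiv i (c • φ + φ') = c • pderiv i φ + pderiv i φ' := by
  funext x
  have h1 := (h.smooth.differentiable (by simp)) x
  have h2 := (h'.smooth.differentiable (by simp)) x
  simp only [pderiv, Pi.add_apply, Pi.smul_apply]
  rw [fderiv_add (h1.const_smul c) h2, fderiv_const_smul h1]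
  simp

lemma integral_comb {d : ℕ} {μ : Measure (Eu d)} {a b f : Eu d → ℂ} (c : ℂ)
    (ha : Integrable (fun x => a x * f x) μ) (hb : Integrable (fun x => b x * f x) μ) :
    ∫ x, (c • a + b) x * f x ∂μ = c * ∫ x, a x * f x ∂μ + ∫ x, b x * f x ∂μ := by
  rw [← integral_const_mul, ← integral_add (ha.const_mul c) hb]
  exact integral_congr_ae (Eventually.of_forall fun x => by simp; ring)

lemma tendsto_comb {d : ℕ} {μ : Measure (Eu d)} {a a' b b' : ℕ → Eu d → ℂ} (c : ℂ)
    (hma : ∀ n, AEStronglyMeasurable (a n - a' n) μ)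
    (hmb : ∀ n, AEStronglyMeasurable (b n - b' n) μ)
    (ha : Tendsto (fun n => eLpNorm (a n - a' n) 2 μ) atTop (𝓝 0))
    (hb : Tendsto (fun n => eLpNorm (b n - b' n) 2 μ) atTop (𝓝 0)) :
    Tendsto (fun n => eLpNorm ((c • a n + b n) - (c • a' n + b' n)) 2 μ) atTop (𝓝 0) := by
  have h : Tendsto (fun n => ‖c‖ₑ * eLpNorm (a n - a' n) 2 μ + eLpNorm (b n - b' n) 2 μ)
      atTop (𝓝 0) := by
    simpa using (ENNReal.Tendsto.const_mul ha (Or.inr (by simp))).add hb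
  refine tendsto_of_tendsto_of_tendsto_of_le_of_le tendsto_const_nhds h (fun _ => zero_le) ?_
  intro n
  have e : (c • a n + b n) - (c • a' n + b' n) = c • (a n - a' n) + (b n - b' n) := by
    rw [smul_sub]; abel
  calc eLpNorm ((c • a n + b n) - (c • a' n + b' n)) 2 μ
      ≤ eLpNorm (c • (a n - a' n)) 2 μ + eLpNorm (b n - b' n) 2 μ := by
        rw [e]; exact eLpNorm_add_le ((hma n).const_smul c) (hmb n) (by norm_num)
    _ = _ := by rw [eLpNorm_const_smul]

/-- The linear combination `c ψ + ψ'` of two regular solutions. -/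
def RegularSolution.comb {d : ℕ} {D : Set (Eu d)} {v : Eu d → ℂ} {E : ℝ} (c : ℂ)
    (ψ ψ' : RegularSolution D v E) : RegularSolution D v E where
  toFun := c • ψ.toFun + ψ'.toFun
  grad i := c • ψ.grad i + ψ'.grad i
  lap := c • ψ.lap + ψ'.lap
  trace := c • ψ.trace + ψ'.trace
  normalDeriv := c • ψ.normalDeriv + ψ'.normalDeriv
  memLp_toFun := (ψ.memLp_toFun.const_smul c).add ψ'.memLp_toFun
  memLp_grad i := ((ψ.memLp_grad i).const_smul c).add (ψ'.memLp_grad i)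
  memLp_lap := (ψ.memLp_lap.const_smul c).add ψ'.memLp_lap
  hasWeakGradient φ hφ hs i := by
    rw [integral_comb c (ψ.memLp_toFun.integrable_mul (hφ.memLp_pderiv i D))
        (ψ'.memLp_toFun.integrable_mul (hφ.memLp_pderiv i D)),
      integral_comb c ((ψ.memLp_grad i).integrable_mul (hφ.memLp D))
        ((ψ'.memLp_grad i).integrable_mul (hφ.memLp D)),
      ψ.hasWeakGradient φ hφ hs i, ψ'.hasWeakGradient φ hφ hs i]
    ring
  hasWeakLaplacian φ hφ hs := by
    have h1 := ψ.hasWeakLaplacian φ hφ hs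
    have h2 := ψ'.hasWeakLaplacian φ hφ hs
    rw [integral_comb c (ψ.memLp_lap.integrable_mul (hφ.memLp D))
      (ψ'.memLp_lap.integrable_mul (hφ.memLp D))]
    rw [Finset.sum_congr rfl fun i _ => integral_comb c
      ((ψ.memLp_grad i).integrable_mul (hφ.memLp_pderiv i D))
      ((ψ'.memLp_grad i).integrable_mul (hφ.memLp_pderiv i D)),
      Finset.sum_add_distrib, ← Finset.mul_sum, h1, h2]
    ring
  hasTrace := by
    obtain ⟨φ, h1, h2, h3, h4⟩ := ψ.hasTrace
    obtain ⟨φ', h1', h2', h3', h4'⟩ := ψ'.hasTrace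
    refine ⟨fun n => c • φ n + φ' n, fun n => (h1 n).comb (h1' n) c, ?_, fun i => ?_, ?_⟩
    · exact tendsto_comb c
        (fun n => ((h1 n).continuous.aestronglyMeasurable).sub ψ.memLp_toFun.1)
        (fun n => ((h1' n).continuous.aestronglyMeasurable).sub ψ'.memLp_toFun.1) h2 h2'
    · simp_rw [pderiv_comb (h1 _) (h1' _)]
      exact tendsto_comb c
        (fun n => (((h1 n).continuous_pderiv i).aestronglyMeasurable).sub (ψ.memLp_grad i).1)
        (fun n => (((h1' n).continuous_pderiv i).aestronglyMeasurable).sub (ψ'.memLp_grad i).1)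
        (h3 i) (h3' i)
    · have h := tendsto_comb c
        (fun n => ((h1 n).continuous.aestronglyMeasurable).sub
          (Lp.aestronglyMeasurable ψ.trace))
        (fun n => ((h1' n).continuous.aestronglyMeasurable).sub
          (Lp.aestronglyMeasurable ψ'.trace)) h4 h4'
      refine h.congr fun n => eLpNorm_congr_ae ?_
      filter_upwards [Lp.coeFn_add (c • ψ.trace) ψ'.trace, Lp.coeFn_smul c ψ.trace] with x hx hx'
      rw [Pi.sub_apply, Pi.sub_apply, hx, Pi.add_apply _ _ x, Pi.add_apply _ _ x,
        Pi.add_apply _ _ x, hx']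
  hasNormalDeriv φ hφ := by
    obtain ⟨i1, h1⟩ := ψ.hasNormalDeriv φ hφ
    obtain ⟨i2, h2⟩ := ψ'.hasNormalDeriv φ hφ
    have hae : (fun x => (c • (ψ.normalDeriv : Eu d → ℂ) + (ψ'.normalDeriv : Eu d → ℂ)) x * φ x)
        =ᵐ[surf D] fun x => (c • ψ.normalDeriv + ψ'.normalDeriv : BdryL2 D) x * φ x := by
      filter_upwards [Lp.coeFn_add (c • ψ.normalDeriv) ψ'.normalDeriv,
        Lp.coeFn_smul c ψ.normalDeriv] with x hx hx'
      rw [hx, Pi.add_apply, Pi.add_apply, hx']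
    constructor
    · refine Integrable.congr ((i1.const_mul c).add i2) (EventuallyEq.trans ?_ hae)
      exact Eventually.of_forall fun x => by simp; ring
    · rw [← integral_congr_ae hae, integral_comb c i1 i2, ← h1, ← h2,
        integral_comb c (ψ.memLp_lap.integrable_mul (hφ.memLp D))
          (ψ'.memLp_lap.integrable_mul (hφ.memLp D)),
        Finset.sum_congr rfl fun i _ => integral_comb c
          ((ψ.memLp_grad i).integrable_mul (hφ.memLp_pderiv i D))
          ((ψ'.memLp_grad i).integrable_mul (hφ.memLp_pderiv i D)),
        Finset.sum_add_distrib, ← Finset.mul_sum]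
      ring
  equation := by
    filter_upwards [ψ.equation, ψ'.equation] with x h1 h2
    simp only [Pi.add_apply, Pi.smul_apply, smul_eq_mul]
    linear_combination c * h1 + h2

/-- The zero solution. -/
def RegularSolution.zero {d : ℕ} (D : Set (Eu d)) (v : Eu d → ℂ) (E : ℝ) :
    RegularSolution D v E where
  toFun := 0
  grad _ := 0
  lap := 0
  trace := 0
  normalDeriv := 0
  memLp_toFun := MemLp.zero
  memLp_grad _ := MemLp.zero
  memLp_lap := MemLp.zero
  hasWeakGradient φ hφ hs i := by simp
  hasWeakLaplacian φ hφ hs := by simp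
  hasTrace := by
    refine ⟨fun _ => 0, fun _ => isTest_zero, by simp, fun i => ?_, ?_⟩
    · have : pderiv i (0 : Eu d → ℂ) = 0 := by funext x; simp [pderiv]
      simp [this]
    · have h : eLpNorm ((0 : Eu d → ℂ) - ((0 : BdryL2 D) : Eu d → ℂ)) 2 (surf D) = 0 := by
        rw [eLpNorm_congr_ae (g := 0)]
        · simp
        · filter_upwards [Lp.coeFn_zero ℂ 2 (surf D)] with x hx
          rw [Pi.sub_apply, hx, Pi.zero_apply, sub_zero]
      simp_rw [h]
      exact tendsto_const_nhds
  hasNormalDeriv φ hφ := by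
    have hae : (fun _ => (0 : ℂ)) =ᵐ[surf D] fun x => (0 : BdryL2 D) x * φ x := by
      filter_upwards [Lp.coeFn_zero ℂ 2 (surf D)] with x hx
      rw [hx, Pi.zero_apply, zero_mul]
    exact ⟨(integrable_zero _ _ _).congr hae, by rw [← integral_congr_ae hae]; simp⟩
  equation := by simp

lemma RegularSolution.bracket_comb {d : ℕ} {D : Set (Eu d)} {v : Eu d → ℂ} {E : ℝ} (c : ℂ)
    (ψ ψ' : RegularSolution D v E) (α : ℝ) :
    (comb c ψ ψ').bracket α = c • ψ.bracket α + ψ'.bracket α := by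
  simp only [bracket, comb]
  module

lemma RegularSolution.bracket_zero {d : ℕ} (D : Set (Eu d)) (v : Eu d → ℂ) (E α : ℝ) :
    (zero D v E).bracket α = 0 := by
  simp [bracket, zero]

/-- The space of all pairs `([ψ]_α, [ψ]_{α-π/2})`, for the regular solutions `ψ`. -/
def impedanceGraph {d : ℕ} (D : Set (Eu d)) (v : Eu d → ℂ) (E α : ℝ) :
    Submodule ℂ (BdryL2 D × BdryL2 D) where
  carrier := {p | ∃ ψ : RegularSolution D v E,
    p = (ψ.bracket α, ψ.bracket (α - Real.pi / 2))}
  zero_mem' := ⟨.zero D v E, by simp only [RegularSolution.bracket_zero]; rfl⟩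
  add_mem' := by
    rintro _ _ ⟨ψ, rfl⟩ ⟨ψ', rfl⟩
    exact ⟨.comb 1 ψ ψ', by simp [RegularSolution.bracket_comb]⟩
  smul_mem' := by
    rintro c _ ⟨ψ, rfl⟩
    exact ⟨.comb c ψ (.zero D v E), by
      simp [RegularSolution.bracket_comb, RegularSolution.bracket_zero]⟩

/-- The impedance boundary map `M̂_{α,v}(E)`: the linear operator with domain
`{[ψ]_α : ψ a regular solution}` in `L²(∂D)` given by `M̂ [ψ]_α = [ψ]_{α-π/2}`. -/
def impedanceMap {d : ℕ} (D : Set (Eu d)) (v : Eu d → ℂ) (E α : ℝ) :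
    BdryL2 D →ₗ.[ℂ] BdryL2 D :=
  (impedanceGraph D v E α).toLinearPMap

end Impedance

end

/-!
The identity is Green's second formula. For regular solutions `ψ`, `ψ'` with potentials `v`, `v'`,
Green's formula for each, tested with the other, gives
`∫_D (v - v') ψ ψ' = ∫_{∂D} (∂ψ/∂ν ψ' - ψ ∂ψ'/∂ν)` (`RegularSolution.integral_potential_sub`), and
the boundary term is a combination of `[·]_α` and `[·]_{α-π/2}` (`RegularSolution.pairing_bracket`).
Apply this to `ψ₁` and `ψ₂`, and to `ψ₁` and a regular solution `φ` with potential `v₁` and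
`[φ]_α = [ψ₂]_α`; the difference is the claim, as `M̂_{α,v₁} [ψ₂]_α = [φ]_{α-π/2}`. The maps are well
defined since a regular solution that vanishes in `D` has vanishing boundary data
(`RegularSolution.eq_zero`).

The main work is the existence of `φ`. It is found in a Hilbert space of functions with their
gradients and boundary values (`Energy`), by the Fredholm alternative (`exists_form_eq`). Compactness
comes from the trace inequality with a small constant (`exists_trace_le`), the smallness of the mass
in thin boundary layers (`exists_layer_le`), and finitely many averages in the interior
(`exists_finite_averages`). Non-eigenvalues give uniqueness. If `sin α ≠ 0`, the boundary condition
is of Robin type, and the weak formulation provides the normal derivative in `L²(∂D)`.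

If `sin α = 0`, the problem is the Dirichlet problem: `φ = ψ₂ + z`, where `z` vanishes on the
boundary, and it remains to show that `∂z/∂ν` belongs to `L²(∂D)` (`exists_normalDeriv`). By
duality this amounts to bounding solutions of `-ΔΦ + ℓΦ = 0` in `L²(D)` by their boundary values in
`L²(∂D)`. A barrier `b` with `b = 0` on `∂D` and `2ℓb - Δb ≥ 1` in `D` does this: testing the equation
with `bΦ` gives `∫_D |Φ|² ≤ C ∫_{∂D} |Φ|²` (`exists_barrier`, `norm_val_sq_le_form`). The barrier is
where the `C²` regularity of the boundary enters. Two facts replace the calculus of traces: a `C¹`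
function that vanishes on `∂D` is a limit of test functions with support in `D`
(`toEnergy_mem_of_eq_zero`), and the integral of a derivative over `D` is bounded by the integral of
the absolute value over `∂D` (`exists_integral_pderiv_le`).
-/

open scoped ComplexConjugate

namespace Impedance

/-! ### One-dimensional inequalities -/

lemma sq_intervalIntegral_le {a : ℝ → ℝ} (ha : Continuous a) {s : ℝ} (hs : 0 < s) :
    (∫ τ in 0..s, a τ) ^ 2 ≤ s * ∫ τ in 0..s, a τ ^ 2 := by
  set A := ∫ τ in 0..s, a τ with hA
  have h0 : 0 ≤ ∫ τ in 0..s, (a τ - A / s) ^ 2 :=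
    intervalIntegral.integral_nonneg hs.le fun x _ => sq_nonneg _
  have h1 : ∫ τ in 0..s, (a τ - A / s) ^ 2
      = (∫ τ in 0..s, a τ ^ 2) - 2 * (A / s) * A + (A / s) ^ 2 * s := by
    have : ∀ τ, (a τ - A / s) ^ 2 = (a τ ^ 2 - 2 * (A / s) * a τ) + (A / s) ^ 2 := fun τ => by ring
    simp_rw [this]
    rw [intervalIntegral.integral_add, intervalIntegral.integral_sub,
      intervalIntegral.integral_const_mul, intervalIntegral.integral_const]
    · simp [← hA]; ring
    all_goals exact Continuous.intervalIntegrable (by fun_prop) _ _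
  rw [h1] at h0
  have : s * ((∫ τ in 0..s, a τ ^ 2) - 2 * (A / s) * A + (A / s) ^ 2 * s)
      = s * (∫ τ in 0..s, a τ ^ 2) - A ^ 2 := by
    field_simp; ring
  nlinarith [mul_nonneg hs.le h0]

/-- The oscillation of a `C¹` function on an interval, by the Cauchy–Schwarz inequality. -/
lemma norm_sub_sq_le {f : ℝ → ℂ} (hf : ContDiff ℝ 1 f) {s : ℝ} (hs : 0 < s) {t τ : ℝ}
    (ht : t ∈ Set.Icc 0 s) (hτ : τ ∈ Set.Icc 0 s) :
    ‖f t - f τ‖ ^ 2 ≤ s * ∫ r in 0..s, ‖deriv f r‖ ^ 2 := by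
  have hc : Continuous (deriv f) := hf.continuous_deriv le_rfl
  have h1 : f t - f τ = ∫ r in τ..t, deriv f r := by
    rw [intervalIntegral.integral_deriv_eq_sub (fun x _ => hf.differentiable (by simp) x)
      (hc.intervalIntegrable _ _)]
  have h2 : ‖f t - f τ‖ ≤ ∫ r in 0..s, ‖deriv f r‖ := by
    rw [h1]
    refine (intervalIntegral.norm_integral_le_integral_norm_uIoc).trans ?_
    rw [intervalIntegral.integral_of_le hs.le]
    refine setIntegral_mono_set ((hc.norm.intervalIntegrable 0 s).1)
      (Eventually.of_forall fun _ => norm_nonneg _) ?_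
    refine LE.le.eventuallyLE ?_
    exact Set.Ioc_subset_Ioc (le_min hτ.1 ht.1) (max_le hτ.2 ht.2)
  calc ‖f t - f τ‖ ^ 2 ≤ (∫ r in 0..s, ‖deriv f r‖) ^ 2 := by gcongr
    _ ≤ _ := sq_intervalIntegral_le hc.norm hs

lemma norm_sq_le_intervalIntegral {f : ℝ → ℂ} (hf : ContDiff ℝ 1 f) {s : ℝ} (hs : 0 < s) {t : ℝ}
    (ht : t ∈ Set.Icc 0 s) :
    ‖f t‖ ^ 2 ≤ 2 / s * (∫ r in 0..s, ‖f r‖ ^ 2) + 2 * s * ∫ r in 0..s, ‖deriv f r‖ ^ 2 := by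
  have hc := hf.continuous
  set B := ∫ r in 0..s, ‖deriv f r‖ ^ 2
  have h : ∀ τ ∈ Set.Icc 0 s, ‖f t‖ ^ 2 ≤ 2 * ‖f τ‖ ^ 2 + 2 * (s * B) := by
    intro τ hτ
    have h1 := norm_sub_sq_le hf hs ht hτ
    have h2 : ‖f t‖ ≤ ‖f τ‖ + ‖f t - f τ‖ := by
      simpa using norm_add_le (f τ) (f t - f τ)
    nlinarith [sq_nonneg (‖f τ‖ - ‖f t - f τ‖), norm_nonneg (f t)]
  have h3 : ∫ _ in (0 : ℝ)..s, ‖f t‖ ^ 2 ≤ ∫ τ in 0..s, (2 * ‖f τ‖ ^ 2 + 2 * (s * B)) :=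
    intervalIntegral.integral_mono_on hs.le (by simp)
      (Continuous.intervalIntegrable (by fun_prop) _ _) h
  rw [intervalIntegral.integral_add (Continuous.intervalIntegrable (by fun_prop) _ _) (by simp),
    intervalIntegral.integral_const_mul, intervalIntegral.integral_const,
    intervalIntegral.integral_const] at h3
  simp only [sub_zero, smul_eq_mul] at h3
  have h4 : ‖f t‖ ^ 2 ≤ (2 * (∫ r in 0..s, ‖f r‖ ^ 2) + s * (2 * (s * B))) / s := by
    rw [le_div_iff₀ hs]; linarith
  refine h4.trans (le_of_eq ?_)
  field_simp

lemma lintegral_Ioo_enorm_sq {f : ℝ → ℂ} (hf : Continuous f) {s : ℝ} (hs : 0 < s) :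
    ∫⁻ t in Set.Ioo 0 s, ‖f t‖ₑ ^ 2 = ENNReal.ofReal (∫ t in 0..s, ‖f t‖ ^ 2) := by
  rw [restrict_Ioo_eq_restrict_Ioc, intervalIntegral.integral_of_le hs.le,
    ofReal_integral_eq_lintegral_ofReal]
  · refine lintegral_congr fun t => ?_
    rw [← ofReal_norm, ENNReal.ofReal_pow (norm_nonneg _)]
  · exact (Continuous.intervalIntegrable (μ := volume) (by fun_prop) 0 s).1
  · exact Eventually.of_forall fun _ => by positivity

/-- The value of a `C¹` function on an interval is controlled by its `H¹` norm. As the length `s`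
of the interval shrinks, the constant in front of the derivative becomes small. -/
lemma enorm_sq_le_lintegral {f : ℝ → ℂ} (hf : ContDiff ℝ 1 f) {s : ℝ} (hs : 0 < s) {t : ℝ}
    (ht : t ∈ Set.Icc 0 s) :
    ‖f t‖ₑ ^ 2 ≤ ENNReal.ofReal (2 / s) * (∫⁻ r in Set.Ioo 0 s, ‖f r‖ₑ ^ 2)
      + ENNReal.ofReal (2 * s) * ∫⁻ r in Set.Ioo 0 s, ‖deriv f r‖ₑ ^ 2 := by
  rw [lintegral_Ioo_enorm_sq hf.continuous hs,
    lintegral_Ioo_enorm_sq (hf.continuous_deriv le_rfl) hs,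
    ← ENNReal.ofReal_mul (by positivity), ← ENNReal.ofReal_mul (by positivity),
    ← ENNReal.ofReal_add, ← ofReal_norm, ← ENNReal.ofReal_pow (norm_nonneg _)]
  · exact ENNReal.ofReal_le_ofReal (norm_sq_le_intervalIntegral hf hs ht)
  · exact mul_nonneg (by positivity) (intervalIntegral.integral_nonneg hs.le fun _ _ => by positivity)
  · exact mul_nonneg (by positivity) (intervalIntegral.integral_nonneg hs.le fun _ _ => by positivity)

lemma enorm_sub_sq_le_lintegral {f : ℝ → ℂ} (hf : ContDiff ℝ 1 f) :
    ‖f 1 - f 0‖ₑ ^ 2 ≤ ∫⁻ r in Set.Ioo 0 1, ‖deriv f r‖ₑ ^ 2 := by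
  rw [lintegral_Ioo_enorm_sq (hf.continuous_deriv le_rfl) one_pos, ← ofReal_norm,
    ← ENNReal.ofReal_pow (norm_nonneg _)]
  refine ENNReal.ofReal_le_ofReal ?_
  simpa using norm_sub_sq_le hf one_pos (t := 1) (τ := 0) (by simp) (by simp)

/-! ### Charts of the boundary -/

/-- Fubini's theorem for the decomposition `x = y + (γ y + t) e`, with `y` orthogonal to the unit
vector `e`. Shifting the lines by `γ y` does not change the measure. -/
lemma lintegral_orthogonal {d : ℕ} {e : Eu d} (he : ‖e‖ = 1) (γ : Eu d → ℝ)
    {F : Eu d → ℝ≥0∞} (hF : Measurable F) :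
    ∫⁻ x, F x = ∫⁻ y : (Submodule.span ℝ {e})ᗮ, ∫⁻ t : ℝ, F ((y : Eu d) + γ y • e + t • e) := by
  have h1 := (Submodule.span ℝ {e}).measurePreserving_measurableEquivProd (0 : Eu d)
  rw [InnerProductSpace.euclideanHausdorffMeasure_eq_volume] at h1
  have h2 := (LinearIsometryEquiv.toSpanUnitSingleton (𝕜 := ℝ) e he).measurePreserving
  rw [← h1.symm.lintegral_comp hF, Measure.volume_eq_prod, lintegral_prod_symm]
  · refine lintegral_congr fun y => ?_
    rw [← h2.lintegral_comp]
    · simp only [Submodule.measurableEquivProd_symm_apply]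
      rw [← lintegral_add_right_eq_self _ (γ y)]
      refine lintegral_congr fun t => ?_
      congr 1
      simp [LinearIsometryEquiv.toSpanUnitSingleton]
      module
    · exact hF.comp ((Submodule.measurableEquivProd _ _).symm.measurable.comp
        (measurable_id.prodMk measurable_const))
  · exact (hF.comp (Submodule.measurableEquivProd _ _).symm.measurable).aemeasurable

lemma euclideanHausdorffMeasure_image_le {X Y : Type*} [EMetricSpace X] [MeasurableSpace X]
    [BorelSpace X] [EMetricSpace Y] [MeasurableSpace Y] [BorelSpace Y] {K : NNReal} {f : X → Y}
    {s : Set X} (h : LipschitzOnWith K f s) (k : ℕ) :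
    (Measure.euclideanHausdorffMeasure k : Measure Y) (f '' s)
      ≤ (K : ℝ≥0∞) ^ k * (Measure.euclideanHausdorffMeasure k : Measure X) s := by
  simp only [Measure.euclideanHausdorffMeasure_def, Measure.smul_apply]
  have := h.hausdorffMeasure_image_le (d := k) (by positivity)
  rw [ENNReal.rpow_natCast] at this
  simp only [ENNReal.smul_def, smul_eq_mul]
  calc _ ≤ _ * ((K : ℝ≥0∞) ^ k * (Measure.hausdorffMeasure k : Measure X) s) := by gcongr
    _ = _ := by ring

/-- A chart of the boundary of `D`. The `C²` function `height` measures the height above the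
boundary in the direction `dir`, and `D` is the set of positive height in the open set `base`. The
measure `meas` is carried by a piece of the boundary; it is the image of Lebesgue measure under the
parametrization of the boundary as a graph. Integrals over thin layers `p + t dir`, with `p`
distributed as `meas`, replace integrals over `D` near the boundary. The comparison of `meas` with
the surface measure in both directions (`meas_le`, `surf_le`) avoids a formula for its density. -/
structure BoundaryChart {d : ℕ} (D : Set (Eu d)) where
  dir : Eu d
  height : Eu d → ℝ
  base : Set (Eu d)
  width : ℝ
  meas : Measure (Eu d)
  const : NNReal
  norm_dir : ‖dir‖ = 1
  contDiff_height : ContDiff ℝ 2 height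
  height_add : ∀ x t, height (x + t • dir) = height x + t
  isOpen_base : IsOpen base
  isBounded_base : Bornology.IsBounded base
  width_pos : 0 < width
  isFinite : IsFiniteMeasure meas
  mem_iff : ∀ x ∈ base, (x ∈ D ↔ 0 < height x)
  height_lt : ∀ x ∈ base, height x < width
  height_eq_zero : ∀ x ∈ base, x ∈ frontier D → height x = 0
  foot_mem : ∀ x ∈ base, x - height x • dir ∈ frontier D
  meas_le : meas ≤ surf D
  surf_le : (surf D).restrict base ≤ const • meas
  layer_le : ∀ f : Eu d → ℝ≥0∞, Measurable f →
    ∫⁻ p, (∫⁻ t in Set.Ioo 0 width, f (p + t • dir)) ∂meas ≤ ∫⁻ x in D, f x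
  le_layer : ∀ f : Eu d → ℝ≥0∞, Measurable f → ∀ δ ≤ width,
    ∫⁻ x in {x | x ∈ D ∩ base ∧ height x < δ}, f x
      ≤ ∫⁻ p, (∫⁻ t in Set.Ioo 0 δ, f (p + t • dir)) ∂meas

attribute [instance] BoundaryChart.isFinite

set_option maxHeartbeats 1000000 in
/-- Every boundary point has a chart. The parametrization of the graph is Lipschitz, and so is its
inverse, an orthogonal projection; this compares the measures. -/
lemma exists_boundaryChart {d : ℕ} {D : Set (Eu d)} (hD : IsC2Domain D)
    {x₀ : Eu d} (hx₀ : x₀ ∈ frontier D) : ∃ c : BoundaryChart D, x₀ ∈ c.base := by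
  obtain ⟨e, he, γ, hγ, r, hr, hB⟩ := hD.boundary x₀ hx₀
  have hee : inner ℝ e e = (1 : ℝ) := by rw [real_inner_self_eq_norm_sq, he]; norm_num
  set θ : Eu d → ℝ := fun x => inner ℝ e x - γ (x - (inner ℝ e x) • e) with hθ
  have hθC : ContDiff ℝ 2 θ := by
    have h1 : ContDiff ℝ 2 (fun x : Eu d => inner ℝ e x) := contDiff_const.inner ℝ contDiff_id
    exact h1.sub (hγ.comp (contDiff_id.sub (h1.smul contDiff_const)))
  have hadd : ∀ x t, θ (x + t • e) = θ x + t := by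
    intro x t
    have h1 : inner ℝ e (x + t • e) = inner ℝ e x + t := by
      rw [inner_add_right, inner_smul_right, hee, mul_one]
    have h2 : x + t • e - (inner ℝ e x + t) • e = x - (inner ℝ e x) • e := by module
    simp only [hθ, h1, h2]; ring
  have hmem : ∀ x ∈ Metric.ball x₀ r, (x ∈ D ↔ 0 < θ x) := by
    intro x hx; rw [hB x hx, hθ]; simp
  have hDo := hD.isOpen
  have hfr0 : ∀ x ∈ Metric.ball x₀ r, x ∈ frontier D → θ x = 0 := by
    intro x hx hxf
    rw [hDo.frontier_eq] at hxf
    have h1 : ¬ 0 < θ x := fun h => hxf.2 ((hmem x hx).2 h)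
    by_contra hne
    have hneg : θ x < 0 := lt_of_le_of_ne (not_lt.1 h1) hne
    have hopen : IsOpen (Metric.ball x₀ r ∩ {x | θ x < 0}) :=
      Metric.isOpen_ball.inter (isOpen_lt hθC.continuous continuous_const)
    obtain ⟨z, hz, hzD⟩ := mem_closure_iff.1 hxf.1 _ hopen ⟨hx, hneg⟩
    exact absurd ((hmem z hz.1).1 hzD) (not_lt.2 hz.2.le)
  have h0fr : ∀ x ∈ Metric.ball x₀ r, θ x = 0 → x ∈ frontier D := by
    intro x hx h0
    rw [hDo.frontier_eq]
    refine ⟨?_, fun h => absurd ((hmem x hx).1 h) (by rw [h0]; exact lt_irrefl _)⟩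
    have ht : Tendsto (fun t : ℝ => x + t • e) (𝓝[>] 0) (𝓝 x) := by
      have : Continuous (fun t : ℝ => x + t • e) := by fun_prop
      have := this.tendsto 0
      simp only [zero_smul, add_zero] at this
      exact this.mono_left nhdsWithin_le_nhds
    refine mem_closure_of_tendsto ht ?_
    filter_upwards [ht (Metric.isOpen_ball.mem_nhds hx), self_mem_nhdsWithin] with t h1 h2
    rw [hmem _ h1, hadd, h0, zero_add]; exact h2
  -- The graph is parametrized by `Φ` over the hyperplane `Sᗮ`, and `P` inverts `Φ`.
  set S := Submodule.span ℝ {e} with hS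
  have hSe : ∀ y : Sᗮ, inner ℝ e (y : Eu d) = 0 := fun y =>
    Submodule.mem_orthogonal_singleton_iff_inner_right.1 y.2
  set P : Eu d →L[ℝ] Sᗮ := Sᗮ.orthogonalProjectionOnto with hP
  have hPn : ∀ x, ‖P x‖ ≤ ‖x‖ := fun x => Sᗮ.norm_orthogonalProjectionOnto_apply_le x
  have hPe : P e = 0 := by
    exact Submodule.orthogonalProjectionOnto_orthogonal_apply_eq_zero
      (Submodule.mem_span_singleton_self e)
  have hPy : ∀ y : Sᗮ, P (y : Eu d) = y := fun y =>
    Submodule.orthogonalProjectionOnto_mem_subspace_eq_self y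
  set Φ : Sᗮ → Eu d := fun y => (y : Eu d) + γ y • e with hΦ
  have hΦc : Continuous Φ := by
    have := hγ.continuous
    fun_prop
  have hPΦ : ∀ y, P (Φ y) = y := by
    intro y; simp only [hΦ, map_add, map_smul, hPe, hPy, smul_zero, add_zero]
  have hθΦ : ∀ y, θ (Φ y) = 0 := by
    intro y
    rw [hΦ, hadd, hθ]
    simp [hSe]
  have hdec : ∀ x, x = Φ (P x) + θ x • e := by
    intro x
    have h1 : ((P x : Sᗮ) : Eu d) = x - inner ℝ e x • e := by
      have := S.starProjection_add_starProjection_orthogonal x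
      have h2 : S.starProjection x = inner ℝ e x • e :=
        Submodule.starProjection_unit_singleton ℝ he x
      rw [h2] at this
      exact eq_sub_of_add_eq' this
    simp only [hΦ, hθ, h1]
    module
  have hFub : ∀ F : Eu d → ℝ≥0∞, Measurable F →
      ∫⁻ x, F x = ∫⁻ y, ∫⁻ t : ℝ, F (Φ y + t • e) := fun F hF =>
    lintegral_orthogonal he γ hF
  clear_value P θ Φ
  -- `γ` is only locally Lipschitz: on the parameters `Y` of a small piece of the graph, `Φ` is
  -- Lipschitz.
  obtain ⟨K, T, hT, hKT⟩ := (hγ.contDiffAt (x := ((P x₀ : Sᗮ) : Eu d))).of_le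
    (show (1 : WithTop ℕ∞) ≤ 2 by norm_num) |>.exists_lipschitzOnWith
  obtain ⟨ρ, hρ, hρT⟩ := Metric.mem_nhds_iff.1 hT
  set R := min (r / 2) ρ with hR
  have hR0 : 0 < R := by positivity
  set Y : Set Sᗮ := Φ ⁻¹' Metric.ball x₀ R with hY
  have hYo : IsOpen Y := Metric.isOpen_ball.preimage hΦc
  have hYγ : ∀ y ∈ Y, (y : Eu d) ∈ T := by
    intro y hy
    apply hρT
    have h0 : ‖Φ y - x₀‖ < R := mem_ball_iff_norm.1 (Set.mem_preimage.1 hy)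
    have h1 : y - P x₀ = P (Φ y - x₀) := by rw [map_sub, hPΦ]
    rw [mem_ball_iff_norm, ← Submodule.coe_sub, h1]
    exact (hPn _).trans_lt (h0.trans_le (min_le_right _ _))
  have hΦL : LipschitzOnWith (1 + K) Φ Y := by
    refine LipschitzOnWith.of_dist_le_mul fun x hx y hy => ?_
    have h1 := hKT.dist_le_mul _ (hYγ x hx) _ (hYγ y hy)
    have h2 : Φ x - Φ y = ((x : Eu d) - y) + (γ x - γ y) • e := by simp only [hΦ]; module
    have h3 : dist x y = dist (x : Eu d) y := rfl
    rw [dist_eq_norm, dist_eq_norm] at h1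
    rw [dist_eq_norm, h2, h3, dist_eq_norm, NNReal.coe_add, NNReal.coe_one, add_mul, one_mul]
    refine (norm_add_le _ _).trans ?_
    rw [norm_smul, he, mul_one]
    gcongr
  have hPL : LipschitzWith 1 P := by
    refine LipschitzWith.of_dist_le_mul fun x y => ?_
    rw [dist_eq_norm, dist_eq_norm, ← map_sub, NNReal.coe_one, one_mul]
    exact hPn _
  have hrank : Module.finrank ℝ Sᗮ = d - 1 := by
    have h1 := S.finrank_add_finrank_orthogonal
    rw [hS, finrank_span_singleton (by rintro rfl; simp at he), finrank_euclideanSpace,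
      Fintype.card_fin] at h1
    rw [hS]; omega
  have hvol : (volume : Measure Sᗮ) = Measure.euclideanHausdorffMeasure (d - 1) := by
    rw [← hrank, InnerProductSpace.euclideanHausdorffMeasure_eq_volume]
  have hYsub : ∀ y ∈ Y, Φ y ∈ Metric.ball x₀ r := fun y hy =>
    Metric.ball_subset_ball ((min_le_left _ _).trans (by linarith)) hy
  have hfin : volume Y < ⊤ := by
    refine (measure_mono (t := Metric.closedBall 0 (‖x₀‖ + R)) fun y hy => ?_).trans_lt
      measure_closedBall_lt_top
    rw [mem_closedBall_zero_iff]
    have h1 : ‖Φ y - x₀‖ < R := mem_ball_iff_norm.1 hy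
    calc ‖y‖ = ‖P (Φ y)‖ := by rw [hPΦ]
      _ ≤ ‖Φ y‖ := hPn _
      _ ≤ ‖x₀‖ + ‖Φ y - x₀‖ := by simpa using norm_add_le x₀ (Φ y - x₀)
      _ ≤ _ := by linarith
  -- The base is so small that the foot of each of its points on the graph lies in the ball of
  -- radius `R`, and the layers over that piece stay in the ball of radius `r`.
  refine ⟨⟨e, θ, Metric.ball x₀ (R / 2) ∩ {x | |θ x| < min (R / 2) (r / 2)}, r / 2,
    (volume.restrict Y).map Φ, (1 + K) ^ (d - 1), he, hθC, hadd, ?_, ?_, by positivity, ?_, ?_, ?_,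
    ?_, ?_, ?_, ?_, ?_, ?_⟩, ?_⟩
  · exact Metric.isOpen_ball.inter (isOpen_lt hθC.continuous.abs continuous_const)
  · exact Metric.isBounded_ball.subset Set.inter_subset_left
  · have : IsFiniteMeasure (volume.restrict Y) := ⟨by simpa using hfin⟩
    infer_instance
  · exact fun x hx => hmem x (Metric.ball_subset_ball
      (by have := min_le_left (r / 2) ρ; rw [← hR] at this; linarith) hx.1)
  · exact fun x hx => (le_abs_self _).trans_lt (hx.2.trans_le (min_le_right _ _))
  · exact fun x hx => hfr0 x (Metric.ball_subset_ball
      (by have := min_le_left (r / 2) ρ; rw [← hR] at this; linarith) hx.1)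
  · intro x hx
    have h1 : x - θ x • e = Φ (P x) := sub_eq_of_eq_add (hdec x)
    rw [h1]
    refine h0fr _ ?_ (hθΦ _)
    rw [← h1, mem_ball_iff_norm]
    have h2 : ‖x - x₀‖ < R / 2 := mem_ball_iff_norm.1 hx.1
    have h3 : ‖θ x • e‖ < R / 2 := by
      rw [norm_smul, he, mul_one]; exact hx.2.trans_le (min_le_left _ _)
    have h4 : R ≤ r / 2 := min_le_left _ _
    calc ‖x - θ x • e - x₀‖ = ‖(x - x₀) - θ x • e‖ := by congr 1; abel
      _ ≤ _ := norm_sub_le _ _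
      _ < r := by linarith
  · refine Measure.le_iff.2 fun A hA => ?_
    rw [Measure.map_apply hΦc.measurable hA, Measure.restrict_apply (hΦc.measurable hA), surf,
      Measure.restrict_apply hA, hvol]
    calc _ ≤ (Measure.euclideanHausdorffMeasure (d - 1) : Measure Sᗮ) (P '' (A ∩ frontier D)) := by
          refine measure_mono fun y hy => ⟨Φ y, ⟨hy.1, h0fr _ (hYsub y hy.2) (hθΦ y)⟩, hPΦ y⟩
      _ ≤ _ := by
          simpa using euclideanHausdorffMeasure_image_le hPL.lipschitzOnWith (d - 1)
  · refine Measure.le_iff.2 fun A hA => ?_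
    have hUm : MeasurableSet (Metric.ball x₀ (R / 2) ∩ {x | |θ x| < min (R / 2) (r / 2)}) :=
      (Metric.isOpen_ball.inter (isOpen_lt hθC.continuous.abs continuous_const)).measurableSet
    rw [Measure.restrict_apply hA, surf, Measure.restrict_apply (hA.inter hUm), Measure.smul_apply,
      Measure.map_apply hΦc.measurable hA, Measure.restrict_apply (hΦc.measurable hA), hvol]
    calc _ ≤ (Measure.euclideanHausdorffMeasure (d - 1) : Measure (Eu d)) (Φ '' (Φ ⁻¹' A ∩ Y)) := by
          refine measure_mono fun x hx => ?_
          have hx1 : x ∈ Metric.ball x₀ R := Metric.ball_subset_ball (by linarith) hx.1.2.1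
          have h0 : θ x = 0 := hfr0 x (Metric.ball_subset_ball
            (by have := min_le_left (r / 2) ρ; rw [← hR] at this; linarith) hx1) hx.2
          have h1 := hdec x
          rw [h0, zero_smul, add_zero] at h1
          exact ⟨P x, ⟨by rw [Set.mem_preimage, ← h1]; exact hx.1.1,
            by rw [hY, Set.mem_preimage, ← h1]; exact hx1⟩, h1.symm⟩
      _ ≤ _ := by
          have := euclideanHausdorffMeasure_image_le (hΦL.mono Set.inter_subset_right
            (s := Φ ⁻¹' A ∩ Y)) (d - 1)
          refine this.trans (le_of_eq ?_)
          rw [ENNReal.smul_def, smul_eq_mul, ENNReal.coe_pow]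
  · intro f hf
    have hfm : Measurable (fun p : Eu d => ∫⁻ t in Set.Ioo 0 (r / 2), f (p + t • e)) := by
      refine Measurable.lintegral_prod_right' (f := fun q : Eu d × ℝ => f (q.1 + q.2 • e)) ?_
      exact hf.comp (by fun_prop)
    rw [lintegral_map hfm hΦc.measurable, ← lintegral_indicator hDo.measurableSet,
      hFub _ (hf.indicator hDo.measurableSet)]
    refine (setLIntegral_mono' hYo.measurableSet fun y hy => ?_).trans (setLIntegral_le_lintegral Y _)
    refine (setLIntegral_mono' measurableSet_Ioo fun t ht => ?_).trans
      (setLIntegral_le_lintegral _ _)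
    have h1 : Φ y + t • e ∈ Metric.ball x₀ r := by
      rw [mem_ball_iff_norm]
      have h2 : ‖Φ y - x₀‖ < R := mem_ball_iff_norm.1 hy
      have h3 : ‖t • e‖ < r / 2 := by
        rw [norm_smul, he, mul_one, Real.norm_of_nonneg ht.1.le]; exact ht.2
      have h4 : R ≤ r / 2 := min_le_left _ _
      calc ‖Φ y + t • e - x₀‖ = ‖(Φ y - x₀) + t • e‖ := by congr 1; abel
        _ ≤ _ := norm_add_le _ _
        _ < r := by linarith
    have h2 : Φ y + t • e ∈ D := by
      rw [hmem _ h1, hadd, hθΦ, zero_add]; exact ht.1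
    rw [Set.indicator_of_mem h2]
  · intro f hf δ hδ
    have hfm : Measurable (fun p : Eu d => ∫⁻ t in Set.Ioo 0 δ, f (p + t • e)) := by
      refine Measurable.lintegral_prod_right' (f := fun q : Eu d × ℝ => f (q.1 + q.2 • e)) ?_
      exact hf.comp (by fun_prop)
    have hLm : MeasurableSet {x | x ∈ D ∩ (Metric.ball x₀ (R / 2) ∩
        {x | |θ x| < min (R / 2) (r / 2)}) ∧ θ x < δ} :=
      ((hDo.inter (Metric.isOpen_ball.inter (isOpen_lt hθC.continuous.abs continuous_const))).inter
        (isOpen_lt hθC.continuous continuous_const)).measurableSet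
    rw [lintegral_map hfm hΦc.measurable, ← lintegral_indicator hLm,
      hFub _ (hf.indicator hLm),
      ← lintegral_indicator hYo.measurableSet]
    refine lintegral_mono fun y => ?_
    have key : ∀ t, Φ y + t • e ∈ {x | x ∈ D ∩ (Metric.ball x₀ (R / 2) ∩
        {x | |θ x| < min (R / 2) (r / 2)}) ∧ θ x < δ} → y ∈ Y ∧ t ∈ Set.Ioo 0 δ := by
      intro t ht
      have hθt : θ (Φ y + t • e) = t := by rw [hadd, hθΦ, zero_add]
      have h1 : Φ y + t • e ∈ Metric.ball x₀ r := Metric.ball_subset_ball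
        (by have := min_le_left (r / 2) ρ; rw [← hR] at this; linarith) ht.1.2.1
      have h2 := (hmem _ h1).1 ht.1.1
      have h3 := ht.2
      have h4 := ht.1.2.2
      simp only [Set.mem_ofPred_eq] at h4
      rw [hθt] at h2 h3 h4
      refine ⟨?_, h2, h3⟩
      rw [hY, Set.mem_preimage, mem_ball_iff_norm]
      have h5 : ‖Φ y + t • e - x₀‖ < R / 2 := mem_ball_iff_norm.1 ht.1.2.1
      have h6 : ‖t • e‖ < R / 2 := by
        rw [norm_smul, he, mul_one]; exact h4.trans_le (min_le_left _ _)
      calc ‖Φ y - x₀‖ = ‖(Φ y + t • e - x₀) - t • e‖ := by congr 1; abel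
        _ ≤ _ := norm_sub_le _ _
        _ < R := by linarith
    by_cases hy : y ∈ Y
    · rw [Set.indicator_of_mem hy, ← lintegral_indicator measurableSet_Ioo]
      refine lintegral_mono fun t => ?_
      by_cases ht : Φ y + t • e ∈ {x | x ∈ D ∩ (Metric.ball x₀ (R / 2) ∩
        {x | |θ x| < min (R / 2) (r / 2)}) ∧ θ x < δ}
      · rw [Set.indicator_of_mem (key t ht).2, Set.indicator_of_mem ht]
      · rw [Set.indicator_of_notMem ht]; exact zero_le
    · rw [Set.indicator_of_notMem hy]
      refine (lintegral_eq_zero_of_ae_eq_zero (Eventually.of_forall fun t => ?_)).le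
      exact Set.indicator_of_notMem (fun h => hy (key t h).1) _
  · refine ⟨Metric.mem_ball_self (by positivity), ?_⟩
    simp only [Set.mem_ofPred_eq, hfr0 x₀ (Metric.mem_ball_self hr) hx₀, abs_zero]
    positivity

/-! ### The trace inequality -/

section

/-- Finitely many charts that cover the boundary of `D`, with a smooth partition of unity on the
closure of `D` that consists of a function for each chart and a function supported in `D`. -/
structure BoundaryAtlas {d : ℕ} (D : Set (Eu d)) where
  ι : Type
  fintype : Fintype ι
  chart : ι → BoundaryChart D
  cutoff : ι → Eu d → ℝ
  inner : Eu d → ℝ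
  contDiff_cutoff : ∀ k, ContDiff ℝ ∞ (cutoff k)
  contDiff_inner : ContDiff ℝ ∞ inner
  cutoff_nonneg : ∀ k x, 0 ≤ cutoff k x
  inner_nonneg : ∀ x, 0 ≤ inner x
  compact_cutoff : ∀ k, HasCompactSupport (cutoff k)
  compact_inner : HasCompactSupport inner
  tsupport_cutoff : ∀ k, tsupport (cutoff k) ⊆ (chart k).base
  tsupport_inner : tsupport inner ⊆ D
  sum_eq_one : ∀ x ∈ closure D, ∑ k, cutoff k x + inner x = 1

attribute [instance] BoundaryAtlas.fintype

lemma IsC2Domain.isCompact_closure {d : ℕ} {D : Set (Eu d)} (hD : IsC2Domain D) :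
    IsCompact (closure D) :=
  Metric.isCompact_of_isClosed_isBounded isClosed_closure hD.isBounded.closure

lemma exists_boundaryAtlas {d : ℕ} {D : Set (Eu d)} (hD : IsC2Domain D) :
    Nonempty (BoundaryAtlas D) := by
  classical
  have hfc : IsCompact (frontier D) :=
    hD.isCompact_closure.of_isClosed_subset isClosed_frontier frontier_subset_closure
  choose c hc using fun x : frontier D => exists_boundaryChart hD x.2
  obtain ⟨t, ht⟩ := hfc.elim_finite_subcover (fun x => (c x).base) (fun x => (c x).isOpen_base)
    (fun x hx => Set.mem_iUnion.2 ⟨⟨x, hx⟩, hc ⟨x, hx⟩⟩)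
  let V : Option t → Set (Eu d) := fun k => k.elim D (fun x => (c x).base)
  have hVo : ∀ k, IsOpen (V k) := by
    rintro (_ | k)
    · exact hD.isOpen
    · exact (c k).isOpen_base
  have hVb : ∀ k, Bornology.IsBounded (V k) := by
    rintro (_ | k)
    · exact hD.isBounded
    · exact (c k).isBounded_base
  have hVc : closure D ⊆ ⋃ k, V k := by
    intro x hx
    by_cases hxD : x ∈ D
    · exact Set.mem_iUnion.2 ⟨none, hxD⟩
    · have hxf : x ∈ frontier D := by rw [hD.isOpen.frontier_eq]; exact ⟨hx, hxD⟩
      obtain ⟨i, hi, hxi⟩ := Set.mem_iUnion₂.1 (ht hxf)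
      exact Set.mem_iUnion.2 ⟨some ⟨i, hi⟩, hxi⟩
  obtain ⟨f, hf⟩ := SmoothPartitionOfUnity.exists_isSubordinate (modelWithCornersSelf ℝ (Eu d))
    isClosed_closure V hVo hVc
  have hcs : ∀ k, HasCompactSupport (f k) := fun k =>
    Metric.isCompact_of_isClosed_isBounded (isClosed_tsupport _) ((hVb k).subset (hf k))
  refine ⟨⟨t, inferInstance, fun k => c k, fun k => f (some k), f none,
    fun k => (f (some k)).contMDiff.contDiff, (f none).contMDiff.contDiff,
    fun k x => f.nonneg _ x, fun x => f.nonneg _ x, fun k => hcs _, hcs _, fun k => hf (some k),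
    hf none, fun x hx => ?_⟩⟩
  have h1 := f.sum_eq_one hx
  rw [finsum_eq_sum_of_fintype, Fintype.sum_option] at h1
  rw [add_comm]; exact h1

lemma BoundaryAtlas.frontier_subset {d : ℕ} {D : Set (Eu d)} (hDo : IsOpen D)
    (A : BoundaryAtlas D) : frontier D ⊆ ⋃ k, (A.chart k).base := by
  intro x hx
  by_contra hn
  have h1 : ∀ k, A.cutoff k x = 0 := fun k => by
    refine image_eq_zero_of_notMem_tsupport fun h => hn ?_
    exact Set.mem_iUnion.2 ⟨k, A.tsupport_cutoff k h⟩
  have h2 : A.inner x = 0 := by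
    refine image_eq_zero_of_notMem_tsupport fun h => ?_
    rw [hDo.frontier_eq] at hx
    exact hx.2 (A.tsupport_inner h)
  have h3 := A.sum_eq_one x (frontier_subset_closure hx)
  simp [h1, h2] at h3

/-- The squared length of the gradient. -/
noncomputable def gradSq {d : ℕ} (f : Eu d → ℂ) (x : Eu d) : ℝ≥0∞ := ∑ i, ‖pderiv i f x‖ₑ ^ 2

lemma continuous_pderiv {d : ℕ} {f : Eu d → ℂ} (hf : ContDiff ℝ 1 f) (i : Fin d) :
    Continuous (pderiv i f) :=
  (hf.continuous_fderiv (by simp)).clm_apply continuous_const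

lemma measurable_gradSq {d : ℕ} {f : Eu d → ℂ} (hf : ContDiff ℝ 1 f) : Measurable (gradSq f) := by
  unfold gradSq
  exact Finset.measurable_sum _ fun i _ => ((continuous_pderiv hf i).measurable.enorm).pow_const 2

lemma fderiv_eq_sum {d : ℕ} {f : Eu d → ℂ} (x z : Eu d) :
    fderiv ℝ f x z = ∑ i, (z i : ℂ) * pderiv i f x := by
  conv_lhs => rw [← (EuclideanSpace.basisFun (Fin d) ℝ).sum_repr z]
  simp [pderiv, map_sum]

lemma enorm_fderiv_sq_le {d : ℕ} {f : Eu d → ℂ} (x z : Eu d) :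
    ‖fderiv ℝ f x z‖ₑ ^ 2 ≤ ‖z‖ₑ ^ 2 * gradSq f x := by
  have h : ‖fderiv ℝ f x z‖ ^ 2 ≤ ‖z‖ ^ 2 * ∑ i, ‖pderiv i f x‖ ^ 2 := by
    rw [fderiv_eq_sum, EuclideanSpace.norm_sq_eq]
    calc _ ≤ (∑ i, ‖z i‖ * ‖pderiv i f x‖) ^ 2 := by
          gcongr
          refine (norm_sum_le _ _).trans (le_of_eq ?_)
          simp
      _ ≤ _ := Finset.sum_mul_sq_le_sq_mul_sq _ _ _
  have h2 := ENNReal.ofReal_le_ofReal h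
  rw [ENNReal.ofReal_mul (by positivity), ENNReal.ofReal_sum_of_nonneg (fun _ _ => by positivity)]
    at h2
  simpa only [gradSq, ENNReal.ofReal_pow (norm_nonneg _), ofReal_norm] using h2

lemma deriv_line {d : ℕ} {f : Eu d → ℂ} (hf : ContDiff ℝ 1 f) (x z : Eu d) (t : ℝ) :
    deriv (fun r : ℝ => f (x + r • z)) t = fderiv ℝ f (x + t • z) z := by
  have h1 : HasDerivAt (fun r : ℝ => x + r • z) z t := by
    simpa using ((hasDerivAt_id t).smul_const z).const_add x
  exact ((hf.differentiable (by simp) _).hasFDerivAt.comp_hasDerivAt t h1).deriv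

lemma contDiff_line {d : ℕ} {f : Eu d → ℂ} (hf : ContDiff ℝ 1 f) (x z : Eu d) :
    ContDiff ℝ 1 (fun r : ℝ => f (x + r • z)) :=
  hf.comp (contDiff_const.add (contDiff_id.smul contDiff_const))

namespace BoundaryChart

variable {d : ℕ} {D : Set (Eu d)}

lemma enorm_sq_le (c : BoundaryChart D) {f : Eu d → ℂ} (hf : ContDiff ℝ 1 f) {s t : ℝ}
    (hs : 0 < s) (ht : t ∈ Set.Icc 0 s) (p : Eu d) :
    ‖f (p + t • c.dir)‖ₑ ^ 2 ≤
      ENNReal.ofReal (2 / s) * (∫⁻ r in Set.Ioo 0 s, ‖f (p + r • c.dir)‖ₑ ^ 2)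
      + ENNReal.ofReal (2 * s) * ∫⁻ r in Set.Ioo 0 s, gradSq f (p + r • c.dir) := by
  refine (enorm_sq_le_lintegral (contDiff_line hf p c.dir) hs ht).trans ?_
  gcongr with r
  rw [deriv_line hf]
  have h1 : ‖c.dir‖ₑ = 1 := by rw [← ofReal_norm, c.norm_dir, ENNReal.ofReal_one]
  simpa [h1] using enorm_fderiv_sq_le (f := f) (p + r • c.dir) c.dir

lemma layer_le' (c : BoundaryChart D) {g : Eu d → ℝ≥0∞} (hg : Measurable g) {s : ℝ}
    (hs : s ≤ c.width) :
    ∫⁻ p, (∫⁻ t in Set.Ioo 0 s, g (p + t • c.dir)) ∂c.meas ≤ ∫⁻ x in D, g x :=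
  (lintegral_mono fun _ => lintegral_mono_set (Set.Ioo_subset_Ioo_right hs)).trans
    (c.layer_le g hg)

lemma measurable_inner_lintegral (e : Eu d) (s : ℝ) {g : Eu d → ℝ≥0∞} (hg : Measurable g) :
    Measurable fun p : Eu d => ∫⁻ t in Set.Ioo 0 s, g (p + t • e) :=
  Measurable.lintegral_prod_right' (f := fun q : Eu d × ℝ => g (q.1 + q.2 • e))
    (hg.comp (by fun_prop))

/-- The bound of `enorm_sq_le`, integrated over the boundary. -/
lemma lintegral_bound_le (c : BoundaryChart D) {f : Eu d → ℂ} (hf : ContDiff ℝ 1 f) {s : ℝ}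
    (hsw : s ≤ c.width) :
    ∫⁻ p, (ENNReal.ofReal (2 / s) * (∫⁻ r in Set.Ioo 0 s, ‖f (p + r • c.dir)‖ₑ ^ 2)
      + ENNReal.ofReal (2 * s) * ∫⁻ r in Set.Ioo 0 s, gradSq f (p + r • c.dir)) ∂c.meas ≤
    ENNReal.ofReal (2 / s) * (∫⁻ x in D, ‖f x‖ₑ ^ 2)
      + ENNReal.ofReal (2 * s) * ∫⁻ x in D, gradSq f x := by
  have hm0 : Measurable (fun x => ‖f x‖ₑ ^ 2) := (hf.continuous.measurable.enorm).pow_const 2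
  have hm1 := measurable_gradSq hf
  rw [lintegral_add_left ((measurable_inner_lintegral c.dir s hm0).const_mul _),
    lintegral_const_mul _ (measurable_inner_lintegral c.dir s hm0),
    lintegral_const_mul _ (measurable_inner_lintegral c.dir s hm1)]
  exact add_le_add (mul_le_mul_right (c.layer_le' hm0 hsw) _)
    (mul_le_mul_right (c.layer_le' hm1 hsw) _)

lemma lintegral_surf_le (c : BoundaryChart D) {f : Eu d → ℂ} (hf : ContDiff ℝ 1 f) {s : ℝ}
    (hs : 0 < s) (hsw : s ≤ c.width) :
    ∫⁻ x in c.base, ‖f x‖ₑ ^ 2 ∂(surf D) ≤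
      c.const * (ENNReal.ofReal (2 / s) * (∫⁻ x in D, ‖f x‖ₑ ^ 2)
      + ENNReal.ofReal (2 * s) * ∫⁻ x in D, gradSq f x) := by
  calc _ ≤ ∫⁻ x, ‖f x‖ₑ ^ 2 ∂(c.const • c.meas) := lintegral_mono' c.surf_le le_rfl
    _ = c.const * ∫⁻ x, ‖f x‖ₑ ^ 2 ∂c.meas := by
        rw [lintegral_smul_measure, ENNReal.smul_def, smul_eq_mul]
    _ ≤ _ := by
        gcongr
        refine (lintegral_mono fun p => ?_).trans (c.lintegral_bound_le hf hsw)
        simpa using c.enorm_sq_le hf hs (t := 0) ⟨le_rfl, hs.le⟩ p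

lemma lintegral_layer_le (c : BoundaryChart D) {f : Eu d → ℂ} (hf : ContDiff ℝ 1 f) {s δ : ℝ}
    (hs : 0 < s) (hsw : s ≤ c.width) (hδ : δ ≤ s) :
    ∫⁻ x in {x | x ∈ D ∩ c.base ∧ c.height x < δ}, ‖f x‖ₑ ^ 2 ≤
      ENNReal.ofReal δ * (ENNReal.ofReal (2 / s) * (∫⁻ x in D, ‖f x‖ₑ ^ 2)
      + ENNReal.ofReal (2 * s) * ∫⁻ x in D, gradSq f x) := by
  have hm0 : Measurable (fun x => ‖f x‖ₑ ^ 2) := (hf.continuous.measurable.enorm).pow_const 2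
  refine (c.le_layer _ hm0 δ (hδ.trans hsw)).trans ?_
  refine le_trans ?_ (mul_le_mul_right (c.lintegral_bound_le hf hsw) _)
  rw [← lintegral_const_mul' _ _ ENNReal.ofReal_ne_top]
  refine lintegral_mono fun p => ?_
  calc _ ≤ ∫⁻ _ in Set.Ioo 0 δ, (ENNReal.ofReal (2 / s) *
        (∫⁻ r in Set.Ioo 0 s, ‖f (p + r • c.dir)‖ₑ ^ 2)
      + ENNReal.ofReal (2 * s) * ∫⁻ r in Set.Ioo 0 s, gradSq f (p + r • c.dir)) :=
        setLIntegral_mono' measurableSet_Ioo fun t ht =>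
          c.enorm_sq_le hf hs ⟨ht.1.le, ht.2.le.trans hδ⟩ p
    _ = _ := by
        rw [lintegral_const, Measure.restrict_apply_univ, Real.volume_Ioo, sub_zero, mul_comm]

end BoundaryChart

variable {d : ℕ} {D : Set (Eu d)}

lemma BoundaryAtlas.exists_width (A : BoundaryAtlas D) :
    ∃ s > 0, ∀ k, s ≤ (A.chart k).width := by
  obtain h | h := isEmpty_or_nonempty A.ι
  · exact ⟨1, one_pos, fun k => (h.false k).elim⟩
  · refine ⟨Finset.univ.inf' Finset.univ_nonempty fun k => (A.chart k).width, ?_,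
      fun k => Finset.inf'_le _ (Finset.mem_univ k)⟩
    rw [gt_iff_lt, Finset.lt_inf'_iff]
    exact fun k _ => (A.chart k).width_pos

lemma surf_compl_frontier (D : Set (Eu d)) : surf D (frontier D)ᶜ = 0 := by
  rw [surf, Measure.restrict_apply isClosed_frontier.measurableSet.compl]; simp

lemma BoundaryAtlas.lintegral_surf_le_sum (hDo : IsOpen D) (A : BoundaryAtlas D)
    (g : Eu d → ℝ≥0∞) :
    ∫⁻ x, g x ∂(surf D) ≤ ∑ k, ∫⁻ x in (A.chart k).base, g x ∂(surf D) := by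
  have h1 : (surf D).restrict (⋃ k, (A.chart k).base) = surf D := by
    refine Measure.restrict_eq_self_of_ae_mem ?_
    have : ∀ᵐ x ∂(surf D), x ∈ frontier D := by
      rw [ae_iff]; exact surf_compl_frontier D
    filter_upwards [this] with x hx using A.frontier_subset hDo hx
  calc _ = ∫⁻ x in ⋃ k, (A.chart k).base, g x ∂(surf D) := by rw [h1]
    _ ≤ _ := by
      refine (lintegral_iUnion_le _ _).trans (le_of_eq ?_)
      rw [tsum_fintype]

/-- The trace inequality: the boundary values of a `C¹` function are controlled by its `H¹` norm,
with an arbitrarily small constant in front of the gradient. -/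
lemma exists_trace_le (hD : IsC2Domain D) {ε : ℝ} (hε : 0 < ε) :
    ∃ C : ℝ, 0 ≤ C ∧ ∀ f : Eu d → ℂ, ContDiff ℝ 1 f →
      ∫⁻ x, ‖f x‖ₑ ^ 2 ∂(surf D) ≤
        ENNReal.ofReal C * (∫⁻ x in D, ‖f x‖ₑ ^ 2) + ENNReal.ofReal ε * ∫⁻ x in D, gradSq f x := by
  obtain ⟨A⟩ := exists_boundaryAtlas hD
  obtain ⟨s₀, hs₀, hw⟩ := A.exists_width
  -- On lines of length `s` the constant in front of the derivative is `2 s`, up to the comparison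
  -- of measures.
  set M : ℝ := ∑ k, ((A.chart k).const : ℝ) with hM
  have hM0 : 0 ≤ M := Finset.sum_nonneg fun _ _ => NNReal.coe_nonneg _
  set s := min s₀ (ε / (2 * (M + 1))) with hs
  have hs0 : 0 < s := by positivity
  have hMs : M * (2 * s) ≤ ε := by
    have h1 : s ≤ ε / (2 * (M + 1)) := min_le_right _ _
    rw [le_div_iff₀ (by positivity)] at h1
    nlinarith
  refine ⟨M * (2 / s), by positivity, fun f hf => ?_⟩
  have hMe : ENNReal.ofReal M = ∑ k, ((A.chart k).const : ℝ≥0∞) := by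
    rw [hM, ENNReal.ofReal_sum_of_nonneg fun _ _ => NNReal.coe_nonneg _]
    simp
  calc _ ≤ _ := A.lintegral_surf_le_sum hD.isOpen _
    _ ≤ ∑ k, ((A.chart k).const : ℝ≥0∞) * (ENNReal.ofReal (2 / s) * (∫⁻ x in D, ‖f x‖ₑ ^ 2)
      + ENNReal.ofReal (2 * s) * ∫⁻ x in D, gradSq f x) :=
        Finset.sum_le_sum fun k _ => (A.chart k).lintegral_surf_le hf hs0
          ((min_le_left _ _).trans (hw k))
    _ = ENNReal.ofReal (M * (2 / s)) * (∫⁻ x in D, ‖f x‖ₑ ^ 2)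
      + ENNReal.ofReal (M * (2 * s)) * ∫⁻ x in D, gradSq f x := by
        rw [← Finset.sum_mul, ← hMe, ENNReal.ofReal_mul hM0, ENNReal.ofReal_mul hM0]
        ring
    _ ≤ _ := by gcongr

/-- The part of the `L²` norm of a `C¹` function that is carried by a thin boundary layer is small
in comparison with its `H¹` norm. -/
lemma exists_layer_le (hD : IsC2Domain D) {ε : ℝ} (hε : 0 < ε) :
    ∃ K : Set (Eu d), IsCompact K ∧ K ⊆ D ∧ ∀ f : Eu d → ℂ, ContDiff ℝ 1 f →
      ∫⁻ x in D \ K, ‖f x‖ₑ ^ 2 ≤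
        ENNReal.ofReal ε * ((∫⁻ x in D, ‖f x‖ₑ ^ 2) + ∫⁻ x in D, gradSq f x) := by
  obtain ⟨A⟩ := exists_boundaryAtlas hD
  obtain ⟨s, hs, hw⟩ := A.exists_width
  set N : ℝ := (Fintype.card A.ι : ℝ) with hN
  have hN0 : 0 ≤ N := by positivity
  set M : ℝ := max (2 / s) (2 * s) with hM
  have hM0 : 0 < M := by positivity
  set δ := min s (ε / (N * M + 1)) with hδ
  have hδ0 : 0 < δ := by positivity
  have hNδ : N * (δ * M) ≤ ε := by
    have h1 : δ ≤ ε / (N * M + 1) := min_le_right _ _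
    rw [le_div_iff₀ (by positivity)] at h1
    nlinarith
  set L : A.ι → Set (Eu d) := fun k => {x | x ∈ (A.chart k).base ∧ (A.chart k).height x < δ} with hL
  have hLo : ∀ k, IsOpen (L k) := fun k => (A.chart k).isOpen_base.inter
    (isOpen_lt (A.chart k).contDiff_height.continuous continuous_const)
  refine ⟨closure D \ ⋃ k, L k, hD.isCompact_closure.diff (isOpen_iUnion hLo), ?_, fun f hf => ?_⟩
  · rintro x ⟨hx, hxn⟩
    by_contra hxD
    have hxf : x ∈ frontier D := by rw [hD.isOpen.frontier_eq]; exact ⟨hx, hxD⟩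
    obtain ⟨k, hk⟩ := Set.mem_iUnion.1 (A.frontier_subset hD.isOpen hxf)
    refine hxn (Set.mem_iUnion.2 ⟨k, hk, ?_⟩)
    rw [(A.chart k).height_eq_zero x hk hxf]; exact hδ0
  · have hsub : D \ (closure D \ ⋃ k, L k) ⊆
        ⋃ k, {x | x ∈ D ∩ (A.chart k).base ∧ (A.chart k).height x < δ} := by
      rintro x ⟨hxD, hx⟩
      have : x ∈ ⋃ k, L k := by
        by_contra h
        exact hx ⟨subset_closure hxD, h⟩
      obtain ⟨k, hk⟩ := Set.mem_iUnion.1 this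
      exact Set.mem_iUnion.2 ⟨k, ⟨hxD, hk.1⟩, hk.2⟩
    calc _ ≤ _ := lintegral_mono_set hsub
      _ ≤ ∑ k, ∫⁻ x in {x | x ∈ D ∩ (A.chart k).base ∧ (A.chart k).height x < δ}, ‖f x‖ₑ ^ 2 := by
          refine (lintegral_iUnion_le _ _).trans (le_of_eq ?_)
          rw [tsum_fintype]
      _ ≤ ∑ _k : A.ι, ENNReal.ofReal δ * (ENNReal.ofReal M * ((∫⁻ x in D, ‖f x‖ₑ ^ 2) +
            ∫⁻ x in D, gradSq f x)) := by
          refine Finset.sum_le_sum fun k _ => ?_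
          refine ((A.chart k).lintegral_layer_le hf hs (hw k) (min_le_left _ _)).trans ?_
          rw [mul_add (ENNReal.ofReal M)]
          gcongr
          · exact le_max_left _ _
          · exact le_max_right _ _
      _ = ENNReal.ofReal (N * (δ * M)) * ((∫⁻ x in D, ‖f x‖ₑ ^ 2) +
            ∫⁻ x in D, gradSq f x) := by
          rw [Finset.sum_const, Finset.card_univ, nsmul_eq_mul, ENNReal.ofReal_mul hN0,
            ENNReal.ofReal_mul hδ0.le, hN, ENNReal.ofReal_natCast]
          ring
      _ ≤ _ := by gcongr

lemma isFiniteMeasure_surf (hD : IsC2Domain D) : IsFiniteMeasure (surf D) := by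
  obtain ⟨A⟩ := exists_boundaryAtlas hD
  refine ⟨?_⟩
  have h := A.lintegral_surf_le_sum hD.isOpen 1
  simp only [Pi.one_apply, lintegral_one] at h
  refine h.trans_lt (ENNReal.sum_lt_top.2 fun k _ => ?_)
  refine (Measure.le_iff'.1 (A.chart k).surf_le Set.univ).trans_lt ?_
  rw [Measure.smul_apply, ENNReal.smul_def, smul_eq_mul]
  exact ENNReal.mul_lt_top ENNReal.coe_lt_top (measure_lt_top _ _)

end

/-! ### Averages in the interior -/

section

variable {d : ℕ} {D : Set (Eu d)}

lemma sq_lintegral_le {X : Type*} [MeasurableSpace X] (μ : Measure X) {g : X → ℝ≥0∞}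
    (hg : AEMeasurable g μ) : (∫⁻ x, g x ∂μ) ^ 2 ≤ μ Set.univ * ∫⁻ x, g x ^ 2 ∂μ := by
  have h := ENNReal.lintegral_mul_le_Lp_mul_Lq μ Real.HolderConjugate.two_two
    (f := fun _ => 1) (g := g) aemeasurable_const hg
  simp only [Pi.mul_apply, one_mul, lintegral_const, ENNReal.rpow_ofNat, one_pow] at h
  calc _ ≤ ((μ Set.univ) ^ (1 / 2 : ℝ) * (∫⁻ x, g x ^ 2 ∂μ) ^ (1 / 2 : ℝ)) ^ 2 := by gcongr
    _ = _ := by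
      rw [mul_pow, ← ENNReal.rpow_natCast, ← ENNReal.rpow_natCast, ← ENNReal.rpow_mul,
        ← ENNReal.rpow_mul]
      norm_num

lemma enorm_add_sq_le (a b : ℂ) : ‖a + b‖ₑ ^ 2 ≤ 2 * ‖a‖ₑ ^ 2 + 2 * ‖b‖ₑ ^ 2 := by
  have h : ‖a + b‖ ^ 2 ≤ 2 * ‖a‖ ^ 2 + 2 * ‖b‖ ^ 2 := by
    have := norm_add_le a b
    nlinarith [sq_nonneg (‖a‖ - ‖b‖), norm_nonneg (a + b)]
  have h2 := ENNReal.ofReal_le_ofReal h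
  rw [ENNReal.ofReal_add (by positivity) (by positivity), ENNReal.ofReal_mul (by positivity),
    ENNReal.ofReal_mul (by positivity)] at h2
  simpa only [ENNReal.ofReal_pow (norm_nonneg _), ofReal_norm, ENNReal.ofReal_ofNat] using h2

/-- The `L²` modulus of continuity of a `C¹` function, along shifts that do not leave `D`. -/
lemma lintegral_translate_le {f : Eu d → ℂ} (hf : ContDiff ℝ 1 f) {K : Set (Eu d)}
    (hK : MeasurableSet K) (hD : MeasurableSet D) {z : Eu d}
    (hz : ∀ x ∈ K, ∀ t ∈ Set.Ioo (0 : ℝ) 1, x + t • z ∈ D) :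
    ∫⁻ x in K, ‖f (x + z) - f x‖ₑ ^ 2 ≤ ‖z‖ₑ ^ 2 * ∫⁻ x in D, gradSq f x := by
  have hm1 := measurable_gradSq hf
  calc _ ≤ ∫⁻ x in K, ∫⁻ t in Set.Ioo (0 : ℝ) 1, ‖z‖ₑ ^ 2 * gradSq f (x + t • z) := by
        refine lintegral_mono fun x => ?_
        have h := enorm_sub_sq_le_lintegral (contDiff_line hf x z)
        simp only [one_smul, zero_smul, add_zero] at h
        refine h.trans (lintegral_mono fun t => ?_)
        rw [deriv_line hf]
        exact enorm_fderiv_sq_le _ _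
    _ = ∫⁻ t in Set.Ioo (0 : ℝ) 1, ∫⁻ x in K, ‖z‖ₑ ^ 2 * gradSq f (x + t • z) := by
        refine lintegral_lintegral_swap (Measurable.aemeasurable ?_)
        exact (hm1.comp (by fun_prop : Measurable fun p : Eu d × ℝ => p.1 + p.2 • z)).const_mul _
    _ ≤ ∫⁻ _ in Set.Ioo (0 : ℝ) 1, ‖z‖ₑ ^ 2 * ∫⁻ x in D, gradSq f x := by
        refine setLIntegral_mono' measurableSet_Ioo fun t ht => ?_
        have hmt : Measurable fun x => gradSq f (x + t • z) := hm1.comp (by fun_prop)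
        rw [lintegral_const_mul _ hmt]
        refine mul_le_mul_right ?_ _
        rw [← lintegral_indicator hK, ← lintegral_indicator hD,
          ← lintegral_add_right_eq_self (D.indicator (gradSq f)) (t • z)]
        refine lintegral_mono fun x => ?_
        by_cases hx : x ∈ K
        · rw [Set.indicator_of_mem hx, Set.indicator_of_mem (hz x hx t ht)]
        · rw [Set.indicator_of_notMem hx]; exact zero_le
    _ = _ := by simp

/-- Comparison of the value of a function at a point with its integral over a ball. -/
lemma volume_sq_mul_enorm_sq_le {f : Eu d → ℂ} (hf : Continuous f) {x x₀ : Eu d} {h : ℝ}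
    (hx : x ∈ Metric.ball x₀ h) :
    volume (Metric.ball (0 : Eu d) h) ^ 2 * ‖f x‖ₑ ^ 2 ≤
      2 * ‖∫ y in Metric.ball x₀ h, f y‖ₑ ^ 2 + 2 * (volume (Metric.ball (0 : Eu d) h) *
        ∫⁻ z in Metric.ball 0 (2 * h), ‖f (x + z) - f x‖ₑ ^ 2) := by
  set B := Metric.ball x₀ h
  have hV : volume (Metric.ball (0 : Eu d) h) = volume B :=
    (Measure.addHaar_ball_center volume x₀ h).symm
  have hfin : volume B ≠ ⊤ := measure_ball_lt_top.ne
  have hint : IntegrableOn f B volume :=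
    (hf.continuousOn.integrableOn_compact (isCompact_closedBall x₀ h)).mono_set
      Metric.ball_subset_closedBall
  have h1 : (volume.real B : ℂ) * f x = (∫ y in B, f y) + ∫ y in B, (f x - f y) := by
    rw [integral_sub (integrableOn_const hfin (by simp)).integrable hint.integrable, setIntegral_const]
    simp
  have h2 : volume B ^ 2 * ‖f x‖ₑ ^ 2 = ‖(volume.real B : ℂ) * f x‖ₑ ^ 2 := by
    rw [enorm_mul, mul_pow]
    congr 2
    rw [← ofReal_norm, Complex.norm_real, Real.norm_of_nonneg measureReal_nonneg,
      measureReal_def, ENNReal.ofReal_toReal hfin]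
  rw [hV, h2, h1]
  refine (enorm_add_sq_le _ _).trans ?_
  gcongr
  calc ‖∫ y in B, (f x - f y)‖ₑ ^ 2 ≤ (∫⁻ y in B, ‖f x - f y‖ₑ) ^ 2 := by
        gcongr; exact enorm_integral_le_lintegral_enorm _
    _ ≤ volume B * ∫⁻ y in B, ‖f x - f y‖ₑ ^ 2 := by
        have := sq_lintegral_le (volume.restrict B) (g := fun y => ‖f x - f y‖ₑ)
          (continuous_const.sub hf).measurable.enorm.aemeasurable
        simpa using this
    _ ≤ _ := by
        refine mul_le_mul_right ?_ _
        rw [← lintegral_indicator measurableSet_ball, ← lintegral_indicator measurableSet_ball,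
          ← lintegral_add_right_eq_self _ x]
        refine lintegral_mono fun z => ?_
        by_cases hz : z + x ∈ B
        · have : z ∈ Metric.ball (0 : Eu d) (2 * h) := by
            rw [mem_ball_zero_iff]
            have h3 : dist (z + x) x₀ < h := hz
            have h4 : dist x x₀ < h := hx
            have h5 := dist_triangle_right (z + x) x x₀
            rw [dist_eq_norm (z + x) x, add_sub_cancel_right] at h5
            linarith
          rw [Set.indicator_of_mem hz, Set.indicator_of_mem this, ← enorm_neg, neg_sub, add_comm z]
        · rw [Set.indicator_of_notMem hz]; exact zero_le

/-- On a compact subset of `D`, the `L²` norm of a `C¹` function is controlled by finitely many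
averages, up to a small multiple of the `L²` norm of the gradient. -/
lemma exists_finite_averages (hD : IsOpen D) {K : Set (Eu d)} (hK : IsCompact K) (hKD : K ⊆ D)
    {ε : ℝ} (hε : 0 < ε) :
    ∃ (N : ℕ) (B : Fin N → Set (Eu d)) (C : ℝ), (∀ j, MeasurableSet (B j)) ∧ (∀ j, B j ⊆ D) ∧
      0 ≤ C ∧ ∀ f : Eu d → ℂ, ContDiff ℝ 1 f →
      ∫⁻ x in K, ‖f x‖ₑ ^ 2 ≤ ENNReal.ofReal ε * (∫⁻ x in D, gradSq f x) +
        ENNReal.ofReal C * ∑ j, ‖∫ y in B j, f y‖ₑ ^ 2 := by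
  obtain ⟨δ, hδ, hδD⟩ := hK.exists_thickening_subset_open hD hKD
  obtain ⟨h, hh, hhδ, hhε⟩ : ∃ h > 0, 2 * h ≤ δ ∧ 2 * ((2 : ℝ) ^ d * (2 * h) ^ 2) ≤ ε := by
    have hlim : Tendsto (fun h : ℝ => 2 * ((2 : ℝ) ^ d * (2 * h) ^ 2)) (𝓝[>] 0) (𝓝 0) := by
      have : Continuous (fun h : ℝ => 2 * ((2 : ℝ) ^ d * (2 * h) ^ 2)) := by fun_prop
      have := this.tendsto 0
      simp only [mul_zero, ne_eq, OfNat.ofNat_ne_zero, not_false_eq_true, zero_pow] at this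
      exact this.mono_left nhdsWithin_le_nhds
    have h1 := hlim.eventually_le_const hε
    have h2 : ∀ᶠ h : ℝ in 𝓝[>] 0, h ≤ δ / 2 :=
      nhdsWithin_le_nhds (Iic_mem_nhds (by positivity))
    obtain ⟨h, ha, hb, hc⟩ := (h1.and (h2.and self_mem_nhdsWithin)).exists
    exact ⟨h, hc, by linarith, ha⟩
  obtain ⟨t, htK, htc⟩ := hK.elim_nhds_subcover (fun x => Metric.ball x h)
    (fun x _ => Metric.ball_mem_nhds x hh)
  set e := t.equivFin.symm
  set B : Fin t.card → Set (Eu d) := fun j => Metric.ball (e j : Eu d) h with hB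
  set V := volume (Metric.ball (0 : Eu d) h) with hV
  have hV0 : V ≠ 0 := (Metric.measure_ball_pos volume _ hh).ne'
  have hVt : V ≠ ⊤ := measure_ball_lt_top.ne
  have hBm : ∀ j, MeasurableSet (B j) := fun j => measurableSet_ball
  have hKm : MeasurableSet K := hK.isClosed.measurableSet
  have hball : ∀ x ∈ K, Metric.ball x (2 * h) ⊆ D := fun x hx =>
    ((Metric.ball_subset_ball hhδ).trans (Metric.ball_subset_thickening hx δ)).trans hδD
  have hKc : K ⊆ ⋃ j, B j := by
    intro x hx
    obtain ⟨y, hy, hxy⟩ := Set.mem_iUnion₂.1 (htc hx)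
    refine Set.mem_iUnion.2 ⟨e.symm ⟨y, hy⟩, ?_⟩
    simpa [hB] using hxy
  refine ⟨t.card, B, (2 * (V ^ 2)⁻¹ * volume K).toReal, hBm, fun j => ?_, ENNReal.toReal_nonneg,
    fun f hf => ?_⟩
  · exact (Metric.ball_subset_ball (by linarith)).trans (hball _ (htK _ (e j).2))
  have hm1 := measurable_gradSq hf
  have hfm := hf.continuous.measurable
  have hKt : volume K ≠ ⊤ := hK.measure_lt_top.ne
  rw [ENNReal.ofReal_toReal (by finiteness)]
  set A : Fin t.card → Set (Eu d) := fun j => K ∩ disjointed B j with hA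
  have hAm : ∀ j, MeasurableSet (A j) := fun j =>
    hKm.inter (by
      rw [disjointed_apply, Finset.sup_set_eq_biUnion]
      exact (hBm j).diff (Finset.measurableSet_biUnion _ fun i _ => hBm i))
  have hAd : Pairwise (Function.onFun Disjoint A) := fun i j hij =>
    ((disjoint_disjointed B hij).mono Set.inter_subset_right Set.inter_subset_right)
  have hAK : K = ⋃ j, A j := by
    rw [hA, ← Set.inter_iUnion, iUnion_disjointed]
    exact (Set.inter_eq_left.2 hKc).symm
  set G : Eu d → ℝ≥0∞ := fun x => ∫⁻ z in Metric.ball 0 (2 * h), ‖f (x + z) - f x‖ₑ ^ 2 with hG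
  have hGm : Measurable G := by
    refine Measurable.lintegral_prod_right'
      (f := fun q : Eu d × Eu d => ‖f (q.1 + q.2) - f q.1‖ₑ ^ 2) ?_
    exact ((hfm.comp (by fun_prop)).sub (hfm.comp measurable_fst)).enorm.pow_const 2
  have hpt : ∀ j, ∀ x ∈ A j, ‖f x‖ₑ ^ 2 ≤
      2 * (V ^ 2)⁻¹ * ‖∫ y in B j, f y‖ₑ ^ 2 + 2 * V⁻¹ * G x := by
    intro j x hx
    have hxB : x ∈ B j := disjointed_subset B j hx.2
    have h1 := volume_sq_mul_enorm_sq_le hf.continuous hxB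
    have hV2 : V ^ 2 ≠ 0 := pow_ne_zero _ hV0
    have hV2t : V ^ 2 ≠ ⊤ := ENNReal.pow_ne_top hVt
    calc ‖f x‖ₑ ^ 2 = (V ^ 2)⁻¹ * (V ^ 2 * ‖f x‖ₑ ^ 2) := by
          rw [← mul_assoc, ENNReal.inv_mul_cancel hV2 hV2t, one_mul]
      _ ≤ (V ^ 2)⁻¹ * (2 * ‖∫ y in B j, f y‖ₑ ^ 2 + 2 * (V * G x)) := by gcongr
      _ = _ := by
          have h3 : (V ^ 2)⁻¹ * V = V⁻¹ := by
            rw [sq, ENNReal.mul_inv (Or.inl hV0) (Or.inl hVt), mul_assoc,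
              ENNReal.inv_mul_cancel hV0 hVt, mul_one]
          rw [mul_add, ← h3]; ring
  have hGint : ∫⁻ x in K, G x ≤ (2 : ℝ≥0∞) ^ d * V * (ENNReal.ofReal ((2 * h) ^ 2) *
      ∫⁻ x in D, gradSq f x) := by
    rw [hG, lintegral_lintegral_swap]
    · calc _ ≤ ∫⁻ _ in Metric.ball (0 : Eu d) (2 * h), ENNReal.ofReal ((2 * h) ^ 2) *
            ∫⁻ x in D, gradSq f x := by
            refine setLIntegral_mono' measurableSet_ball fun z hz => ?_
            rw [mem_ball_zero_iff] at hz
            refine (lintegral_translate_le hf hKm hD.measurableSet fun x hx s hs => ?_).trans ?_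
            · refine hball x hx ?_
              rw [mem_ball_iff_norm, add_sub_cancel_left, norm_smul, Real.norm_of_nonneg hs.1.le]
              nlinarith [hs.1, hs.2, norm_nonneg z]
            · gcongr
              rw [← ofReal_norm, ← ENNReal.ofReal_pow (norm_nonneg _)]
              exact ENNReal.ofReal_le_ofReal (by gcongr)
        _ = _ := by
            rw [lintegral_const, Measure.restrict_apply_univ, Measure.addHaar_ball_mul_of_pos volume _
              (by norm_num : (0 : ℝ) < 2), finrank_euclideanSpace, Fintype.card_fin, mul_comm,
              ENNReal.ofReal_pow (zero_le_two (α := ℝ)) d, ENNReal.ofReal_ofNat]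
    · refine (Measurable.aemeasurable ?_)
      exact ((hfm.comp (by fun_prop)).sub (hfm.comp measurable_fst)).enorm.pow_const 2
  calc ∫⁻ x in K, ‖f x‖ₑ ^ 2 = ∑ j, ∫⁻ x in A j, ‖f x‖ₑ ^ 2 := by
        conv_lhs => rw [hAK]
        rw [lintegral_iUnion hAm hAd, tsum_fintype]
    _ ≤ ∑ j, ∫⁻ x in A j, (2 * (V ^ 2)⁻¹ * ‖∫ y in B j, f y‖ₑ ^ 2 + 2 * V⁻¹ * G x) :=
        Finset.sum_le_sum fun j _ => setLIntegral_mono' (hAm j) (hpt j)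
    _ = (∑ j, 2 * (V ^ 2)⁻¹ * ‖∫ y in B j, f y‖ₑ ^ 2 * volume (A j)) +
          2 * V⁻¹ * ∫⁻ x in K, G x := by
        conv_rhs => rw [hAK]
        rw [lintegral_iUnion hAm hAd, tsum_fintype, Finset.mul_sum, ← Finset.sum_add_distrib]
        refine Finset.sum_congr rfl fun j _ => ?_
        rw [lintegral_add_left measurable_const, lintegral_const, Measure.restrict_apply_univ,
          lintegral_const_mul _ hGm]
    _ ≤ (∑ j, 2 * (V ^ 2)⁻¹ * ‖∫ y in B j, f y‖ₑ ^ 2 * volume K) +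
          2 * V⁻¹ * ((2 : ℝ≥0∞) ^ d * V * (ENNReal.ofReal ((2 * h) ^ 2) *
            ∫⁻ x in D, gradSq f x)) := by
        gcongr
        exact Set.inter_subset_left
    _ = ENNReal.ofReal (2 * ((2 : ℝ) ^ d * (2 * h) ^ 2)) * (∫⁻ x in D, gradSq f x) +
          2 * (V ^ 2)⁻¹ * volume K * ∑ j, ‖∫ y in B j, f y‖ₑ ^ 2 := by
        rw [ENNReal.ofReal_mul (by norm_num), ENNReal.ofReal_mul (by positivity),
          ENNReal.ofReal_pow (zero_le_two (α := ℝ)) d, ENNReal.ofReal_ofNat, add_comm]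
        congr 1
        · calc _ = (V⁻¹ * V) * (2 * (2 ^ d * ENNReal.ofReal ((2 * h) ^ 2)) *
                ∫⁻ x in D, gradSq f x) := by ring
            _ = _ := by rw [ENNReal.inv_mul_cancel hV0 hVt, one_mul]
        · rw [Finset.mul_sum]
          exact Finset.sum_congr rfl fun j _ => by ring
    _ ≤ _ := by gcongr

end

/-! ### The energy space and the Fredholm alternative -/

section

variable {d : ℕ} {D : Set (Eu d)}

/-- The complex Hilbert space `L²(D)`. -/
abbrev DomL2 (D : Set (Eu d)) : Type := Lp ℂ 2 (vol D)

/-- Triples of a function on `D`, a function on `∂D`, and a vector field on `D`, all square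
integrable. -/
abbrev EnergyModel (D : Set (Eu d)) : Type :=
  WithLp 2 (DomL2 D × WithLp 2 (BdryL2 D × PiLp 2 fun _ : Fin d => DomL2 D))

/-- The Hilbert space of all triples `(u, τ, g)` of a function `u ∈ L²(D)`, boundary values
`τ ∈ L²(∂D)`, and a vector field `g ∈ L²(D)^d`, without any relation between them. Sobolev spaces
are closed subspaces of it, with `τ` the trace of `u` and `g` its gradient. -/
def Energy (D : Set (Eu d)) : Type := EnergyModel D

namespace Energy

noncomputable instance : NormedAddCommGroup (Energy D) :=
  inferInstanceAs (NormedAddCommGroup (EnergyModel D))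

noncomputable instance : InnerProductSpace ℂ (Energy D) :=
  inferInstanceAs (InnerProductSpace ℂ (EnergyModel D))

instance : CompleteSpace (Energy D) := inferInstanceAs (CompleteSpace (EnergyModel D))

/-- The function `u` of `(u, τ, g)`. -/
noncomputable def val : Energy D →L[ℂ] DomL2 D :=
  (WithLp.fstL 2 ℂ _ _ : EnergyModel D →L[ℂ] DomL2 D)

/-- The boundary values `τ` of `(u, τ, g)`. -/
noncomputable def tr : Energy D →L[ℂ] BdryL2 D :=
  ((WithLp.fstL 2 ℂ _ _).comp (WithLp.sndL 2 ℂ _ _) : EnergyModel D →L[ℂ] BdryL2 D)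

/-- The vector field `g` of `(u, τ, g)`. -/
noncomputable def gr : Energy D →L[ℂ] PiLp 2 fun _ : Fin d => DomL2 D :=
  ((WithLp.sndL 2 ℂ _ _).comp (WithLp.sndL 2 ℂ _ _) :
    EnergyModel D →L[ℂ] PiLp 2 fun _ : Fin d => DomL2 D)

/-- The triple `(u, τ, g)`. -/
noncomputable def mk (u : DomL2 D) (τ : BdryL2 D) (g : Fin d → DomL2 D) : Energy D :=
  (WithLp.toLp 2 (u, WithLp.toLp 2 (τ, WithLp.toLp 2 g)) : EnergyModel D)

@[simp] lemma val_mk (u : DomL2 D) (τ : BdryL2 D) (g : Fin d → DomL2 D) : (mk u τ g).val = u := rfl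
@[simp] lemma tr_mk (u : DomL2 D) (τ : BdryL2 D) (g : Fin d → DomL2 D) : (mk u τ g).tr = τ := rfl
@[simp] lemma gr_mk (u : DomL2 D) (τ : BdryL2 D) (g : Fin d → DomL2 D) (i : Fin d) :
    (mk u τ g).gr i = g i := rfl

lemma inner_eq (U W : Energy D) :
    inner ℂ U W = inner ℂ U.val W.val + (inner ℂ U.tr W.tr + inner ℂ U.gr W.gr) := rfl

lemma norm_sq_eq (U : Energy D) : ‖U‖ ^ 2 = ‖U.val‖ ^ 2 + (‖U.tr‖ ^ 2 + ‖U.gr‖ ^ 2) := by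
  have h : ∀ V : EnergyModel D, ‖V‖ ^ 2 = ‖V.fst‖ ^ 2 + (‖V.snd.fst‖ ^ 2 + ‖V.snd.snd‖ ^ 2) := by
    intro V
    rw [WithLp.prod_norm_sq_eq_of_L2, WithLp.prod_norm_sq_eq_of_L2]
  exact h U

lemma ext' {U W : Energy D} (h1 : U.val = W.val) (h2 : U.tr = W.tr)
    (h3 : ∀ i, U.gr i = W.gr i) : U = W := by
  have h4 : U.gr = W.gr := by ext1 i; exact h3 i
  rw [← sub_eq_zero, ← norm_eq_zero, ← sq_eq_zero_iff, norm_sq_eq]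
  simp [map_sub, h1, h2, h4]

end Energy

/-- `C¹` functions with compact support. -/
def C1c (d : ℕ) : Submodule ℂ (Eu d → ℂ) where
  carrier := {f | ContDiff ℝ 1 f ∧ HasCompactSupport f}
  zero_mem' := ⟨contDiff_const, HasCompactSupport.zero⟩
  add_mem' h h' := ⟨h.1.add h'.1, h.2.add h'.2⟩
  smul_mem' c _ h := ⟨contDiff_const.smul h.1, h.2.smul_left (f := fun _ => c)⟩

lemma IsTest.mem_C1c {f : Eu d → ℂ} (hf : IsTest f) : f ∈ C1c d :=
  ⟨hf.smooth.of_le (by simp), hf.compact⟩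

lemma C1c.memLp {f : Eu d → ℂ} (hf : f ∈ C1c d) (μ : Measure (Eu d))
    [IsFiniteMeasureOnCompacts μ] : MemLp f 2 μ :=
  hf.1.continuous.memLp_of_hasCompactSupport hf.2

lemma C1c.memLp_pderiv {f : Eu d → ℂ} (hf : f ∈ C1c d) (i : Fin d) (μ : Measure (Eu d))
    [IsFiniteMeasureOnCompacts μ] : MemLp (pderiv i f) 2 μ :=
  (continuous_pderiv hf.1 i).memLp_of_hasCompactSupport
    (hf.2.fderiv_apply (𝕜 := ℝ) (EuclideanSpace.single i 1))

lemma pderiv_add {f g : Eu d → ℂ} (hf : ContDiff ℝ 1 f) (hg : ContDiff ℝ 1 g) (i : Fin d) :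
    pderiv i (f + g) = pderiv i f + pderiv i g := by
  funext x
  simp only [pderiv, Pi.add_apply]
  rw [fderiv_add (hf.differentiable (by simp) x) (hg.differentiable (by simp) x)]
  rfl

lemma pderiv_smul {f : Eu d → ℂ} (hf : ContDiff ℝ 1 f) (c : ℂ) (i : Fin d) :
    pderiv i (c • f) = c • pderiv i f := by
  funext x
  simp only [pderiv, Pi.smul_apply]
  rw [fderiv_const_smul (hf.differentiable (by simp) x)]
  rfl

/-- A `C¹` function with its boundary values and its gradient. -/
noncomputable def toEnergy (D : Set (Eu d)) [IsFiniteMeasure (surf D)] : C1c d →ₗ[ℂ] Energy D where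
  toFun f := Energy.mk ((C1c.memLp f.2 (vol D)).toLp f) ((C1c.memLp f.2 (surf D)).toLp f)
    (fun i => (C1c.memLp_pderiv f.2 i (vol D)).toLp (pderiv i f))
  map_add' f g := by
    refine Energy.ext' ?_ ?_ fun i => ?_
    · simp only [map_add, Energy.val_mk]
      rw [← MemLp.toLp_add]; rfl
    · simp only [map_add, Energy.tr_mk]
      rw [← MemLp.toLp_add]; rfl
    · simp only [map_add, Energy.gr_mk, PiLp.add_apply]
      rw [← MemLp.toLp_add]
      congr 1
      exact pderiv_add f.2.1 g.2.1 i
  map_smul' c f := by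
    refine Energy.ext' ?_ ?_ fun i => ?_
    · simp only [map_smul, Energy.val_mk, RingHom.id_apply]
      rw [← MemLp.toLp_const_smul]; rfl
    · simp only [map_smul, Energy.tr_mk, RingHom.id_apply]
      rw [← MemLp.toLp_const_smul]; rfl
    · simp only [map_smul, Energy.gr_mk, PiLp.smul_apply, RingHom.id_apply]
      rw [← MemLp.toLp_const_smul]
      congr 1
      exact pderiv_smul f.2.1 c i

/-- The test functions, as a space of `C¹` functions. -/
def tests (d : ℕ) : Submodule ℂ (C1c d) where
  carrier := {f | IsTest (f : Eu d → ℂ)}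
  zero_mem' := isTest_zero
  add_mem' {f g} h h' := by
    have := IsTest.comb h h' 1
    rw [one_smul] at this; exact this
  smul_mem' c f h := by
    have := IsTest.comb h isTest_zero c
    rw [add_zero] at this; exact this

/-- The test functions with support in `D`. -/
def interiorTests (D : Set (Eu d)) : Submodule ℂ (C1c d) where
  carrier := {f | IsTest (f : Eu d → ℂ) ∧ tsupport (f : Eu d → ℂ) ⊆ D}
  zero_mem' := ⟨isTest_zero, by simp [tsupport]⟩
  add_mem' {f g} h h' := ⟨(tests d).add_mem h.1 h'.1,
    (tsupport_add _ _).trans (Set.union_subset h.2 h'.2)⟩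
  smul_mem' c f h := ⟨(tests d).smul_mem c h.1,
    (closure_mono (Function.support_const_smul_subset c _)).trans h.2⟩

lemma interiorTests_le (D : Set (Eu d)) : interiorTests D ≤ tests d := fun _ h => h.1

section
variable [IsFiniteMeasure (surf D)]

variable (D) in
/-- The closure of a space of functions in the energy norm. For all test functions this is `H¹(D)`,
and for the test functions with support in `D` it is `H¹₀(D)`. -/
noncomputable def energySpace (S : Submodule ℂ (C1c d)) : Submodule ℂ (Energy D) :=
  (S.map (toEnergy D)).topologicalClosure

lemma energySpace_mono {S T : Submodule ℂ (C1c d)} (h : S ≤ T) :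
    energySpace D S ≤ energySpace D T :=
  Submodule.topologicalClosure_mono (Submodule.map_mono h)

instance (S : Submodule ℂ (C1c d)) : CompleteSpace (energySpace D S) :=
  (Submodule.isClosed_topologicalClosure _).completeSpace_coe

lemma toEnergy_mem {S : Submodule ℂ (C1c d)} {f : C1c d} (hf : f ∈ S) :
    toEnergy D f ∈ energySpace D S :=
  Submodule.le_topologicalClosure _ (Submodule.mem_map_of_mem hf)

/-- A closed condition holds on the energy space if it holds for the functions that generate it. -/
lemma energySpace_induction {S : Submodule ℂ (C1c d)} {p : Energy D → Prop}
    (hp : IsClosed {U | p U}) (h : ∀ f ∈ S, p (toEnergy D f)) :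
    ∀ U ∈ energySpace D S, p U := by
  intro U hU
  have h1 : closure ((S.map (toEnergy D) : Submodule ℂ (Energy D)) : Set (Energy D)) ⊆ {U | p U} := by
    refine hp.closure_subset_iff.2 ?_
    rintro _ ⟨f, hf, rfl⟩
    exact h f hf
  exact h1 hU

lemma ofReal_norm_toLp_sq {μ : Measure (Eu d)} {g : Eu d → ℂ} (hg : MemLp g 2 μ) :
    ENNReal.ofReal (‖hg.toLp g‖ ^ 2) = ∫⁻ x, ‖g x‖ₑ ^ 2 ∂μ := by
  rw [ENNReal.ofReal_pow (norm_nonneg _), ofReal_norm, Lp.enorm_toLp,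
    eLpNorm_eq_lintegral_rpow_enorm_toReal (by norm_num) (by norm_num)]
  simp only [ENNReal.toReal_ofNat, ENNReal.rpow_ofNat]
  rw [← ENNReal.rpow_natCast, ← ENNReal.rpow_mul]
  norm_num

lemma ofReal_norm_val_sq (f : C1c d) :
    ENNReal.ofReal (‖(toEnergy D f).val‖ ^ 2) = ∫⁻ x in D, ‖(f : Eu d → ℂ) x‖ₑ ^ 2 :=
  ofReal_norm_toLp_sq (C1c.memLp f.2 (vol D))

lemma ofReal_norm_tr_sq (f : C1c d) :
    ENNReal.ofReal (‖(toEnergy D f).tr‖ ^ 2) = ∫⁻ x, ‖(f : Eu d → ℂ) x‖ₑ ^ 2 ∂(surf D) :=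
  ofReal_norm_toLp_sq (C1c.memLp f.2 (surf D))

lemma ofReal_norm_gr_sq (f : C1c d) :
    ENNReal.ofReal (‖(toEnergy D f).gr‖ ^ 2) = ∫⁻ x in D, gradSq (f : Eu d → ℂ) x := by
  rw [PiLp.norm_sq_eq_of_L2, ENNReal.ofReal_sum_of_nonneg fun _ _ => by positivity]
  unfold gradSq
  rw [lintegral_finsetSum _ fun i _ => ((continuous_pderiv f.2.1 i).measurable.enorm).pow_const 2]
  exact Finset.sum_congr rfl fun i _ => ofReal_norm_toLp_sq (C1c.memLp_pderiv f.2 i (vol D))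

lemma exists_norm_tr_sq_le (hD : IsC2Domain D) {ε : ℝ} (hε : 0 < ε) :
    ∃ C : ℝ, 0 ≤ C ∧ ∀ U ∈ energySpace D (tests d),
      ‖U.tr‖ ^ 2 ≤ C * ‖U.val‖ ^ 2 + ε * ‖U.gr‖ ^ 2 := by
  obtain ⟨C, hC, h⟩ := exists_trace_le hD hε
  refine ⟨C, hC, energySpace_induction ?_ fun f _ => ?_⟩
  · exact isClosed_le (by fun_prop) (by fun_prop)
  · have := h f f.2.1
    rw [← ofReal_norm_val_sq, ← ofReal_norm_gr_sq, ← ofReal_norm_tr_sq, ← ENNReal.ofReal_mul hC,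
      ← ENNReal.ofReal_mul hε.le, ← ENNReal.ofReal_add (by positivity) (by positivity)] at this
    exact (ENNReal.ofReal_le_ofReal_iff (by positivity)).1 this

/-- In `H¹(D)` the `L²` norm is dominated by finitely many functionals, up to a small multiple of
the `H¹` norm. This is Rellich's theorem in quantitative form. -/
lemma exists_norm_val_sq_le (hD : IsC2Domain D) {ε : ℝ} (hε : 0 < ε) :
    ∃ (N : ℕ) (Q : Energy D →L[ℂ] EuclideanSpace ℂ (Fin N)), ∀ U ∈ energySpace D (tests d),
      ‖U.val‖ ^ 2 ≤ ε * ‖U‖ ^ 2 + ‖Q U‖ ^ 2 := by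
  obtain ⟨K, hK, hKD, hL⟩ := exists_layer_le hD (half_pos hε)
  obtain ⟨N, B, C, hBm, hBD, hC, hI⟩ := exists_finite_averages hD.isOpen hK hKD (half_pos hε)
  have hfin : ∀ j, vol D (B j) ≠ ⊤ := fun j => by
    have h1 : volume D < ⊤ := hD.isBounded.measure_lt_top
    exact ((measure_mono (Set.subset_univ _)).trans_lt (by simpa using h1)).ne
  let χ : Fin N → DomL2 D := fun j => indicatorConstLp 2 (hBm j) (hfin j) 1
  let Q : Energy D →L[ℂ] EuclideanSpace ℂ (Fin N) :=
    (PiLp.continuousLinearEquiv 2 ℂ (fun _ : Fin N => ℂ)).symm.toContinuousLinearMap.comp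
      (ContinuousLinearMap.pi fun j => ((√C : ℝ) : ℂ) • (innerSL ℂ (χ j)).comp Energy.val)
  refine ⟨N, Q, energySpace_induction ?_ fun f _ => ?_⟩
  · exact isClosed_le (by fun_prop) (by fun_prop)
  · have hQ : ENNReal.ofReal (‖Q (toEnergy D f)‖ ^ 2)
        = ENNReal.ofReal C * ∑ j, ‖∫ y in B j, (f : Eu d → ℂ) y‖ₑ ^ 2 := by
      have hj : ∀ j, inner ℂ (χ j) ((toEnergy D f).val) = ∫ y in B j, (f : Eu d → ℂ) y := by
        intro j
        rw [L2.inner_indicatorConstLp_one, Measure.restrict_restrict (hBm j),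
          Set.inter_eq_left.2 (hBD j)]
        refine integral_congr_ae ?_
        have h1 := (C1c.memLp f.2 (vol D)).coeFn_toLp
        exact (ae_mono (Measure.restrict_mono (hBD j) le_rfl)) h1
      have hn : ‖Q (toEnergy D f)‖ ^ 2 = C * ∑ j, ‖∫ y in B j, (f : Eu d → ℂ) y‖ ^ 2 := by
        rw [EuclideanSpace.norm_sq_eq, Finset.mul_sum]
        refine Finset.sum_congr rfl fun j _ => ?_
        change ‖((√C : ℝ) : ℂ) * inner ℂ (χ j) ((toEnergy D f).val)‖ ^ 2 = _
        rw [hj, norm_mul, mul_pow, Complex.norm_real, Real.norm_of_nonneg (Real.sqrt_nonneg _),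
          Real.sq_sqrt hC]
      rw [hn, ENNReal.ofReal_mul hC, ENNReal.ofReal_sum_of_nonneg fun _ _ => by positivity]
      simp only [ENNReal.ofReal_pow (norm_nonneg _), ofReal_norm]
    have hu : ∫⁻ x in D, ‖(f : Eu d → ℂ) x‖ₑ ^ 2 ≤
        (∫⁻ x in K, ‖(f : Eu d → ℂ) x‖ₑ ^ 2) + ∫⁻ x in D \ K, ‖(f : Eu d → ℂ) x‖ₑ ^ 2 := by
      refine (lintegral_mono_set (?_ : D ⊆ K ∪ (D \ K))).trans (lintegral_union_le _ _ _)
      simp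
    have h1 := hu.trans (add_le_add (hI f f.2.1) (hL f f.2.1))
    rw [← hQ, ← ofReal_norm_val_sq, ← ofReal_norm_gr_sq,
      ← ENNReal.ofReal_add (by positivity) (by positivity), ← ENNReal.ofReal_mul (by positivity),
      ← ENNReal.ofReal_mul (by positivity), ← ENNReal.ofReal_add (by positivity) (by positivity),
      ← ENNReal.ofReal_add (by positivity) (by positivity),
      ENNReal.ofReal_le_ofReal_iff (by positivity)] at h1
    rw [Energy.norm_sq_eq]
    have := sq_nonneg ‖(toEnergy D f).tr‖
    have := sq_nonneg ‖(toEnergy D f).val‖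
    nlinarith

end

/-- An operator that is dominated by compact operators, up to arbitrarily small multiples of the
norm, is compact. -/
lemma isCompactOperator_of_norm_sq_le {X Y : Type*} [NormedAddCommGroup X] [NormedSpace ℂ X]
    [NormedAddCommGroup Y] [NormedSpace ℂ Y] [CompleteSpace Y] (T : X →L[ℂ] Y)
    (h : ∀ ε > 0, ∃ (G : Type) (_ : NormedAddCommGroup G) (_ : NormedSpace ℂ G) (Q : X →L[ℂ] G),
      IsCompactOperator Q ∧ ∀ x, ‖T x‖ ^ 2 ≤ ε * ‖x‖ ^ 2 + ‖Q x‖ ^ 2) :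
    IsCompactOperator T := by
  refine (isCompactOperator_iff_isCompact_closure_image_ball (T : X →ₗ[ℂ] Y) one_pos).2 ?_
  refine TotallyBounded.isCompact_of_isClosed (TotallyBounded.closure ?_) isClosed_closure
  refine Metric.totallyBounded_iff.2 fun η hη => ?_
  obtain ⟨G, _, _, Q, hQ, hTQ⟩ := h (η ^ 2 / 16) (by positivity)
  have hQt : TotallyBounded (Q '' Metric.ball 0 1) :=
    ((hQ.isCompact_closure_image_ball (f := (Q : X →ₗ[ℂ] G)) 1).totallyBounded).subset
      subset_closure
  obtain ⟨u, hu, huf, hcov⟩ := Set.exists_subset_image_finite_and.1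
    (Metric.finite_approx_of_totallyBounded hQt (η / 4) (by positivity))
  refine ⟨T '' u, huf.image T, ?_⟩
  rintro _ ⟨x, hx, rfl⟩
  obtain ⟨_, ⟨z, hz, rfl⟩, hxz⟩ := Set.mem_iUnion₂.1 (hcov ⟨x, hx, rfl⟩)
  refine Set.mem_iUnion₂.2 ⟨T z, ⟨z, hz, rfl⟩, ?_⟩
  rw [mem_ball_iff_norm, ← map_sub] at hxz
  change T x ∈ _
  rw [mem_ball_iff_norm, ← map_sub]
  have h1 := hTQ (x - z)
  have h2 : ‖x - z‖ ≤ 2 := by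
    have h3 := mem_ball_zero_iff.1 hx
    have h4 := mem_ball_zero_iff.1 (hu hz)
    linarith [norm_sub_le x z]
  refine lt_of_pow_lt_pow_left₀ 2 hη.le ?_
  have h5 : ‖x - z‖ ^ 2 ≤ 2 ^ 2 := by gcongr
  have h6 : ‖Q (x - z)‖ ^ 2 < (η / 4) ^ 2 := by gcongr
  nlinarith [sq_nonneg η, mul_pos hη hη]

section
variable [IsFiniteMeasure (surf D)]

lemma isCompactOperator_val (hD : IsC2Domain D) {S : Submodule ℂ (C1c d)} (hS : S ≤ tests d) :
    IsCompactOperator (Energy.val.comp (energySpace D S).subtypeL) := by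
  refine isCompactOperator_of_norm_sq_le _ fun ε hε => ?_
  obtain ⟨N, Q, hQ⟩ := exists_norm_val_sq_le hD hε
  refine ⟨_, inferInstance, inferInstance, Q.comp (energySpace D S).subtypeL, ?_, fun U => ?_⟩
  · exact isCompactOperator_of_locallyCompactSpace_dom (Q.comp (energySpace D S).subtypeL)
  · exact hQ U (energySpace_mono hS U.2)

lemma isCompactOperator_tr (hD : IsC2Domain D) {S : Submodule ℂ (C1c d)} (hS : S ≤ tests d) :
    IsCompactOperator (Energy.tr.comp (energySpace D S).subtypeL) := by
  refine isCompactOperator_of_norm_sq_le _ fun ε hε => ?_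
  obtain ⟨C, hC, h⟩ := exists_norm_tr_sq_le hD hε
  refine ⟨_, inferInstance, inferInstance,
    ((√C : ℝ) : ℂ) • Energy.val.comp (energySpace D S).subtypeL,
    (isCompactOperator_val hD hS).smul ((√C : ℝ) : ℂ), fun U => ?_⟩
  have h1 := h U (energySpace_mono hS U.2)
  have h2 : ‖(((√C : ℝ) : ℂ) • Energy.val.comp (energySpace D S).subtypeL) U‖ ^ 2
      = C * ‖(U : Energy D).val‖ ^ 2 := by
    change ‖((√C : ℝ) : ℂ) • (U : Energy D).val‖ ^ 2 = _
    rw [norm_smul, mul_pow, Complex.norm_real, Real.norm_of_nonneg (Real.sqrt_nonneg _),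
      Real.sq_sqrt hC]
  rw [h2]
  have h3 : ‖U‖ ^ 2 = _ := Energy.norm_sq_eq (U : Energy D)
  rw [h3]
  change ‖(U : Energy D).tr‖ ^ 2 ≤ _
  nlinarith [sq_nonneg ‖(U : Energy D).val‖, sq_nonneg ‖(U : Energy D).tr‖]

/-- The sesquilinear form `∫_D ∇W̄ · ∇U + ∫_D W̄ mU - c ∫_{∂D} W̄ U`. -/
noncomputable def form (m : DomL2 D →L[ℂ] DomL2 D) (c : ℂ) (W U : Energy D) : ℂ :=
  inner ℂ W.gr U.gr + inner ℂ W.val (m U.val) - c * inner ℂ W.tr U.tr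

/-- The Fredholm alternative for a form that is a compact perturbation of the inner product. -/
lemma exists_inner_eq_of_compact {V L B : Type*} [NormedAddCommGroup V] [InnerProductSpace ℂ V]
    [CompleteSpace V] [NormedAddCommGroup L] [InnerProductSpace ℂ L] [CompleteSpace L]
    [NormedAddCommGroup B] [InnerProductSpace ℂ B] [CompleteSpace B]
    {ι : V →L[ℂ] L} {t : V →L[ℂ] B} (hι : IsCompactOperator ι) (ht : IsCompactOperator t)
    (n : L →L[ℂ] L) (b : ℂ)
    (hinj : ∀ U : V, (∀ W : V, inner ℂ W U - inner ℂ (ι W) (n (ι U))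
      - b * inner ℂ (t W) (t U) = 0) → U = 0) (R : V) :
    ∃ U : V, ∀ W : V, inner ℂ W U - inner ℂ (ι W) (n (ι U)) - b * inner ℂ (t W) (t U)
      = inner ℂ W R := by
  set T : V →L[ℂ] V := (ContinuousLinearMap.adjoint ι).comp (n.comp ι)
    + (ContinuousLinearMap.adjoint t).comp (b • t) with hT
  have hTc : IsCompactOperator T :=
    ((hι.clm_comp n).clm_comp (ContinuousLinearMap.adjoint ι)).add
      ((ht.smul b).clm_comp (ContinuousLinearMap.adjoint t))
  have key : ∀ W U : V, inner ℂ W U - inner ℂ (ι W) (n (ι U)) - b * inner ℂ (t W) (t U)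
      = inner ℂ W (U - T U) := by
    intro W U
    simp only [hT, inner_sub_right, add_apply, inner_add_right,
      ContinuousLinearMap.comp_apply, ContinuousLinearMap.adjoint_inner_right,
      smul_apply, inner_smul_right]
    ring
  have hunit : (1 : ℂ) ∈ resolventSet ℂ T := by
    refine (hTc.hasEigenvalue_or_mem_resolventSet one_ne_zero).resolve_left fun he => ?_
    obtain ⟨U, hU⟩ := he.exists_hasEigenvector
    have hTU : T U = U := by simpa using hU.apply_eq_smul
    refine hU.2 (hinj U fun W => ?_)
    rw [key W U, hTU, sub_self, inner_zero_right]
  rw [spectrum.mem_resolventSet_iff, map_one] at hunit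
  obtain ⟨A, hA⟩ := hunit
  refine ⟨(↑A⁻¹ : V →L[ℂ] V) R, fun W => ?_⟩
  rw [key]
  have h1 : (A : V →L[ℂ] V) * ↑A⁻¹ = 1 := A.mul_inv
  have h2 := congrArg (fun L : V →L[ℂ] V => L R) h1
  rw [hA] at h2
  exact congrArg (inner ℂ W) h2

/-- The Fredholm alternative for the form. -/
lemma exists_form_eq (hD : IsC2Domain D) {S : Submodule ℂ (C1c d)} (hS : S ≤ tests d)
    (m : DomL2 D →L[ℂ] DomL2 D) (c : ℂ)
    (hinj : ∀ U ∈ energySpace D S, (∀ W ∈ energySpace D S, form m c W U = 0) → U = 0)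
    (R : Energy D) :
    ∃ U ∈ energySpace D S, ∀ W ∈ energySpace D S, form m c W U = inner ℂ W R := by
  have key : ∀ W U : energySpace D S, form m c (W : Energy D) (U : Energy D) =
      inner ℂ W U - inner ℂ (Energy.val (W : Energy D))
        ((1 - m) (Energy.val (U : Energy D)))
      - (c + 1) * inner ℂ (Energy.tr (W : Energy D)) (Energy.tr (U : Energy D)) := by
    intro W U
    rw [Submodule.coe_inner, Energy.inner_eq, form, sub_apply,
      one_apply_eq_self, inner_sub_right]
    ring
  have hinj' : ∀ U : energySpace D S, (∀ W : energySpace D S,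
      inner ℂ W U - inner ℂ (Energy.val (W : Energy D)) ((1 - m) (Energy.val (U : Energy D)))
      - (c + 1) * inner ℂ (Energy.tr (W : Energy D)) (Energy.tr (U : Energy D)) = 0) → U = 0 :=
    fun U h => Subtype.ext (hinj U U.2 fun W hW => (key ⟨W, hW⟩ U).trans (h ⟨W, hW⟩))
  obtain ⟨U, hU⟩ := exists_inner_eq_of_compact (V := energySpace D S) (L := DomL2 D)
    (B := BdryL2 D) (ι := Energy.val.comp (energySpace D S).subtypeL)
    (t := Energy.tr.comp (energySpace D S).subtypeL) (isCompactOperator_val hD hS)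
    (isCompactOperator_tr hD hS) (1 - m) (c + 1) hinj'
    ((energySpace D S).orthogonalProjectionOnto R)
  refine ⟨U, U.2, fun W hW => ((key ⟨W, hW⟩ U).trans (hU ⟨W, hW⟩)).trans ?_⟩
  exact Submodule.inner_orthogonalProjectionOnto_eq_of_mem_left ⟨W, hW⟩ R

end

end

/-! ### Regular solutions in the energy space -/

section

variable {d : ℕ} {D : Set (Eu d)}

lemma integral_mul_congr_left {μ : Measure (Eu d)} {f g q : Eu d → ℂ} (h : f =ᵐ[μ] g) :
    ∫ x, f x * q x ∂μ = ∫ x, g x * q x ∂μ :=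
  integral_congr_ae (h.mono fun x hx => congrArg (· * q x) hx)

lemma inner_toLp_conj {μ : Measure (Eu d)} {p q : Eu d → ℂ} (hp : MemLp p 2 μ)
    (hpq : ∀ x, p x = conj (q x)) (u : Lp ℂ 2 μ) :
    inner ℂ (hp.toLp p) u = ∫ x, u x * q x ∂μ := by
  rw [L2.inner_def]
  refine integral_congr_ae ?_
  filter_upwards [hp.coeFn_toLp] with x hx
  rw [RCLike.inner_apply, hx, hpq, Complex.conj_conj]

lemma memLp_conj {μ : Measure (Eu d)} {q : Eu d → ℂ} (hq : MemLp q 2 μ) :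
    MemLp (fun x => conj (q x)) 2 μ := hq.star

lemma continuous_integral_mul {μ : Measure (Eu d)} {q : Eu d → ℂ} (hq : MemLp q 2 μ) :
    Continuous fun u : Lp ℂ 2 μ => ∫ x, u x * q x ∂μ := by
  simp_rw [← inner_toLp_conj (memLp_conj hq) (fun _ => rfl)]
  fun_prop

/-- The complex conjugate of a `C¹` function. -/
noncomputable def conjC (f : C1c d) : C1c d :=
  ⟨fun x => conj ((f : Eu d → ℂ) x), Complex.conjCLE.contDiff.comp f.2.1,
    f.2.2.comp_left (g := conj) (map_zero _)⟩

lemma pderiv_conj {f : Eu d → ℂ} (hf : ContDiff ℝ 1 f) (i : Fin d) (x : Eu d) :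
    pderiv i (fun x => conj (f x)) x = conj (pderiv i f x) := by
  have h := (hf.differentiable (by simp) x).hasFDerivAt
  have h2 : HasFDerivAt (fun x => conj (f x)) _ x :=
    Complex.conjCLE.toContinuousLinearMap.hasFDerivAt.comp x h
  simp only [pderiv]
  rw [h2.fderiv]
  rfl

lemma conjC_mem_tests {f : C1c d} (hf : f ∈ tests d) : conjC f ∈ tests d :=
  ⟨Complex.conjCLE.contDiff.comp hf.smooth, (conjC f).2.2⟩

lemma setIntegral_eq_of_tsupport {f g : Eu d → ℂ} (hg : tsupport g ⊆ D) :
    ∫ x in D, f x * g x = ∫ x, f x * g x :=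
  setIntegral_eq_integral_of_forall_compl_eq_zero fun x hx => by
    rw [image_eq_zero_of_notMem_tsupport fun h => hx (hg h), mul_zero]

lemma tsupport_pderiv_subset (g : Eu d → ℂ) (i : Fin d) : tsupport (pderiv i g) ⊆ tsupport g :=
  tsupport_fderiv_apply_subset ℝ _

/-- Integration by parts, for a function that vanishes near the boundary. -/
lemma integral_mul_pderiv {f g : Eu d → ℂ} (hf : ContDiff ℝ 1 f) (hg : g ∈ C1c d)
    (hgD : tsupport g ⊆ D) (i : Fin d) :
    ∫ x, f x * pderiv i g x ∂(vol D) = - ∫ x, pderiv i f x * g x ∂(vol D) := by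
  rw [setIntegral_eq_of_tsupport hgD,
    setIntegral_eq_of_tsupport ((tsupport_pderiv_subset g i).trans hgD)]
  have hgc := hg.1.continuous
  have hg'c := continuous_pderiv hg.1 i
  have hf'c := continuous_pderiv hf i
  have hg's : HasCompactSupport (pderiv i g) :=
    hg.2.fderiv_apply (𝕜 := ℝ) (EuclideanSpace.single i 1)
  refine integral_mul_fderiv_eq_neg_fderiv_mul_of_integrable ?_ ?_ ?_
    (fun x _ => hf.differentiable (by simp) x) (fun x _ => hg.1.differentiable (by simp) x)
  · exact (hf'c.mul hgc).integrable_of_hasCompactSupport hg.2.mul_left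
  · exact (hf.continuous.mul hg'c).integrable_of_hasCompactSupport hg's.mul_left
  · exact (hf.continuous.mul hgc).integrable_of_hasCompactSupport hg.2.mul_left

lemma Energy.tendsto_iff {F : ℕ → Energy D} {U : Energy D} :
    Tendsto F atTop (𝓝 U) ↔ Tendsto (fun n => (F n).val) atTop (𝓝 U.val) ∧
      Tendsto (fun n => (F n).tr) atTop (𝓝 U.tr) ∧
      ∀ i, Tendsto (fun n => (F n).gr i) atTop (𝓝 (U.gr i)) := by
  constructor
  · intro h
    refine ⟨(Energy.val.continuous.tendsto U).comp h, (Energy.tr.continuous.tendsto U).comp h,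
      fun i => ?_⟩
    exact (((PiLp.continuous_apply 2 _ i).comp Energy.gr.continuous).tendsto U).comp h
  · rintro ⟨h1, h2, h3⟩
    rw [tendsto_iff_norm_sub_tendsto_zero] at h1 h2 ⊢
    have h4 : Tendsto (fun n => ‖F n - U‖ ^ 2) atTop (𝓝 0) := by
      have h5 : ∀ n, ‖F n - U‖ ^ 2 = ‖(F n).val - U.val‖ ^ 2 + (‖(F n).tr - U.tr‖ ^ 2
          + ∑ i, ‖(F n).gr i - U.gr i‖ ^ 2) := by
        intro n
        rw [Energy.norm_sq_eq, map_sub, map_sub, map_sub, PiLp.norm_sq_eq_of_L2]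
        rfl
      simp_rw [h5]
      have h6 : Tendsto (fun n => ∑ i, ‖(F n).gr i - U.gr i‖ ^ 2) atTop
          (𝓝 (∑ _i : Fin d, (0 : ℝ) ^ 2)) :=
        tendsto_finsetSum _ fun i _ => (tendsto_iff_norm_sub_tendsto_zero.1 (h3 i)).pow 2
      simpa using (h1.pow 2).add ((h2.pow 2).add h6)
    have h7 := h4.sqrt
    simpa using h7

lemma tendsto_toLp_iff {μ : Measure (Eu d)} {f : ℕ → Eu d → ℂ} (hf : ∀ n, MemLp (f n) 2 μ)
    (u : Lp ℂ 2 μ) : Tendsto (fun n => (hf n).toLp (f n)) atTop (𝓝 u) ↔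
      Tendsto (fun n => eLpNorm (f n - (u : Eu d → ℂ)) 2 μ) atTop (𝓝 0) := by
  rw [← Lp.tendsto_Lp_iff_tendsto_eLpNorm'' f hf u (Lp.memLp u), Lp.toLp_coeFn]

lemma surf_ae_notMem (hD : IsOpen D) : ∀ᵐ x ∂(surf D), x ∉ D := by
  have : ∀ᵐ x ∂(surf D), x ∈ frontier D := by
    rw [ae_iff]; exact surf_compl_frontier D
  filter_upwards [this] with x hx
  rw [hD.frontier_eq] at hx
  exact hx.2

section
variable [IsFiniteMeasure (surf D)]

lemma inner_val_conjC (f : C1c d) (u : DomL2 D) :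
    inner ℂ (toEnergy D (conjC f)).val u = ∫ x, u x * (f : Eu d → ℂ) x ∂(vol D) :=
  inner_toLp_conj (C1c.memLp (conjC f).2 (vol D)) (fun _ => rfl) u

lemma inner_tr_conjC (f : C1c d) (τ : BdryL2 D) :
    inner ℂ (toEnergy D (conjC f)).tr τ = ∫ x, τ x * (f : Eu d → ℂ) x ∂(surf D) :=
  inner_toLp_conj (C1c.memLp (conjC f).2 (surf D)) (fun _ => rfl) τ

lemma inner_gr_conjC (f : C1c d) (g : PiLp 2 fun _ : Fin d => DomL2 D) :
    inner ℂ (toEnergy D (conjC f)).gr g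
      = ∑ i, ∫ x, g i x * pderiv i (f : Eu d → ℂ) x ∂(vol D) := by
  rw [PiLp.inner_apply]
  exact Finset.sum_congr rfl fun i _ =>
    inner_toLp_conj (C1c.memLp_pderiv (conjC f).2 i (vol D)) (pderiv_conj f.2.1 i) (g i)

lemma hasWeakGradient_of_mem {U : Energy D} (hU : U ∈ energySpace D (tests d)) :
    HasWeakGradient D U.val (fun i => U.gr i) := by
  intro φ hφ hφD i
  have hφ' := hφ.mem_C1c
  refine energySpace_induction (p := fun U => ∫ x, U.val x * pderiv i φ x ∂(vol D)
    = - ∫ x, U.gr i x * φ x ∂(vol D)) ?_ (fun f _ => ?_) U hU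
  · have h1 := continuous_integral_mul (C1c.memLp_pderiv hφ' i (vol D))
    have h2 := continuous_integral_mul (C1c.memLp hφ' (vol D))
    refine isClosed_eq (h1.comp Energy.val.continuous) (Continuous.neg ?_)
    exact h2.comp ((PiLp.continuous_apply 2 _ i).comp Energy.gr.continuous)
  · have h1 : ((toEnergy D f).val : Eu d → ℂ) =ᵐ[vol D] f :=
      (C1c.memLp f.2 (vol D)).coeFn_toLp
    have h2 : ((toEnergy D f).gr i : Eu d → ℂ) =ᵐ[vol D] pderiv i (f : Eu d → ℂ) :=
      (C1c.memLp_pderiv f.2 i (vol D)).coeFn_toLp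
    rw [integral_mul_congr_left h1, integral_mul_congr_left h2]
    exact integral_mul_pderiv f.2.1 hφ' hφD i

lemma mem_energySpace_iff {S : Submodule ℂ (C1c d)} {U : Energy D} :
    U ∈ energySpace D S ↔ ∃ f : ℕ → C1c d, (∀ n, f n ∈ S) ∧
      Tendsto (fun n => toEnergy D (f n)) atTop (𝓝 U) := by
  constructor
  · intro hU
    obtain ⟨F, hF, hlim⟩ := mem_closure_iff_seq_limit.1
      (show U ∈ closure ((S.map (toEnergy D) : Submodule ℂ (Energy D)) : Set (Energy D)) from hU)
    choose f hf hfF using hF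
    exact ⟨f, hf, by simpa only [hfF] using hlim⟩
  · rintro ⟨f, hf, hlim⟩
    exact (Submodule.isClosed_topologicalClosure _).mem_of_tendsto hlim
      (Eventually.of_forall fun n => toEnergy_mem (hf n))

lemma hasTrace_of_mem {U : Energy D} (hU : U ∈ energySpace D (tests d)) :
    HasTrace D U.val (fun i => U.gr i) U.tr := by
  obtain ⟨f, hf, hlim⟩ := mem_energySpace_iff.1 hU
  obtain ⟨h1, h2, h3⟩ := Energy.tendsto_iff.1 hlim
  exact ⟨fun n => f n, hf, (tendsto_toLp_iff (fun n => C1c.memLp (f n).2 (vol D)) _).1 h1,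
    fun i => (tendsto_toLp_iff (fun n => C1c.memLp_pderiv (f n).2 i (vol D)) _).1 (h3 i),
    (tendsto_toLp_iff (fun n => C1c.memLp (f n).2 (surf D)) _).1 h2⟩

/-- The point of the energy space that is given by a regular solution. -/
noncomputable def RegularSolution.toEnergy {v : Eu d → ℂ} {E : ℝ} (ψ : RegularSolution D v E) :
    Energy D :=
  Energy.mk (ψ.memLp_toFun.toLp _) ψ.trace (fun i => (ψ.memLp_grad i).toLp _)

lemma RegularSolution.toEnergy_mem {v : Eu d → ℂ} {E : ℝ} (ψ : RegularSolution D v E) :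
    ψ.toEnergy ∈ energySpace D (tests d) := by
  obtain ⟨φ, hφ, h1, h2, h3⟩ := ψ.hasTrace
  refine mem_energySpace_iff.2 ⟨fun n => ⟨φ n, (hφ n).mem_C1c⟩, hφ, ?_⟩
  refine Energy.tendsto_iff.2 ⟨?_, ?_, fun i => ?_⟩
  · exact (Lp.tendsto_Lp_iff_tendsto_eLpNorm'' _ (fun n => C1c.memLp (hφ n).mem_C1c (vol D)) _
      ψ.memLp_toFun).2 h1
  · exact (tendsto_toLp_iff (fun n => C1c.memLp (hφ n).mem_C1c (surf D)) _).2 h3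
  · exact (Lp.tendsto_Lp_iff_tendsto_eLpNorm'' _
      (fun n => C1c.memLp_pderiv (hφ n).mem_C1c i (vol D)) _ (ψ.memLp_grad i)).2 (h2 i)

/-- A point of the energy space that satisfies Green's formula and the equation is a regular
solution. -/
noncomputable def RegularSolution.ofEnergy {v : Eu d → ℂ} {E : ℝ} (hD : IsOpen D) {U : Energy D}
    (hU : U ∈ energySpace D (tests d)) (w : DomL2 D) (h : BdryL2 D)
    (hgreen : ∀ φ : Eu d → ℂ, IsTest φ → (∑ i, ∫ x, U.gr i x * pderiv i φ x ∂(vol D))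
      + ∫ x, w x * φ x ∂(vol D) = ∫ x, h x * φ x ∂(surf D))
    (heq : ∀ᵐ x ∂(vol D), - w x + v x * U.val x = (E : ℂ) * U.val x) : RegularSolution D v E where
  toFun := U.val
  grad i := U.gr i
  lap := w
  trace := U.tr
  normalDeriv := h
  memLp_toFun := Lp.memLp _
  memLp_grad _ := Lp.memLp _
  memLp_lap := Lp.memLp _
  hasWeakGradient := hasWeakGradient_of_mem hU
  hasWeakLaplacian φ hφ hs := by
    have h1 : ∫ x, h x * φ x ∂(surf D) = 0 := by
      refine integral_eq_zero_of_ae ?_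
      filter_upwards [surf_ae_notMem hD] with x hx
      rw [image_eq_zero_of_notMem_tsupport fun h => hx (hs h), mul_zero, Pi.zero_apply]
    exact eq_neg_of_add_eq_zero_left ((hgreen φ hφ).trans h1)
  hasTrace := hasTrace_of_mem hU
  hasNormalDeriv φ hφ :=
    ⟨(Lp.memLp h).integrable_mul (C1c.memLp hφ.mem_C1c (surf D)), hgreen φ hφ⟩
  equation := heq

/-- An element of the energy space is determined by its values in `D`. -/
lemma eq_zero_of_val_eq_zero (hD : IsC2Domain D) {U : Energy D}
    (hU : U ∈ energySpace D (tests d)) (h0 : U.val = 0) : U = 0 := by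
  have hval : (U.val : Eu d → ℂ) =ᵐ[vol D] 0 := by rw [h0]; exact Lp.coeFn_zero _ _ _
  have hvf : IsFiniteMeasure (vol D) := ⟨by simpa using hD.isBounded.measure_lt_top⟩
  have hgr : ∀ i, U.gr i = 0 := by
    intro i
    have hint : Integrable (U.gr i : Eu d → ℂ) (vol D) := (Lp.memLp (U.gr i)).integrable (by simp)
    have h1 : ∀ᵐ x ∂volume, x ∈ D → (U.gr i : Eu d → ℂ) x = 0 := by
      refine hD.isOpen.ae_eq_zero_of_integral_contDiff_smul_eq_zero
        (IntegrableOn.locallyIntegrableOn hint) fun g hg hgc hgD => ?_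
      have hts : tsupport (fun x => (g x : ℂ)) ⊆ D :=
        (closure_mono (Function.support_comp_subset (g := ((↑) : ℝ → ℂ)) rfl g)).trans hgD
      have ht : IsTest (fun x => (g x : ℂ)) :=
        ⟨Complex.ofRealCLM.contDiff.comp hg, hgc.comp_left (g := ((↑) : ℝ → ℂ)) rfl⟩
      have h2 := hasWeakGradient_of_mem hU _ ht hts i
      have h3 : ∫ x, (U.val : Eu d → ℂ) x * pderiv i (fun x => (g x : ℂ)) x ∂(vol D) = 0 := by
        refine integral_eq_zero_of_ae ?_
        filter_upwards [hval] with x hx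
        rw [hx]; simp
      rw [h3, setIntegral_eq_of_tsupport hts] at h2
      rw [← neg_eq_zero, h2]
      congr 2
      funext x
      rw [Complex.real_smul, mul_comm]
    rw [Lp.eq_zero_iff_ae_eq_zero]
    exact (ae_restrict_iff' hD.isOpen.measurableSet).2 h1
  have hgr' : U.gr = 0 := by ext1 i; exact hgr i
  refine Energy.ext' (by simpa using h0) ?_ fun i => by simpa using hgr i
  obtain ⟨C, _, hC⟩ := exists_norm_tr_sq_le hD one_pos
  have h1 := hC U hU
  rw [h0, hgr'] at h1
  simp only [norm_zero] at h1
  have h2 : ‖U.tr‖ = 0 := by nlinarith [norm_nonneg U.tr]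
  simpa using h2

/-- A regular solution that vanishes in `D` has vanishing boundary values and normal derivative. -/
lemma RegularSolution.eq_zero (hD : IsC2Domain D) {v : Eu d → ℂ} {E : ℝ}
    (ψ : RegularSolution D v E) (h0 : ψ.toFun =ᵐ[vol D] 0) :
    ψ.trace = 0 ∧ ψ.normalDeriv = 0 := by
  have hv : ψ.toEnergy.val = 0 := by
    rw [Lp.eq_zero_iff_ae_eq_zero]
    exact ψ.memLp_toFun.coeFn_toLp.trans h0
  have hU := eq_zero_of_val_eq_zero hD ψ.toEnergy_mem hv
  have hgrad : ∀ i, ψ.grad i =ᵐ[vol D] 0 := by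
    intro i
    have h1 : ψ.toEnergy.gr i = 0 := by rw [hU]; simp
    exact ((ψ.memLp_grad i).coeFn_toLp.symm).trans ((Lp.eq_zero_iff_ae_eq_zero).1 h1)
  have hlap : ψ.lap =ᵐ[vol D] 0 := by
    filter_upwards [ψ.equation, h0] with x h1 h2
    rw [h2] at h1
    simpa using h1
  refine ⟨?_, ?_⟩
  · have h1 : ψ.toEnergy.tr = 0 := by rw [hU]; simp
    exact h1
  · rw [Lp.eq_zero_iff_ae_eq_zero]
    have hint : Integrable (ψ.normalDeriv : Eu d → ℂ) (surf D) :=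
      (Lp.memLp ψ.normalDeriv).integrable (by simp)
    refine ae_eq_zero_of_integral_contDiff_smul_eq_zero hint.locallyIntegrable fun g hg hgc => ?_
    have ht : IsTest (fun x => (g x : ℂ)) :=
      ⟨Complex.ofRealCLM.contDiff.comp hg, hgc.comp_left (g := ((↑) : ℝ → ℂ)) rfl⟩
    have h1 := (ψ.hasNormalDeriv _ ht).2
    have h2 : ∀ i, ∫ x, ψ.grad i x * pderiv i (fun x => (g x : ℂ)) x ∂(vol D) = 0 := fun i => by
      refine integral_eq_zero_of_ae ?_
      filter_upwards [hgrad i] with x hx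
      rw [hx]; simp
    have h3 : ∫ x, ψ.lap x * (g x : ℂ) ∂(vol D) = 0 := by
      refine integral_eq_zero_of_ae ?_
      filter_upwards [hlap] with x hx
      rw [hx]; simp
    rw [h3, Finset.sum_eq_zero fun i _ => h2 i, add_zero] at h1
    rw [h1]
    congr 1
    funext x
    rw [Complex.real_smul, mul_comm]

end

end

/-! ### Density of test functions with support in the interior -/

section

variable {d : ℕ} {D : Set (Eu d)}

/-- Dominated convergence in `L²`. -/
lemma tendsto_toLp_of_bounded {μ : Measure (Eu d)} [IsFiniteMeasure μ] {F : ℕ → Eu d → ℂ}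
    {g : Eu d → ℂ} (hF : ∀ n, MemLp (F n) 2 μ) (hg : MemLp g 2 μ) (C : ℝ)
    (hb : ∀ n, ∀ᵐ x ∂μ, ‖F n x‖ ≤ C)
    (hlim : ∀ᵐ x ∂μ, Tendsto (fun n => F n x) atTop (𝓝 (g x))) :
    Tendsto (fun n => (hF n).toLp (F n)) atTop (𝓝 (hg.toLp g)) := by
  have h0 : Tendsto (fun n => ∫⁻ x, ‖F n x - g x‖ₑ ^ 2 ∂μ) atTop (𝓝 (∫⁻ _, 0 ∂μ)) := by
    refine tendsto_lintegral_of_dominated_convergence' (fun _ => ENNReal.ofReal (C + C) ^ 2)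
      (fun n => (((hF n).1.sub hg.1).enorm.pow_const 2)) (fun n => ?_) ?_ ?_
    · filter_upwards [hb n, hlim, ae_all_iff.2 hb] with x h1 h2 h3
      have h4 : ‖g x‖ ≤ C := le_of_tendsto h2.norm (Eventually.of_forall h3)
      rw [← ofReal_norm]
      gcongr
      exact (norm_sub_le _ _).trans (add_le_add h1 h4)
    · rw [lintegral_const]
      exact ENNReal.mul_ne_top (by simp) (measure_ne_top _ _)
    · filter_upwards [hlim] with x hx
      have h5 : Tendsto (fun n => ‖F n x - g x‖ₑ ^ 2) atTop (𝓝 (‖g x - g x‖ₑ ^ 2)) :=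
        (ENNReal.continuous_pow 2).tendsto _ |>.comp ((hx.sub_const (g x)).enorm)
      simpa using h5
  rw [lintegral_zero] at h0
  rw [tendsto_iff_norm_sub_tendsto_zero]
  have h1 : ∀ n, ∫⁻ x, ‖F n x - g x‖ₑ ^ 2 ∂μ
      = ENNReal.ofReal (‖(hF n).toLp (F n) - hg.toLp g‖ ^ 2) := by
    intro n
    rw [← MemLp.toLp_sub (hF n) hg, ofReal_norm_toLp_sq]
    rfl
  simp_rw [h1] at h0
  have h2 := (ENNReal.tendsto_toReal ENNReal.zero_ne_top).comp h0
  have h3 : Tendsto (fun n => ‖(hF n).toLp (F n) - hg.toLp g‖ ^ 2) atTop (𝓝 0) := by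
    refine h2.congr fun n => ?_
    simp only [Function.comp]
    rw [ENNReal.toReal_ofReal (by positivity)]
  simpa using h3.sqrt

lemma ae_surf_mem_frontier (D : Set (Eu d)) : ∀ᵐ x ∂(surf D), x ∈ frontier D := by
  rw [ae_iff]; exact surf_compl_frontier D

lemma isFiniteMeasure_vol (hD : IsC2Domain D) : IsFiniteMeasure (vol D) :=
  ⟨by simpa using hD.isBounded.measure_lt_top⟩

section
variable [IsFiniteMeasure (surf D)]

/-- Bounded pointwise convergence of the functions and of their derivatives in `D` gives membership
in an energy space, if the boundary values stay fixed. -/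
lemma toEnergy_mem_of_tendsto (hD : IsC2Domain D) {S : Submodule ℂ (C1c d)} {F : ℕ → C1c d}
    {g : C1c d} (hF : ∀ n, toEnergy D (F n) ∈ energySpace D S) (C : ℝ)
    (hb : ∀ n, ∀ x ∈ D, ‖(F n : Eu d → ℂ) x‖ ≤ C)
    (hb' : ∀ n i, ∀ x ∈ D, ‖pderiv i (F n : Eu d → ℂ) x‖ ≤ C)
    (hlim : ∀ x ∈ D, Tendsto (fun n => (F n : Eu d → ℂ) x) atTop (𝓝 ((g : Eu d → ℂ) x)))
    (hlim' : ∀ i, ∀ x ∈ D, Tendsto (fun n => pderiv i (F n : Eu d → ℂ) x) atTop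
      (𝓝 (pderiv i (g : Eu d → ℂ) x)))
    (hfr : ∀ n, ∀ x ∈ frontier D, (F n : Eu d → ℂ) x = (g : Eu d → ℂ) x) :
    toEnergy D g ∈ energySpace D S := by
  have := isFiniteMeasure_vol hD
  have hm := hD.isOpen.measurableSet
  refine (Submodule.isClosed_topologicalClosure _).mem_of_tendsto (b := atTop) ?_
    (Eventually.of_forall hF)
  refine Energy.tendsto_iff.2 ⟨?_, ?_, fun i => ?_⟩
  · exact tendsto_toLp_of_bounded (fun n => C1c.memLp (F n).2 (vol D)) (C1c.memLp g.2 (vol D)) C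
      (fun n => (ae_restrict_mem hm).mono fun x hx => hb n x hx)
      ((ae_restrict_mem hm).mono hlim)
  · have h1 : ∀ n, (toEnergy D (F n)).tr = (toEnergy D g).tr := fun n =>
      MemLp.toLp_congr (C1c.memLp (F n).2 (surf D)) (C1c.memLp g.2 (surf D))
        ((ae_surf_mem_frontier D).mono fun x hx => hfr n x hx)
    simp_rw [h1]
    exact tendsto_const_nhds
  · exact tendsto_toLp_of_bounded (fun n => C1c.memLp_pderiv (F n).2 i (vol D))
      (C1c.memLp_pderiv g.2 i (vol D)) C
      (fun n => (ae_restrict_mem hm).mono fun x hx => hb' n i x hx)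
      ((ae_restrict_mem hm).mono (hlim' i))

lemma toEnergy_congr (hD : IsOpen D) {f g : C1c d}
    (h : ∀ x ∈ closure D, (f : Eu d → ℂ) x = (g : Eu d → ℂ) x) :
    toEnergy D f = toEnergy D g := by
  refine Energy.ext' ?_ ?_ fun i => ?_
  · exact MemLp.toLp_congr (C1c.memLp f.2 (vol D)) (C1c.memLp g.2 (vol D))
      ((ae_restrict_mem hD.measurableSet).mono fun x hx => h x (subset_closure hx))
  · exact MemLp.toLp_congr (C1c.memLp f.2 (surf D)) (C1c.memLp g.2 (surf D))
      ((ae_surf_mem_frontier D).mono fun x hx => h x (frontier_subset_closure hx))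
  · refine MemLp.toLp_congr (C1c.memLp_pderiv f.2 i (vol D)) (C1c.memLp_pderiv g.2 i (vol D))
      ((ae_restrict_mem hD.measurableSet).mono fun x hx => ?_)
    have h1 : (f : Eu d → ℂ) =ᶠ[𝓝 x] g :=
      (hD.mem_nhds hx) |> fun h2 => Filter.mem_of_superset h2 fun y hy => h y (subset_closure hy)
    simp only [pderiv, h1.fderiv_eq]

end

lemma exists_norm_le_of_C1c {f : Eu d → ℂ} (hf : f ∈ C1c d) :
    ∃ C, (∀ x, ‖f x‖ ≤ C) ∧ ∀ i x, ‖pderiv i f x‖ ≤ C := by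
  obtain ⟨C0, h0⟩ := hf.2.exists_bound_of_continuous hf.1.continuous
  have h1 : ∀ i, ∃ C, ∀ x, ‖pderiv i f x‖ ≤ C := fun i =>
    (hf.2.fderiv_apply (𝕜 := ℝ) (EuclideanSpace.single i 1)).exists_bound_of_continuous
      (continuous_pderiv hf.1 i)
  choose C hC using h1
  refine ⟨max C0 (∑ i, max (C i) 0), fun x => (h0 x).trans (le_max_left _ _), fun i x => ?_⟩
  refine ((hC i x).trans ?_).trans (le_max_right _ _)
  exact (le_max_left _ _).trans
    (Finset.single_le_sum (f := fun i => max (C i) 0) (fun _ _ => le_max_right _ _)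
      (Finset.mem_univ i))

open scoped Convolution in
lemma pderiv_convolution {p : Eu d → ℝ} (hp : Continuous p) {f : Eu d → ℂ} (hf : f ∈ C1c d)
    (i : Fin d) (x : Eu d) :
    pderiv i (p ⋆[ContinuousLinearMap.lsmul ℝ ℝ, volume] f) x
      = (p ⋆[ContinuousLinearMap.lsmul ℝ ℝ, volume] pderiv i f) x := by
  have hl : LocallyIntegrable p := hp.locallyIntegrable
  rw [pderiv, (hf.2.hasFDerivAt_convolution_right _ hl hf.1 x).fderiv,
    convolution_precompR_apply _ hl (hf.2.fderiv ℝ) (hf.1.continuous_fderiv one_ne_zero)]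
  rfl

open scoped Convolution in
/-- A `C¹` function that vanishes near the boundary is a limit of such smooth functions, by
mollification. -/
lemma toEnergy_mem_of_tsupport_subset [IsFiniteMeasure (surf D)] (hD : IsC2Domain D) {f : C1c d}
    (hf : tsupport (f : Eu d → ℂ) ⊆ D) : toEnergy D f ∈ energySpace D (interiorTests D) := by
  obtain ⟨δ, hδ, hδD⟩ := (show IsCompact (tsupport (f : Eu d → ℂ)) from
    f.2.2).exists_cthickening_subset_open hD.isOpen hf
  let b : ℕ → ContDiffBump (0 : Eu d) := fun n =>
    ⟨δ / (n + 2) / 2, δ / (n + 2), by positivity, half_lt_self (by positivity)⟩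
  have hb0 : Tendsto (fun n => (b n).rOut) atTop (𝓝 0) := by
    have := (tendsto_const_div_atTop_nhds_zero_nat δ).comp (tendsto_add_atTop_nat 2)
    refine this.congr fun n => ?_
    simp [b]
  have hbδ : ∀ n, (b n).rOut ≤ δ := fun n => by
    refine div_le_self hδ.le ?_
    have : (0 : ℝ) ≤ n := Nat.cast_nonneg n
    linarith
  have hbc : ∀ n, Continuous ((b n).normed volume) := fun n => (b n).continuous_normed
  let F : ℕ → Eu d → ℂ := fun n =>
    ((b n).normed volume) ⋆[ContinuousLinearMap.lsmul ℝ ℝ, volume] (f : Eu d → ℂ)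
  have hsupp : ∀ n, tsupport (F n) ⊆ Metric.cthickening δ (tsupport (f : Eu d → ℂ)) := by
    intro n
    refine closure_minimal ?_ Metric.isClosed_cthickening
    refine (support_convolution_subset _).trans ?_
    rintro _ ⟨y, hy, z, hz, rfl⟩
    rw [(b n).support_normed_eq] at hy
    refine Metric.mem_cthickening_of_dist_le _ z δ _ (subset_tsupport _ hz) ?_
    rw [mem_ball_zero_iff] at hy
    simpa using (hy.le.trans (hbδ n))
  have hcomp : ∀ n, HasCompactSupport (F n) := fun n =>
    HasCompactSupport.convolution _ (b n).hasCompactSupport_normed f.2.2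
  have hsm : ∀ n, ContDiff ℝ ∞ (F n) := fun n =>
    HasCompactSupport.contDiff_convolution_left _ (b n).hasCompactSupport_normed
      (b n).contDiff_normed f.2.1.continuous.locallyIntegrable
  have htest : ∀ n, IsTest (F n) := fun n => ⟨hsm n, hcomp n⟩
  obtain ⟨C, hC, hC'⟩ := exists_norm_le_of_C1c f.2
  have hbound : ∀ {q : Eu d → ℂ}, Continuous q → (∀ x, ‖q x‖ ≤ C) → ∀ n x,
      ‖(((b n).normed volume) ⋆[ContinuousLinearMap.lsmul ℝ ℝ, volume] q) x‖ ≤ C + C + C := by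
    intro q hq hqC n x
    have h1 := (b n).dist_normed_convolution_le (μ := volume) (x₀ := x) (ε := C + C)
      hq.aestronglyMeasurable (fun y _ => by
        rw [dist_eq_norm]
        exact (norm_sub_le _ _).trans (add_le_add (hqC _) (hqC _)))
    rw [dist_eq_norm] at h1
    have h2 := norm_le_norm_sub_add
      ((((b n).normed volume) ⋆[ContinuousLinearMap.lsmul ℝ ℝ, volume] q) x) (q x)
    linarith [hqC x]
  refine toEnergy_mem_of_tendsto hD (F := fun n => ⟨F n, (htest n).mem_C1c⟩) (fun n =>
    toEnergy_mem ⟨htest n, (hsupp n).trans hδD⟩) (C + C + C)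
    (fun n x _ => hbound f.2.1.continuous hC n x) (fun n i x _ => ?_)
    (fun x _ => ContDiffBump.convolution_tendsto_right_of_continuous hb0 f.2.1.continuous x)
    (fun i x _ => ?_) (fun n x hx => ?_)
  · rw [pderiv_convolution (hbc n) f.2]
    exact hbound (continuous_pderiv f.2.1 i) (hC' i) n x
  · simp_rw [F, pderiv_convolution (hbc _) f.2]
    exact ContDiffBump.convolution_tendsto_right_of_continuous hb0 (continuous_pderiv f.2.1 i) x
  · rw [hD.isOpen.frontier_eq] at hx
    have h1 : ∀ {q : Eu d → ℂ}, tsupport q ⊆ D → q x = 0 := fun hq =>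
      image_eq_zero_of_notMem_tsupport fun h => hx.2 (hq h)
    exact (h1 ((hsupp n).trans hδD)).trans (h1 hf).symm

end

/-! ### Cutoffs near the boundary -/

section

variable {d : ℕ} {D : Set (Eu d)}

/-- The partial derivative of a real function. -/
noncomputable def rderiv (i : Fin d) (a : Eu d → ℝ) (x : Eu d) : ℝ :=
  fderiv ℝ a x (EuclideanSpace.single i 1)

lemma continuous_rderiv {a : Eu d → ℝ} (ha : ContDiff ℝ 1 a) (i : Fin d) :
    Continuous (rderiv i a) :=
  (ha.continuous_fderiv (by simp)).clm_apply continuous_const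

lemma abs_rderiv_le (i : Fin d) (a : Eu d → ℝ) (x : Eu d) : |rderiv i a x| ≤ ‖fderiv ℝ a x‖ := by
  have := (fderiv ℝ a x).le_opNorm (EuclideanSpace.single i 1)
  simpa [rderiv] using this

lemma pderiv_ofReal_mul {a : Eu d → ℝ} (ha : ContDiff ℝ 1 a) {f : Eu d → ℂ} (hf : ContDiff ℝ 1 f)
    (i : Fin d) (x : Eu d) : pderiv i (fun y => (a y : ℂ) * f y) x
      = (rderiv i a x : ℂ) * f x + (a x : ℂ) * pderiv i f x := by
  have h1 : HasFDerivAt (fun y => (a y : ℂ)) (Complex.ofRealCLM.comp (fderiv ℝ a x)) x :=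
    Complex.ofRealCLM.hasFDerivAt.comp x (ha.differentiable (by simp) x).hasFDerivAt
  have h2 := (hf.differentiable (by simp) x).hasFDerivAt
  have h3 : HasFDerivAt (fun y => (a y : ℂ) * f y) _ x := h1.mul h2
  rw [pderiv, h3.fderiv]
  simp [rderiv, pderiv]
  ring

/-- The product of a real `C¹` function and a compactly supported `C¹` function. -/
noncomputable def mulC (a : Eu d → ℝ) (ha : ContDiff ℝ 1 a) (f : C1c d) : C1c d :=
  ⟨fun x => (a x : ℂ) * (f : Eu d → ℂ) x,
    (Complex.ofRealCLM.contDiff.comp ha).mul f.2.1, f.2.2.mul_left⟩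

lemma exists_deriv_smoothTransition_le :
    ∃ M : ℝ, 0 ≤ M ∧ ∀ s, |deriv Real.smoothTransition s| ≤ M := by
  have hz : ∀ s, s ∉ Set.Icc (0 : ℝ) 1 → deriv Real.smoothTransition s = 0 := by
    intro s hs
    rw [Set.mem_Icc, not_and_or, not_le, not_le] at hs
    rcases hs with hs | hs
    · have : Real.smoothTransition =ᶠ[𝓝 s] fun _ => 0 :=
        (Iio_mem_nhds hs) |> fun h => mem_of_superset h fun y hy =>
          Real.smoothTransition.zero_of_nonpos (le_of_lt hy)
      rw [this.deriv_eq, deriv_const]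
    · have : Real.smoothTransition =ᶠ[𝓝 s] fun _ => 1 :=
        (Ioi_mem_nhds hs) |> fun h => mem_of_superset h fun y hy =>
          Real.smoothTransition.one_of_one_le (le_of_lt hy)
      rw [this.deriv_eq, deriv_const]
  have hc : Continuous (deriv Real.smoothTransition) :=
    (Real.smoothTransition.contDiff (n := 1)).continuous_deriv le_rfl
  obtain ⟨M, hM⟩ := isCompact_Icc.exists_bound_of_continuousOn (s := Set.Icc (0 : ℝ) 1)
    hc.continuousOn
  refine ⟨max M 0, le_max_right _ _, fun s => ?_⟩
  by_cases hs : s ∈ Set.Icc (0 : ℝ) 1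
  · exact (hM s hs).trans (le_max_left _ _)
  · rw [hz s hs]; simp

namespace BoundaryChart

/-- A cutoff function that vanishes up to height `ε` and is `1` above height `2ε`. -/
noncomputable def layer (c : BoundaryChart D) (ε : ℝ) (x : Eu d) : ℝ :=
  Real.smoothTransition (c.height x / ε - 1)

lemma contDiff_layer (c : BoundaryChart D) (ε : ℝ) : ContDiff ℝ 1 (c.layer ε) :=
  Real.smoothTransition.contDiff.comp
    (((c.contDiff_height.of_le (by norm_num)).div_const ε).sub contDiff_const)

lemma layer_eq_zero (c : BoundaryChart D) {ε : ℝ} (hε : 0 < ε) {x : Eu d} (h : c.height x ≤ ε) :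
    c.layer ε x = 0 :=
  Real.smoothTransition.zero_of_nonpos (by rw [sub_nonpos, div_le_one hε]; exact h)

lemma layer_eq_one (c : BoundaryChart D) {ε : ℝ} (hε : 0 < ε) {x : Eu d} (h : 2 * ε ≤ c.height x) :
    c.layer ε x = 1 :=
  Real.smoothTransition.one_of_one_le (by rw [le_sub_iff_add_le, le_div_iff₀ hε]; linarith)

lemma abs_layer_le (c : BoundaryChart D) (ε : ℝ) (x : Eu d) : |c.layer ε x| ≤ 1 := by
  rw [layer, abs_of_nonneg (Real.smoothTransition.nonneg _)]
  exact Real.smoothTransition.le_one _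

lemma rderiv_layer (c : BoundaryChart D) (ε : ℝ) (i : Fin d) (x : Eu d) :
    rderiv i (c.layer ε) x
      = deriv Real.smoothTransition (c.height x / ε - 1) * (rderiv i c.height x / ε) := by
  have h1 := (c.contDiff_height.differentiable (by simp) x).hasFDerivAt
  have h2 : HasDerivAt Real.smoothTransition _ (c.height x / ε - 1) :=
    ((Real.smoothTransition.contDiff (n := 1)).differentiable (by simp) _).hasDerivAt
  have h3 : HasFDerivAt (fun y => c.height y / ε - 1) (ε⁻¹ • fderiv ℝ c.height x) x := by
    simpa [div_eq_inv_mul] using (h1.const_mul ε⁻¹).sub_const 1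
  have h4 : HasFDerivAt (c.layer ε) _ x := h2.comp_hasFDerivAt x h3
  rw [rderiv, h4.fderiv]
  simp only [smul_apply, smul_eq_mul, rderiv]
  ring

lemma rderiv_layer_eq_zero (c : BoundaryChart D) {ε : ℝ} (hε : 0 < ε) (i : Fin d) {x : Eu d}
    (h : c.height x < ε ∨ 2 * ε < c.height x) : rderiv i (c.layer ε) x = 0 := by
  have hc := c.contDiff_height.continuous
  have h1 : ∃ a : ℝ, c.layer ε =ᶠ[𝓝 x] fun _ => a := by
    rcases h with h | h
    · refine ⟨0, mem_of_superset ((isOpen_lt hc continuous_const).mem_nhds h) fun y hy => ?_⟩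
      exact c.layer_eq_zero hε (le_of_lt hy)
    · refine ⟨1, mem_of_superset ((isOpen_lt continuous_const hc).mem_nhds h) fun y hy => ?_⟩
      exact c.layer_eq_one hε (le_of_lt hy)
  obtain ⟨a, ha⟩ := h1
  rw [rderiv, ha.fderiv_eq]
  simp

lemma abs_rderiv_layer_le (c : BoundaryChart D) {ε : ℝ} (hε : 0 < ε) {M B : ℝ}
    (hM : ∀ s, |deriv Real.smoothTransition s| ≤ M) (i : Fin d) {x : Eu d}
    (hB : ‖fderiv ℝ c.height x‖ ≤ B) : |rderiv i (c.layer ε) x| ≤ M * B / ε := by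
  rw [rderiv_layer, abs_mul, abs_div, abs_of_pos hε, mul_div_assoc]
  have h1 := (abs_rderiv_le i c.height x).trans hB
  gcongr
  · exact (abs_nonneg _).trans (hM 0)
  · exact hM _

lemma height_pos (c : BoundaryChart D) {x : Eu d} (hx : x ∈ D) (hb : x ∈ c.base) :
    0 < c.height x := (c.mem_iff x hb).1 hx

/-- Cutting off near the boundary gives a function that is supported in the interior. -/
lemma tsupport_layer_mul_subset (c : BoundaryChart D) {ε : ℝ} (hε : 0 < ε) {g : Eu d → ℂ}
    (hg : tsupport g ⊆ c.base) : tsupport (fun x => (c.layer ε x : ℂ) * g x) ⊆ D := by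
  have h1 : tsupport (fun x => (c.layer ε x : ℂ) * g x) ⊆ tsupport g ∩ {x | ε ≤ c.height x} := by
    refine closure_minimal (fun x hx => ?_) ((isClosed_tsupport g).inter
      (isClosed_le continuous_const c.contDiff_height.continuous))
    have hx' : (c.layer ε x : ℂ) * g x ≠ 0 := hx
    refine ⟨subset_tsupport g (right_ne_zero_of_mul hx'), ?_⟩
    by_contra hlt
    exact left_ne_zero_of_mul hx' (by
      rw [c.layer_eq_zero hε (le_of_lt (not_le.1 hlt)), Complex.ofReal_zero])
  intro x hx
  obtain ⟨h2, h3⟩ := h1 hx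
  exact (c.mem_iff x (hg h2)).2 (hε.trans_le h3)

lemma eventually_mul_lt (a : ℝ) {b : ℝ} (hb : 0 < b) :
    ∀ᶠ n : ℕ in atTop, a * (1 / ((n : ℝ) + 1)) < b := by
  have := (tendsto_one_div_add_atTop_nhds_zero_nat (𝕜 := ℝ)).const_mul a
  rw [mul_zero] at this
  exact this.eventually (gt_mem_nhds hb)

/-- Pointwise limits of the cutoffs, as the layer becomes thin. -/
lemma eventually_layer (c : BoundaryChart D) {x : Eu d} (hx : x ∈ D) (hb : x ∈ c.base) :
    ∀ᶠ n : ℕ in atTop, c.layer (1 / ((n : ℝ) + 1)) x = 1 ∧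
      ∀ i, rderiv i (c.layer (1 / ((n : ℝ) + 1))) x = 0 := by
  filter_upwards [eventually_mul_lt 2 (c.height_pos hx hb)] with n hn
  exact ⟨c.layer_eq_one (by positivity) hn.le,
    fun i => c.rderiv_layer_eq_zero (by positivity) i (Or.inr hn)⟩

/-- A `C¹` function in a chart that vanishes on the boundary is a limit of test functions with
support in the interior. -/
lemma toEnergy_mem [IsFiniteMeasure (surf D)] (hD : IsC2Domain D) (c : BoundaryChart D)
    {g : C1c d} (hg : tsupport (g : Eu d → ℂ) ⊆ c.base)
    (h0 : ∀ x ∈ frontier D, (g : Eu d → ℂ) x = 0) :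
    toEnergy D g ∈ energySpace D (interiorTests D) := by
  obtain ⟨M, hM0, hM⟩ := exists_deriv_smoothTransition_le
  obtain ⟨B, hB⟩ := (show IsCompact (tsupport (g : Eu d → ℂ)) from
    g.2.2).exists_bound_of_continuousOn
    (c.contDiff_height.continuous_fderiv (by simp)).continuousOn
  obtain ⟨C, hC, hC'⟩ := exists_norm_le_of_C1c g.2
  obtain ⟨L, hL⟩ := ContDiff.lipschitzWith_of_hasCompactSupport g.2.2 g.2.1 one_ne_zero
  -- `g` vanishes at the foot of `x` on the boundary. This beats the factor `1 / ε` in the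
  -- derivative of the cutoff.
  have hgL : ∀ x ∈ c.base, x ∈ D → ‖(g : Eu d → ℂ) x‖ ≤ L * c.height x := by
    intro x hb hx
    have h1 := hL.dist_le_mul x (x - c.height x • c.dir)
    rw [h0 _ (c.foot_mem x hb), dist_zero_right, dist_eq_norm, sub_sub_cancel, norm_smul,
      c.norm_dir, mul_one, Real.norm_of_nonneg (c.height_pos hx hb).le] at h1
    exact h1
  have hz : ∀ x, x ∉ tsupport (g : Eu d → ℂ) → (g : Eu d → ℂ) x = 0 := fun x hx =>
    image_eq_zero_of_notMem_tsupport hx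
  have hz' : ∀ x i, x ∉ tsupport (g : Eu d → ℂ) → pderiv i (g : Eu d → ℂ) x = 0 := fun x i hx =>
    image_eq_zero_of_notMem_tsupport fun h => hx (tsupport_pderiv_subset _ i h)
  have hcut : ∀ (n : ℕ) x, ‖(c.layer (1 / ((n : ℝ) + 1)) x : ℂ)‖ ≤ 1 := fun n x => by
    rw [Complex.norm_real]; exact c.abs_layer_le _ x
  refine toEnergy_mem_of_tendsto hD
    (F := fun n : ℕ => mulC (c.layer (1 / ((n : ℝ) + 1))) (c.contDiff_layer _) g)
    (fun n => toEnergy_mem_of_tsupport_subset hD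
      (c.tsupport_layer_mul_subset (by positivity) hg)) (2 * M * |B| * L + C)
    (fun n x _ => ?_) (fun n i x hx => ?_) (fun x hx => ?_) (fun i x hx => ?_) (fun n x hx => ?_)
  · have h1 : ‖(c.layer (1 / ((n : ℝ) + 1)) x : ℂ) * (g : Eu d → ℂ) x‖ ≤ 1 * C := by
      rw [norm_mul]
      exact mul_le_mul (hcut n x) (hC x) (norm_nonneg _) zero_le_one
    have h2 : 0 ≤ 2 * M * |B| * L := by positivity
    change ‖(c.layer (1 / ((n : ℝ) + 1)) x : ℂ) * (g : Eu d → ℂ) x‖ ≤ _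
    linarith
  · change ‖pderiv i (fun y => (c.layer (1 / ((n : ℝ) + 1)) y : ℂ) * (g : Eu d → ℂ) y) x‖ ≤ _
    rw [pderiv_ofReal_mul (c.contDiff_layer _) g.2.1]
    refine (norm_add_le _ _).trans (add_le_add ?_ ?_)
    · by_cases hgx : x ∈ tsupport (g : Eu d → ℂ)
      · by_cases hε : 2 * (1 / ((n : ℝ) + 1)) < c.height x
        · rw [c.rderiv_layer_eq_zero (by positivity) i (Or.inr hε)]
          simp only [Complex.ofReal_zero, zero_mul, norm_zero]
          positivity
        · have h1 := c.abs_rderiv_layer_le (ε := 1 / ((n : ℝ) + 1)) (by positivity) hM i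
            ((hB x hgx).trans (le_abs_self B))
          rw [norm_mul, Complex.norm_real, Real.norm_eq_abs]
          calc _ ≤ M * |B| / (1 / ((n : ℝ) + 1)) * (L * (2 * (1 / ((n : ℝ) + 1)))) := by
                refine mul_le_mul h1 ((hgL x (hg hgx) hx).trans ?_) (norm_nonneg _) (by positivity)
                exact mul_le_mul_of_nonneg_left (not_lt.1 hε) L.2
            _ = _ := by field_simp
      · rw [hz x hgx, mul_zero, norm_zero]
        positivity
    · rw [norm_mul]
      exact (mul_le_mul (hcut n x) (hC' i x) (norm_nonneg _) zero_le_one).trans (one_mul C).le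
  · refine tendsto_const_nhds.congr' ?_
    by_cases hgx : x ∈ tsupport (g : Eu d → ℂ)
    · filter_upwards [c.eventually_layer hx (hg hgx)] with n hn
      change _ = (c.layer (1 / ((n : ℝ) + 1)) x : ℂ) * (g : Eu d → ℂ) x
      rw [hn.1, Complex.ofReal_one, one_mul]
    · exact Eventually.of_forall fun n => by simp [mulC, hz x hgx]
  · refine tendsto_const_nhds.congr' ?_
    have hp : ∀ n : ℕ, pderiv i (mulC (c.layer (1 / ((n : ℝ) + 1))) (c.contDiff_layer _) g :
        Eu d → ℂ) x = _ := fun n => pderiv_ofReal_mul (c.contDiff_layer _) g.2.1 i x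
    by_cases hgx : x ∈ tsupport (g : Eu d → ℂ)
    · filter_upwards [c.eventually_layer hx (hg hgx)] with n hn
      rw [hp n, hn.1, hn.2]; simp
    · exact Eventually.of_forall fun n => by
        refine Eq.trans ?_ (hp n).symm
        rw [hz x hgx, hz' x i hgx]; simp
  · simp [mulC, h0 x hx]

/-- The integral over `D` of a derivative of a function with support in a chart is bounded by its
boundary values. This inequality stands in for the divergence theorem: cut the function off in a
thin layer, integrate by parts, and let the layer shrink. -/
lemma exists_integral_pderiv_le (c : BoundaryChart D) (hD : IsC2Domain D) {K : Set (Eu d)}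
    (hK : IsCompact K) (hKb : K ⊆ c.base) : ∃ C : ℝ, 0 ≤ C ∧ ∀ g ∈ C1c d, tsupport g ⊆ K →
      ∀ i, ‖∫ x in D, pderiv i g x‖ₑ ≤ ENNReal.ofReal C * ∫⁻ x, ‖g x‖ₑ ∂(surf D) := by
  obtain ⟨M, hM0, hM⟩ := exists_deriv_smoothTransition_le
  obtain ⟨B, hB⟩ := hK.exists_bound_of_continuousOn
    (c.contDiff_height.continuous_fderiv (by simp)).continuousOn
  refine ⟨M * |B| * 3, by positivity, fun g hg hgK i => ?_⟩
  have hmg : Measurable fun x => ‖g x‖ₑ := hg.1.continuous.measurable.enorm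
  have hgb : tsupport g ⊆ c.base := hgK.trans hKb
  have hz : ∀ x, x ∉ tsupport g → g x = 0 := fun x hx => image_eq_zero_of_notMem_tsupport hx
  have hz' : ∀ x, x ∉ tsupport g → pderiv i g x = 0 := fun x hx =>
    image_eq_zero_of_notMem_tsupport fun h => hx (tsupport_pderiv_subset _ i h)
  have hp'i : Integrable (pderiv i g) :=
    (continuous_pderiv hg.1 i).integrable_of_hasCompactSupport
      (hg.2.fderiv_apply (𝕜 := ℝ) (EuclideanSpace.single i 1))
  set e : ℕ → ℝ := fun n => 1 / ((n : ℝ) + 1) with he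
  have he0 : ∀ n, 0 < e n := fun n => by positivity
  -- The integral of the cut off derivative is an integral over a thin layer.
  have hparts : ∀ n, ∫ x in D, (c.layer (e n) x : ℂ) * pderiv i g x
      = - ∫ x in D, (rderiv i (c.layer (e n)) x : ℂ) * g x := by
    intro n
    have hm := (mulC (c.layer (e n)) (c.contDiff_layer _) ⟨g, hg⟩).2
    have h1 := integral_mul_pderiv (f := fun _ => 1) contDiff_const hm
      (c.tsupport_layer_mul_subset (he0 n) hgb) i
    have h2 : ∀ x, pderiv i (fun _ : Eu d => (1 : ℂ)) x = 0 := fun x => by simp [pderiv]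
    simp only [h2, zero_mul, integral_zero, neg_zero, one_mul] at h1
    have h3 : ∀ x, pderiv i (mulC (c.layer (e n)) (c.contDiff_layer _) ⟨g, hg⟩ : Eu d → ℂ) x = _ :=
      fun x => pderiv_ofReal_mul (c.contDiff_layer (e n)) hg.1 i x
    simp_rw [h3] at h1
    rw [integral_add] at h1
    · exact eq_neg_of_add_eq_zero_right h1
    · refine Integrable.integrableOn ?_
      exact ((Complex.continuous_ofReal.comp (continuous_rderiv (c.contDiff_layer _) i)).mul
        hg.1.continuous).integrable_of_hasCompactSupport hg.2.mul_left
    · refine Integrable.integrableOn ?_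
      exact ((Complex.continuous_ofReal.comp (c.contDiff_layer _).continuous).mul
        (continuous_pderiv hg.1 i)).integrable_of_hasCompactSupport
        (hg.2.fderiv_apply (𝕜 := ℝ) (EuclideanSpace.single i 1)).mul_left
  have hlim : Tendsto (fun n => ∫ x in D, (c.layer (e n) x : ℂ) * pderiv i g x) atTop
      (𝓝 (∫ x in D, pderiv i g x)) := by
    refine tendsto_integral_of_dominated_convergence (fun x => ‖pderiv i g x‖) (fun n => ?_)
      hp'i.norm.integrableOn (fun n => Eventually.of_forall fun x => ?_) ?_
    · exact ((Complex.continuous_ofReal.comp (c.contDiff_layer _).continuous).mul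
        (continuous_pderiv hg.1 i)).aestronglyMeasurable
    · rw [norm_mul, Complex.norm_real, Real.norm_eq_abs]
      exact mul_le_of_le_one_left (norm_nonneg _) (c.abs_layer_le _ x)
    · refine (ae_restrict_mem hD.isOpen.measurableSet).mono fun x hx => ?_
      refine tendsto_const_nhds.congr' ?_
      by_cases hgx : x ∈ tsupport g
      · filter_upwards [c.eventually_layer hx (hgb hgx)] with n hn
        rw [show c.layer (e n) x = 1 from hn.1, Complex.ofReal_one, one_mul]
      · exact Eventually.of_forall fun n => by simp [hz' x hgx]
  have hstep : ∀ δ : ℝ, 0 < δ → ∀ᶠ n in atTop,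
      ‖∫ x in D, (c.layer (e n) x : ℂ) * pderiv i g x‖ₑ ≤ ENNReal.ofReal (M * |B| * 3) *
        (∫⁻ x, ‖g x‖ₑ ∂(surf D) + ENNReal.ofReal δ * c.meas Set.univ) := by
    intro δ hδ
    obtain ⟨r, hr, hru⟩ := Metric.uniformContinuous_iff.1
      (hg.2.uniformContinuous_of_continuous hg.1.continuous) δ hδ
    filter_upwards [eventually_mul_lt 3 hr, eventually_mul_lt 3 c.width_pos] with n hn hn'
    change 3 * e n < r at hn
    change 3 * e n < c.width at hn'
    -- The derivative of the cutoff is at most `M |B| / e n`, and it vanishes outside a layer of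
    -- height `3 * e n`, so its product with `g` has bounded total mass.
    have hpt : ∀ x ∈ D, ‖(rderiv i (c.layer (e n)) x : ℂ) * g x‖ₑ ≤
        {x | x ∈ D ∩ c.base ∧ c.height x < 3 * e n}.indicator
          (fun x => ENNReal.ofReal (M * |B| / e n) * ‖g x‖ₑ) x := by
      intro x hx
      by_cases hgx : x ∈ tsupport g
      · by_cases hlt : c.height x < 3 * e n
        · rw [Set.indicator_of_mem (show x ∈ {x | x ∈ D ∩ c.base ∧ c.height x < 3 * e n} from
            ⟨⟨hx, hgb hgx⟩, hlt⟩), enorm_mul]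
          gcongr
          rw [← ofReal_norm, Complex.norm_real]
          exact ENNReal.ofReal_le_ofReal (c.abs_rderiv_layer_le (he0 n) hM i
            ((hB x (hgK hgx)).trans (le_abs_self B)))
        · rw [c.rderiv_layer_eq_zero (he0 n) i (Or.inr (by linarith [he0 n, not_lt.1 hlt]))]
          simp
      · rw [hz x hgx]; simp
    have hms : MeasurableSet {x | x ∈ D ∩ c.base ∧ c.height x < 3 * e n} :=
      (hD.isOpen.measurableSet.inter c.isOpen_base.measurableSet).inter
        (measurableSet_lt c.contDiff_height.continuous.measurable measurable_const)
    have hin : ∀ p, ∫⁻ t in Set.Ioo 0 (3 * e n), ‖g (p + t • c.dir)‖ₑ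
        ≤ ENNReal.ofReal (3 * e n) * (‖g p‖ₑ + ENNReal.ofReal δ) := by
      intro p
      calc _ ≤ ∫⁻ _ in Set.Ioo 0 (3 * e n), (‖g p‖ₑ + ENNReal.ofReal δ) := by
            refine setLIntegral_mono measurable_const fun t ht => ?_
            have h1 : dist (g (p + t • c.dir)) (g p) < δ := by
              refine hru ?_
              rw [dist_eq_norm, add_sub_cancel_left, norm_smul, c.norm_dir, mul_one,
                Real.norm_of_nonneg ht.1.le]
              exact ht.2.trans hn
            rw [dist_eq_norm] at h1
            rw [← ofReal_norm, ← ofReal_norm, ← ENNReal.ofReal_add (norm_nonneg _) hδ.le]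
            refine ENNReal.ofReal_le_ofReal ?_
            linarith [norm_le_norm_sub_add (g (p + t • c.dir)) (g p)]
        _ = _ := by
            rw [setLIntegral_const, Real.volume_Ioo, sub_zero, mul_comm]
    rw [hparts, enorm_neg]
    calc _ ≤ ∫⁻ x in D, ‖(rderiv i (c.layer (e n)) x : ℂ) * g x‖ₑ :=
          enorm_integral_le_lintegral_enorm _
      _ ≤ ∫⁻ x in D, {x | x ∈ D ∩ c.base ∧ c.height x < 3 * e n}.indicator
          (fun x => ENNReal.ofReal (M * |B| / e n) * ‖g x‖ₑ) x :=
          setLIntegral_mono' hD.isOpen.measurableSet hpt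
      _ ≤ ∫⁻ x, {x | x ∈ D ∩ c.base ∧ c.height x < 3 * e n}.indicator
          (fun x => ENNReal.ofReal (M * |B| / e n) * ‖g x‖ₑ) x := setLIntegral_le_lintegral _ _
      _ = ENNReal.ofReal (M * |B| / e n) *
          ∫⁻ x in {x | x ∈ D ∩ c.base ∧ c.height x < 3 * e n}, ‖g x‖ₑ := by
          rw [lintegral_indicator hms, lintegral_const_mul _ hmg]
      _ ≤ ENNReal.ofReal (M * |B| / e n) *
          ∫⁻ p, (∫⁻ t in Set.Ioo 0 (3 * e n), ‖g (p + t • c.dir)‖ₑ) ∂c.meas :=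
          mul_le_mul_right (c.le_layer _ hmg _ hn'.le) _
      _ ≤ ENNReal.ofReal (M * |B| / e n) *
          ∫⁻ p, ENNReal.ofReal (3 * e n) * (‖g p‖ₑ + ENNReal.ofReal δ) ∂c.meas :=
          mul_le_mul_right (lintegral_mono hin) _
      _ = ENNReal.ofReal (M * |B| * 3) *
          (∫⁻ p, ‖g p‖ₑ ∂c.meas + ENNReal.ofReal δ * c.meas Set.univ) := by
          rw [lintegral_const_mul _ (hmg.add_const _), lintegral_add_right _ measurable_const,
            lintegral_const, ← mul_assoc, ← ENNReal.ofReal_mul (by have := he0 n; positivity)]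
          congr 2
          have := (he0 n).ne'
          field_simp
      _ ≤ _ := mul_le_mul_right (add_le_add (lintegral_mono' c.meas_le le_rfl) le_rfl) _
  have hfin : IsFiniteMeasure c.meas := c.isFinite
  have hall : ∀ k : ℕ, ‖∫ x in D, pderiv i g x‖ₑ ≤ ENNReal.ofReal (M * |B| * 3) *
        (∫⁻ x, ‖g x‖ₑ ∂(surf D) + ENNReal.ofReal (e k) * c.meas Set.univ) := fun k =>
    le_of_tendsto hlim.enorm (hstep (e k) (he0 k))
  have h1 : Tendsto (fun k => ENNReal.ofReal (e k)) atTop (𝓝 (ENNReal.ofReal 0)) :=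
    (ENNReal.continuous_ofReal.tendsto 0).comp tendsto_one_div_add_atTop_nhds_zero_nat
  have h2 := (ENNReal.Tendsto.mul_const h1
    (Or.inr (measure_ne_top c.meas Set.univ))).const_add (∫⁻ x, ‖g x‖ₑ ∂(surf D))
  have h3 := ENNReal.Tendsto.const_mul h2
    (Or.inr (ENNReal.ofReal_ne_top (r := M * |B| * 3)))
  rw [ENNReal.ofReal_zero, zero_mul, add_zero] at h3
  exact ge_of_tendsto' h3 hall

end BoundaryChart

end

/-! ### The barrier -/

section

variable {d : ℕ} {D : Set (Eu d)}

namespace BoundaryAtlas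

/-- The part of a function that is supported in a chart. -/
noncomputable def piece (A : BoundaryAtlas D) (k : A.ι) (f : C1c d) : C1c d :=
  mulC (A.cutoff k) ((A.contDiff_cutoff k).of_le (by simp)) f

/-- The part of a function that is supported in the interior. -/
noncomputable def innerPiece (A : BoundaryAtlas D) (f : C1c d) : C1c d :=
  mulC A.inner (A.contDiff_inner.of_le (by simp)) f

lemma tsupport_piece_subset (A : BoundaryAtlas D) (k : A.ι) (f : C1c d) :
    tsupport (A.piece k f : Eu d → ℂ) ⊆ tsupport (A.cutoff k) := by
  refine closure_mono fun x hx => ?_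
  have hx' : (A.cutoff k x : ℂ) * (f : Eu d → ℂ) x ≠ 0 := hx
  exact Complex.ofReal_ne_zero.1 (left_ne_zero_of_mul hx')

lemma tsupport_innerPiece_subset (A : BoundaryAtlas D) (f : C1c d) :
    tsupport (A.innerPiece f : Eu d → ℂ) ⊆ D := by
  refine (closure_mono fun x hx => ?_).trans A.tsupport_inner
  have hx' : (A.inner x : ℂ) * (f : Eu d → ℂ) x ≠ 0 := hx
  exact Complex.ofReal_ne_zero.1 (left_ne_zero_of_mul hx')

lemma sum_pieces_apply (A : BoundaryAtlas D) (f : C1c d) {x : Eu d} (hx : x ∈ closure D) :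
    ((∑ k, A.piece k f + A.innerPiece f : C1c d) : Eu d → ℂ) x = (f : Eu d → ℂ) x := by
  have h1 : ((∑ k, A.piece k f + A.innerPiece f : C1c d) : Eu d → ℂ) x
      = ∑ k, (A.cutoff k x : ℂ) * (f : Eu d → ℂ) x + (A.inner x : ℂ) * (f : Eu d → ℂ) x := by
    rw [Submodule.coe_add, Submodule.coe_sum, Pi.add_apply, Finset.sum_apply]
    rfl
  rw [h1, ← Finset.sum_mul, ← add_mul]
  have h2 := congrArg ((↑) : ℝ → ℂ) (A.sum_eq_one x hx)
  push_cast at h2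
  rw [h2, one_mul]

lemma cutoff_le_one (A : BoundaryAtlas D) (k : A.ι) {x : Eu d} (hx : x ∈ closure D) :
    A.cutoff k x ≤ 1 := by
  have h1 := A.sum_eq_one x hx
  have h2 := Finset.single_le_sum (f := fun k => A.cutoff k x) (fun k _ => A.cutoff_nonneg k x)
    (Finset.mem_univ k)
  have h3 := A.inner_nonneg x
  linarith

end BoundaryAtlas

/-- A `C¹` function that vanishes on the boundary lies in the closure of the test functions with
support in the interior. -/
lemma toEnergy_mem_of_eq_zero [IsFiniteMeasure (surf D)] (hD : IsC2Domain D) {f : C1c d}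
    (hf : ∀ x ∈ frontier D, (f : Eu d → ℂ) x = 0) :
    toEnergy D f ∈ energySpace D (interiorTests D) := by
  obtain ⟨A⟩ := exists_boundaryAtlas hD
  rw [← toEnergy_congr hD.isOpen fun x hx => A.sum_pieces_apply f hx, map_add, map_sum]
  refine Submodule.add_mem _ (Submodule.sum_mem _ fun k _ => ?_)
    (toEnergy_mem_of_tsupport_subset hD (A.tsupport_innerPiece_subset f))
  refine (A.chart k).toEnergy_mem hD ((A.tsupport_piece_subset k f).trans (A.tsupport_cutoff k))
    fun x hx => ?_
  change (A.cutoff k x : ℂ) * (f : Eu d → ℂ) x = 0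
  rw [hf x hx, mul_zero]

/-- The integral of a derivative over `D` is bounded by the boundary values. -/
lemma exists_integral_pderiv_le (hD : IsC2Domain D) : ∃ C : ℝ, 0 ≤ C ∧ ∀ f ∈ C1c d, ∀ i,
    ‖∫ x in D, pderiv i f x‖ₑ ≤ ENNReal.ofReal C * ∫⁻ x, ‖f x‖ₑ ∂(surf D) := by
  obtain ⟨A⟩ := exists_boundaryAtlas hD
  choose C hC0 hC using fun k => (A.chart k).exists_integral_pderiv_le hD
    (show IsCompact (tsupport (A.cutoff k)) from A.compact_cutoff k) (A.tsupport_cutoff k)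
  refine ⟨∑ k, C k, Finset.sum_nonneg fun k _ => hC0 k, fun f hf i => ?_⟩
  have hint : ∀ f : C1c d, Integrable (pderiv i (f : Eu d → ℂ)) (vol D) := fun f =>
    ((continuous_pderiv f.2.1 i).integrable_of_hasCompactSupport
      (f.2.2.fderiv_apply (𝕜 := ℝ) (EuclideanSpace.single i 1))).integrableOn
  let I : C1c d →ₗ[ℂ] ℂ :=
    { toFun f := ∫ x in D, pderiv i (f : Eu d → ℂ) x
      map_add' f g := by
        have h1 : pderiv i ((f + g : C1c d) : Eu d → ℂ) = _ := pderiv_add f.2.1 g.2.1 i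
        rw [h1]
        exact integral_add (hint f) (hint g)
      map_smul' c f := by
        have h1 : pderiv i ((c • f : C1c d) : Eu d → ℂ) = _ := pderiv_smul f.2.1 c i
        rw [h1]
        exact integral_const_mul c _ }
  set f' : C1c d := ⟨f, hf⟩ with hf'
  have h1 : I f' = I (∑ k, A.piece k f' + A.innerPiece f') := by
    refine setIntegral_congr_fun hD.isOpen.measurableSet fun x hx => ?_
    have h2 : (f' : Eu d → ℂ) =ᶠ[𝓝 x] (∑ k, A.piece k f' + A.innerPiece f' : C1c d) :=
      mem_of_superset (hD.isOpen.mem_nhds hx) fun y hy =>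
        (A.sum_pieces_apply f' (subset_closure hy)).symm
    simp only [pderiv, h2.fderiv_eq]
  have h3 : I (A.innerPiece f') = 0 := by
    have h4 := integral_mul_pderiv (f := fun _ => 1) contDiff_const (A.innerPiece f').2
      (A.tsupport_innerPiece_subset f') i
    have h5 : ∀ x, pderiv i (fun _ : Eu d => (1 : ℂ)) x = 0 := fun x => by simp [pderiv]
    simp only [h5, zero_mul, integral_zero, neg_zero, one_mul] at h4
    exact h4
  have h6 : ∫ x in D, pderiv i f x = ∑ k, I (A.piece k f') := by
    rw [map_add, map_sum, h3, add_zero] at h1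
    exact h1
  rw [h6, ENNReal.ofReal_sum_of_nonneg fun k _ => hC0 k, Finset.sum_mul]
  refine (enorm_sum_le _ _).trans (Finset.sum_le_sum fun k _ => ?_)
  refine (hC k _ (A.piece k f').2 (A.tsupport_piece_subset k f') i).trans ?_
  refine mul_le_mul_right (lintegral_mono_ae ?_) _
  filter_upwards [ae_surf_mem_frontier D] with x hx
  change ‖(A.cutoff k x : ℂ) * f x‖ₑ ≤ _
  rw [enorm_mul]
  refine mul_le_of_le_one_left zero_le ?_
  rw [← ofReal_norm, Complex.norm_real, Real.norm_of_nonneg (A.cutoff_nonneg k x)]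
  exact ENNReal.ofReal_le_one.2 (A.cutoff_le_one k (frontier_subset_closure hx))

section Barrier

lemma contDiff_rderiv {a : Eu d → ℝ} (ha : ContDiff ℝ 2 a) (i : Fin d) :
    ContDiff ℝ 1 (rderiv i a) :=
  (ha.fderiv_right (m := 1) (by norm_num)).clm_apply contDiff_const

lemma rderiv_add {a b : Eu d → ℝ} (ha : ContDiff ℝ 1 a) (hb : ContDiff ℝ 1 b) (i : Fin d) :
    rderiv i (fun x => a x + b x) = fun x => rderiv i a x + rderiv i b x := by
  funext x
  rw [rderiv, fderiv_fun_add (ha.differentiable (by simp) x) (hb.differentiable (by simp) x)]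
  rfl

lemma rderiv_sum {ι : Type*} [Fintype ι] {a : ι → Eu d → ℝ} (ha : ∀ k, ContDiff ℝ 1 (a k))
    (i : Fin d) : rderiv i (fun x => ∑ k, a k x) = fun x => ∑ k, rderiv i (a k) x := by
  funext x
  rw [rderiv, fderiv_fun_sum fun k _ => (ha k).differentiable (by simp) x, sum_apply]
  rfl

lemma rderiv_mul {a b : Eu d → ℝ} (ha : ContDiff ℝ 1 a) (hb : ContDiff ℝ 1 b) (i : Fin d) :
    rderiv i (fun x => a x * b x) = fun x => rderiv i a x * b x + a x * rderiv i b x := by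
  funext x
  rw [rderiv, fderiv_fun_mul (ha.differentiable (by simp) x) (hb.differentiable (by simp) x)]
  simp only [add_apply, smul_apply, smul_eq_mul, rderiv]
  ring

lemma rderiv_const_mul {a : Eu d → ℝ} (ha : ContDiff ℝ 1 a) (c : ℝ) (i : Fin d) :
    rderiv i (fun x => c * a x) = fun x => c * rderiv i a x := by
  funext x
  rw [rderiv, fderiv_const_mul (ha.differentiable (by simp) x)]
  simp [rderiv]

lemma rderiv_const_sub (a : Eu d → ℝ) (c : ℝ) (i : Fin d) :
    rderiv i (fun x => c - a x) = fun x => - rderiv i a x := by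
  funext x
  rw [rderiv, fderiv_const_sub]
  simp [rderiv]

lemma rderiv_exp {a : Eu d → ℝ} (ha : ContDiff ℝ 1 a) (i : Fin d) :
    rderiv i (fun x => Real.exp (a x)) = fun x => Real.exp (a x) * rderiv i a x := by
  funext x
  rw [rderiv, fderiv_exp (ha.differentiable (by simp) x)]
  simp [rderiv]

lemma rderiv_eq_zero {a : Eu d → ℝ} {x : Eu d} (hx : x ∉ tsupport a) (i : Fin d) :
    rderiv i a x = 0 :=
  image_eq_zero_of_notMem_tsupport fun h => hx (tsupport_fderiv_apply_subset ℝ _ h)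

lemma rderiv_rderiv_eq_zero {a : Eu d → ℝ} {x : Eu d} (hx : x ∉ tsupport a) (i : Fin d) :
    rderiv i (rderiv i a) x = 0 :=
  rderiv_eq_zero (fun h => hx (tsupport_fderiv_apply_subset ℝ _ h)) i

/-- The second derivatives of `χ (1 - exp (-Kθ))`, at a zero of `θ`. -/
lemma rderiv_rderiv_mul_one_sub_exp {χ θ : Eu d → ℝ} (hχ : ContDiff ℝ 2 χ) (hθ : ContDiff ℝ 2 θ)
    (K : ℝ) (i : Fin d) {x : Eu d} (hx : θ x = 0) :
    rderiv i (rderiv i (fun x => χ x * (1 - Real.exp (-K * θ x)))) x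
      = K * (2 * (rderiv i χ x * rderiv i θ x) + χ x * rderiv i (rderiv i θ) x)
        - K ^ 2 * (χ x * rderiv i θ x ^ 2) := by
  have hχ1 : ContDiff ℝ 1 χ := hχ.of_le (by norm_num)
  have hθ1 : ContDiff ℝ 1 θ := hθ.of_le (by norm_num)
  have hKθ : ContDiff ℝ 1 fun x => -K * θ x := contDiff_const.mul hθ1
  have hE : ContDiff ℝ 1 fun x => Real.exp (-K * θ x) := hKθ.exp
  have hEd : rderiv i (fun x => 1 - Real.exp (-K * θ x))
      = fun x => K * (Real.exp (-K * θ x) * rderiv i θ x) := by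
    rw [rderiv_const_sub, rderiv_exp hKθ, rderiv_const_mul hθ1]
    funext x
    ring
  have h1E : ContDiff ℝ 1 fun x => 1 - Real.exp (-K * θ x) := contDiff_const.sub hE
  rw [rderiv_mul hχ1 h1E, hEd,
    rderiv_add ((contDiff_rderiv hχ i).mul h1E)
      (hχ1.mul (contDiff_const.mul (hE.mul (contDiff_rderiv hθ i)))),
    rderiv_mul (contDiff_rderiv hχ i) h1E, hEd,
    rderiv_mul hχ1 (contDiff_const.mul (hE.mul (contDiff_rderiv hθ i))),
    rderiv_const_mul (hE.mul (contDiff_rderiv hθ i)), rderiv_mul hE (contDiff_rderiv hθ i),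
    rderiv_exp hKθ, rderiv_const_mul hθ1]
  simp only [hx, mul_zero, Real.exp_zero]
  ring

lemma BoundaryChart.one_le_sum_rderiv_sq (c : BoundaryChart D) (x : Eu d) :
    1 ≤ ∑ i, rderiv i c.height x ^ 2 := by
  have h1 : fderiv ℝ c.height x c.dir = 1 := by
    have h2 : HasDerivAt (fun t : ℝ => c.height (x + t • c.dir)) (fderiv ℝ c.height x c.dir) 0 := by
      have h3 : HasDerivAt (fun t : ℝ => x + t • c.dir) c.dir 0 := by
        simpa using ((hasDerivAt_id (0 : ℝ)).smul_const c.dir).const_add x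
      have h4 := (c.contDiff_height.differentiable (by simp) (x + (0 : ℝ) • c.dir)).hasFDerivAt
      have h5 : HasDerivAt (fun t : ℝ => c.height (x + t • c.dir)) _ 0 := h4.comp_hasDerivAt 0 h3
      rwa [zero_smul, add_zero] at h5
    have h6 : HasDerivAt (fun t : ℝ => c.height (x + t • c.dir)) 1 0 := by
      simp_rw [c.height_add]
      exact (hasDerivAt_id (0 : ℝ)).const_add _
    exact h2.unique h6
  have h7 : fderiv ℝ c.height x c.dir = ∑ i, c.dir i * rderiv i c.height x := by
    conv_lhs => rw [← (EuclideanSpace.basisFun (Fin d) ℝ).sum_repr c.dir]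
    simp [rderiv, map_sum]
  have h8 := Finset.sum_mul_sq_le_sq_mul_sq Finset.univ (fun i => c.dir i)
    (fun i => rderiv i c.height x)
  rw [← h7, h1] at h8
  have h9 : ∑ i, c.dir i ^ 2 = 1 := by
    have := EuclideanSpace.real_norm_sq_eq c.dir
    rw [c.norm_dir] at this
    linarith
  rw [h9] at h8
  linarith

/-- A barrier: a function that vanishes on the boundary, is nonnegative in `D`, and is a strict
supersolution of `-Δ + 2ℓ`. Near the boundary this comes from the concave function
`1 - exp (-Kθ)` of the heights `θ` of the charts, for a large `K`. -/
lemma exists_barrier (hD : IsC2Domain D) : ∃ b : Eu d → ℝ, ContDiff ℝ 2 b ∧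
    (∀ x ∈ frontier D, b x = 0) ∧ (∀ x ∈ D, 0 ≤ b x) ∧ ∃ ℓ : ℝ, 0 < ℓ ∧
      ∀ x ∈ D, 1 ≤ 2 * ℓ * b x - ∑ i, rderiv i (rderiv i b) x := by
  obtain ⟨A⟩ := exists_boundaryAtlas hD
  have h2 : (2 : WithTop ℕ∞) ≤ ((⊤ : ℕ∞) : WithTop ℕ∞) := by
    exact WithTop.coe_le_coe.2 (le_top : (2 : ℕ∞) ≤ ⊤)
  have hχ : ∀ k, ContDiff ℝ 2 (A.cutoff k) := fun k => (A.contDiff_cutoff k).of_le h2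
  have hχ0 : ContDiff ℝ 2 A.inner := A.contDiff_inner.of_le h2
  have hθ : ∀ k, ContDiff ℝ 2 (A.chart k).height := fun k => (A.chart k).contDiff_height
  have hfc : IsCompact (frontier D) :=
    hD.isCompact_closure.of_isClosed_subset isClosed_frontier frontier_subset_closure
  -- On the boundary the Laplacian of the barrier is `K P - K² Q`, with `Q ≥ 1`.
  let P : Eu d → ℝ := fun x => ∑ k, ∑ i, (2 * (rderiv i (A.cutoff k) x *
    rderiv i (A.chart k).height x) + A.cutoff k x * rderiv i (rderiv i (A.chart k).height) x)
  have hPc : Continuous P := by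
    refine continuous_finsetSum _ fun k _ => continuous_finsetSum _ fun i _ => ?_
    have h1 := (contDiff_rderiv (hχ k) i).continuous
    have h2 := (contDiff_rderiv (hθ k) i).continuous
    have h3 := continuous_rderiv (contDiff_rderiv (hθ k) i) i
    have h4 := (hχ k).continuous
    fun_prop
  obtain ⟨C, hC⟩ := hfc.exists_bound_of_continuousOn hPc.continuousOn
  set K : ℝ := |C| + 2 with hK
  have hK0 : 0 < K := by positivity
  let bk : A.ι → Eu d → ℝ := fun k x => A.cutoff k x * (1 - Real.exp (-K * (A.chart k).height x))
  have hbk : ∀ k, ContDiff ℝ 2 (bk k) := fun k =>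
    (hχ k).mul (contDiff_const.sub (contDiff_const.mul (hθ k)).exp)
  let b : Eu d → ℝ := fun x => ∑ k, bk k x + A.inner x
  have hb : ContDiff ℝ 2 b := (ContDiff.sum fun k _ => hbk k).add hχ0
  have h12 : (1 : WithTop ℕ∞) ≤ 2 := by norm_num
  have hsupp : ∀ k, tsupport (bk k) ⊆ tsupport (A.cutoff k) := fun k =>
    closure_mono fun x hx => left_ne_zero_of_mul hx
  have hheight : ∀ k, ∀ x ∈ frontier D, x ∈ tsupport (A.cutoff k) → (A.chart k).height x = 0 :=
    fun k x hx h => (A.chart k).height_eq_zero x (A.tsupport_cutoff k h) hx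
  have hinner : ∀ x ∈ frontier D, x ∉ tsupport A.inner := fun x hx h => by
    rw [hD.isOpen.frontier_eq] at hx
    exact hx.2 (A.tsupport_inner h)
  have hb0 : ∀ x ∈ frontier D, b x = 0 := by
    intro x hx
    have h1 : ∀ k, bk k x = 0 := fun k => by
      by_cases h : x ∈ tsupport (A.cutoff k)
      · simp [bk, hheight k x hx h]
      · exact image_eq_zero_of_notMem_tsupport fun h' => h (hsupp k h')
    simp [b, h1, image_eq_zero_of_notMem_tsupport (hinner x hx)]
  have hbkn : ∀ k, ∀ x ∈ D, 0 ≤ bk k x ∧ (bk k x = 0 → A.cutoff k x = 0) := by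
    intro k x hx
    by_cases h : A.cutoff k x = 0
    · simp [bk, h]
    · have h1 : 0 < (A.chart k).height x :=
        (A.chart k).height_pos hx (A.tsupport_cutoff k (subset_tsupport _ h))
      have h2 : 0 < 1 - Real.exp (-K * (A.chart k).height x) := by
        rw [sub_pos, Real.exp_lt_one_iff]
        nlinarith
      have h3 : 0 < bk k x := mul_pos ((A.cutoff_nonneg k x).lt_of_ne' h) h2
      exact ⟨h3.le, fun h4 => absurd h4 h3.ne'⟩
  have hbpos : ∀ x ∈ D, 0 < b x := by
    intro x hx
    have h0 : 0 ≤ ∑ k, bk k x := Finset.sum_nonneg fun k _ => (hbkn k x hx).1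
    refine lt_of_le_of_ne (add_nonneg h0 (A.inner_nonneg x)) fun h => ?_
    have h1 : ∑ k, bk k x = 0 := by
      have : b x = ∑ k, bk k x + A.inner x := rfl
      linarith [A.inner_nonneg x]
    have h2 : A.inner x = 0 := by
      have : b x = ∑ k, bk k x + A.inner x := rfl
      linarith
    have h3 := (Finset.sum_eq_zero_iff_of_nonneg fun k _ => (hbkn k x hx).1).1 h1
    have h4 := A.sum_eq_one x (subset_closure hx)
    rw [h2, Finset.sum_eq_zero fun k _ => (hbkn k x hx).2 (h3 k (Finset.mem_univ k))] at h4
    norm_num at h4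
  let Δ : Eu d → ℝ := fun x => ∑ i, rderiv i (rderiv i b) x
  have hΔc : Continuous Δ := continuous_finsetSum _ fun i _ =>
    continuous_rderiv (contDiff_rderiv hb i) i
  have hΔ : ∀ x, Δ x = ∑ k, (∑ i, rderiv i (rderiv i (bk k)) x)
      + ∑ i, rderiv i (rderiv i A.inner) x := by
    intro x
    simp only [Δ]
    rw [Finset.sum_comm, ← Finset.sum_add_distrib]
    refine Finset.sum_congr rfl fun i _ => ?_
    have h1 : rderiv i b = fun x => (∑ k, rderiv i (bk k) x) + rderiv i A.inner x := by
      have h2 := rderiv_add (ContDiff.sum (s := Finset.univ) fun k _ => (hbk k).of_le h12)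
        (hχ0.of_le h12) i
      rw [rderiv_sum fun k => (hbk k).of_le h12] at h2
      exact h2
    rw [h1, rderiv_add (ContDiff.sum fun k _ => contDiff_rderiv (hbk k) i) (contDiff_rderiv hχ0 i),
      rderiv_sum fun k => contDiff_rderiv (hbk k) i]
  have hfr : ∀ x ∈ frontier D, 1 < - Δ x := by
    intro x hx
    have h1 : ∀ k, ∀ i, rderiv i (rderiv i (bk k)) x = K * (2 * (rderiv i (A.cutoff k) x *
        rderiv i (A.chart k).height x) + A.cutoff k x * rderiv i (rderiv i (A.chart k).height) x)
        - K ^ 2 * (A.cutoff k x * rderiv i (A.chart k).height x ^ 2) := by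
      intro k i
      by_cases h : x ∈ tsupport (A.cutoff k)
      · exact rderiv_rderiv_mul_one_sub_exp (hχ k) (hθ k) K i (hheight k x hx h)
      · rw [rderiv_rderiv_eq_zero (fun h' => h (hsupp k h')), rderiv_eq_zero h,
          image_eq_zero_of_notMem_tsupport h]
        ring
    have h2 : Δ x = K * P x - K ^ 2 * ∑ k, A.cutoff k x * ∑ i, rderiv i (A.chart k).height x ^ 2 := by
      rw [hΔ, Finset.sum_eq_zero fun i _ => rderiv_rderiv_eq_zero (hinner x hx) i, add_zero]
      simp only [P, h1, Finset.mul_sum, Finset.sum_sub_distrib]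
    have h3 : 1 ≤ ∑ k, A.cutoff k x * ∑ i, rderiv i (A.chart k).height x ^ 2 := by
      have h4 := A.sum_eq_one x (frontier_subset_closure hx)
      rw [image_eq_zero_of_notMem_tsupport (hinner x hx), add_zero] at h4
      rw [← h4]
      exact Finset.sum_le_sum fun k _ => le_mul_of_one_le_right (A.cutoff_nonneg k x)
        ((A.chart k).one_le_sum_rderiv_sq x)
    have h5 : P x ≤ |C| := ((le_abs_self _).trans (hC x hx)).trans (le_abs_self C)
    have h6 := abs_nonneg C
    rw [h2]
    have h7 : K * P x ≤ K * |C| := mul_le_mul_of_nonneg_left h5 hK0.le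
    have h8 : K ^ 2 * 1 ≤ K ^ 2 * _ := mul_le_mul_of_nonneg_left h3 (sq_nonneg K)
    nlinarith
  -- Where the Laplacian does not help, `b` is bounded below.
  have hN : IsCompact (closure D ∩ {x | - Δ x ≤ 1}) :=
    hD.isCompact_closure.inter_right (isClosed_le hΔc.neg continuous_const)
  obtain ⟨m, hm0, hm⟩ := hN.exists_forall_le' hb.continuous.continuousOn (a := 0) (by
    rintro x ⟨hx, hx'⟩
    refine hbpos x ?_
    by_contra hxD
    have : x ∈ frontier D := by rw [hD.isOpen.frontier_eq]; exact ⟨hx, hxD⟩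
    exact absurd hx' (not_le.2 (hfr x this)))
  obtain ⟨T, hT⟩ := hD.isCompact_closure.exists_bound_of_continuousOn hΔc.continuousOn
  refine ⟨b, hb, hb0, fun x hx => (hbpos x hx).le, (|T| + 1) / (2 * m), by positivity,
    fun x hx => ?_⟩
  change 1 ≤ 2 * ((|T| + 1) / (2 * m)) * b x - Δ x
  have hxb := hbpos x hx
  have e1 : 2 * ((|T| + 1) / (2 * m)) = (|T| + 1) / m := by field_simp
  rw [e1]
  by_cases h : - Δ x ≤ 1
  · have h1 := hm x ⟨subset_closure hx, h⟩
    have h2 : Δ x ≤ |T| := ((le_abs_self _).trans (hT x (subset_closure hx))).trans (le_abs_self T)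
    have h3 : |T| + 1 ≤ (|T| + 1) / m * b x := by
      rw [div_mul_eq_mul_div, le_div_iff₀ hm0]
      gcongr
    linarith
  · have h3 : 0 ≤ (|T| + 1) / m * b x := by positivity
    linarith [not_le.1 h]

end Barrier

end

/-! ### The normal derivative of a Dirichlet solution -/

section

variable {d : ℕ} {D : Set (Eu d)}

/-- Multiplication by a bounded function. -/
noncomputable def mulL {v : Eu d → ℂ} (hv : MemLp v ⊤ (vol D)) : DomL2 D →L[ℂ] DomL2 D :=
  (ContinuousLinearMap.mul ℂ ℂ).holderL (vol D) ⊤ 2 2 (hv.toLp v)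

lemma coeFn_mulL {v : Eu d → ℂ} (hv : MemLp v ⊤ (vol D)) (u : DomL2 D) :
    (mulL hv u : Eu d → ℂ) =ᵐ[vol D] fun x => v x * u x := by
  have h1 : (mulL hv u : Eu d → ℂ) =ᵐ[vol D] _ :=
    (ContinuousLinearMap.mul ℂ ℂ).coeFn_holder (r := 2) (hv.toLp v) u
  filter_upwards [h1, hv.coeFn_toLp] with x hx hx'
  rw [hx, hx']
  rfl

lemma memLp_top_of_continuous (hD : IsC2Domain D) {a : Eu d → ℝ} (ha : Continuous a) :
    MemLp (fun x => (a x : ℂ)) ⊤ (vol D) := by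
  obtain ⟨C, hC⟩ := hD.isCompact_closure.exists_bound_of_continuousOn ha.continuousOn
  refine memLp_top_of_bound (Complex.continuous_ofReal.comp ha).aestronglyMeasurable C ?_
  filter_upwards [ae_restrict_mem hD.isOpen.measurableSet] with x hx
  rw [Complex.norm_real]
  exact hC x (subset_closure hx)

lemma mulL_toLp (hD : IsC2Domain D) {a : Eu d → ℝ} (ha : Continuous a) {f : Eu d → ℂ}
    (hf : MemLp f 2 (vol D)) {g : Eu d → ℂ} (hg : MemLp g 2 (vol D)) (h : ∀ x, g x = a x * f x) :
    mulL (memLp_top_of_continuous hD ha) (hf.toLp f) = hg.toLp g := by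
  refine Lp.ext ?_
  filter_upwards [coeFn_mulL (memLp_top_of_continuous hD ha) (hf.toLp f), hf.coeFn_toLp,
    hg.coeFn_toLp] with x h1 h2 h3
  rw [h1, h2, h3, h]

lemma inner_toLp {μ : Measure (Eu d)} {p q : Eu d → ℂ} (hp : MemLp p 2 μ) (hq : MemLp q 2 μ) :
    inner ℂ (hp.toLp p) (hq.toLp q) = ∫ x, conj (p x) * q x ∂μ := by
  rw [L2.inner_def]
  refine integral_congr_ae ?_
  filter_upwards [hp.coeFn_toLp, hq.coeFn_toLp] with x hx hx'
  rw [RCLike.inner_apply, hx, hx', mul_comm]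

/-- The product of a point of the energy space with a real `C²` function that vanishes on the
boundary. -/
noncomputable def mulEnergy (hD : IsC2Domain D) {b : Eu d → ℝ} (hb : ContDiff ℝ 2 b)
    (U : Energy D) : Energy D :=
  Energy.mk (mulL (memLp_top_of_continuous hD hb.continuous) U.val) 0
    (fun i => mulL (memLp_top_of_continuous hD (contDiff_rderiv hb i).continuous) U.val
      + mulL (memLp_top_of_continuous hD hb.continuous) (U.gr i))

lemma continuous_mulEnergy (hD : IsC2Domain D) {b : Eu d → ℝ} (hb : ContDiff ℝ 2 b) :
    Continuous (mulEnergy hD hb) := by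
  refine continuous_iff_seqContinuous.2 fun F U h => ?_
  obtain ⟨h1, -, h3⟩ := Energy.tendsto_iff.1 h
  refine Energy.tendsto_iff.2 ⟨?_, tendsto_const_nhds, fun i => ?_⟩
  · exact ((mulL (memLp_top_of_continuous hD hb.continuous)).continuous.tendsto _).comp h1
  · exact (((mulL (memLp_top_of_continuous hD
      (contDiff_rderiv hb i).continuous)).continuous.tendsto _).comp h1).add
      (((mulL (memLp_top_of_continuous hD hb.continuous)).continuous.tendsto _).comp (h3 i))

/-- The square of the absolute value, as a complex function. -/
noncomputable def normSqC (f : C1c d) : C1c d :=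
  ⟨fun x => conj ((f : Eu d → ℂ) x) * (f : Eu d → ℂ) x, (conjC f).2.1.mul f.2.1, f.2.2.mul_left⟩

lemma pderiv_normSqC (f : C1c d) (i : Fin d) (x : Eu d) :
    pderiv i (normSqC f : Eu d → ℂ) x = conj (pderiv i (f : Eu d → ℂ) x) * (f : Eu d → ℂ) x
      + conj ((f : Eu d → ℂ) x) * pderiv i (f : Eu d → ℂ) x := by
  have h1 := ((conjC f).2.1.differentiable (by simp) x).hasFDerivAt
  have h2 := (f.2.1.differentiable (by simp) x).hasFDerivAt
  have h3 : HasFDerivAt (normSqC f : Eu d → ℂ) _ x := h1.mul h2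
  rw [← pderiv_conj f.2.1, pderiv, h3.fderiv]
  simp only [add_apply, smul_apply, smul_eq_mul, pderiv, conjC]
  ring

lemma integrable_conj_mul {p q : Eu d → ℂ} (hp : MemLp p 2 (vol D)) (hq : MemLp q 2 (vol D)) :
    Integrable (fun x => conj (p x) * q x) (vol D) :=
  (memLp_conj hp).integrable_mul hq

/-- The real part of the integrand that the barrier produces. -/
lemma re_barrier_identity {n : ℕ} (b ℓ : ℝ) (b' b'' : Fin n → ℝ) (f : ℂ) (f' : Fin n → ℂ) :
    (2 * (∑ i, conj ((b' i : ℂ) * f + b * f' i) * f' i + ℓ * (conj ((b : ℂ) * f) * f))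
      - ∑ i, ((b'' i : ℂ) * (conj f * f)
        + (b' i : ℂ) * (conj (f' i) * f + conj f * f' i))).re
      = 2 * b * (∑ i, ‖f' i‖ ^ 2) + (2 * ℓ * b - ∑ i, b'' i) * ‖f‖ ^ 2 := by
  have h1 : ∀ i, (2 * (conj ((b' i : ℂ) * f + b * f' i) * f' i) - ((b'' i : ℂ) * (conj f * f)
        + (b' i : ℂ) * (conj (f' i) * f + conj f * f' i))).re
      = 2 * b * ‖f' i‖ ^ 2 - b'' i * ‖f‖ ^ 2 := by
    intro i
    rw [← Complex.normSq_eq_norm_sq, ← Complex.normSq_eq_norm_sq]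
    simp [Complex.normSq_apply]
    ring
  have h2 : (2 * ((ℓ : ℂ) * (conj ((b : ℂ) * f) * f))).re = 2 * ℓ * b * ‖f‖ ^ 2 := by
    rw [← Complex.normSq_eq_norm_sq]
    simp [Complex.normSq_apply]
    ring
  rw [mul_add, Finset.mul_sum, add_sub_right_comm, ← Finset.sum_sub_distrib, Complex.add_re,
    Complex.re_sum, Finset.sum_congr rfl fun i _ => h1 i, h2, Finset.sum_sub_distrib,
    ← Finset.mul_sum, ← Finset.sum_mul]
  ring

section
variable [IsFiniteMeasure (surf D)]

lemma mulEnergy_toEnergy (hD : IsC2Domain D) {b : Eu d → ℝ} (hb : ContDiff ℝ 2 b)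
    (hb0 : ∀ x ∈ frontier D, b x = 0) (f : C1c d) :
    mulEnergy hD hb (toEnergy D f)
      = toEnergy D (mulC b (hb.of_le (by norm_num)) f) := by
  have hb1 : ContDiff ℝ 1 b := hb.of_le (by norm_num)
  have hm := C1c.memLp (mulC b hb1 f).2 (vol D)
  refine Energy.ext' ?_ ?_ fun i => ?_
  · exact mulL_toLp hD hb.continuous (C1c.memLp f.2 (vol D)) hm fun x => rfl
  · refine ((Lp.eq_zero_iff_ae_eq_zero).2 ?_).symm
    have h1 : ((toEnergy D (mulC b hb1 f)).tr : Eu d → ℂ) =ᵐ[surf D] _ :=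
      (C1c.memLp (mulC b hb1 f).2 (surf D)).coeFn_toLp
    filter_upwards [h1, ae_surf_mem_frontier D] with x hx hx'
    rw [hx]
    change (b x : ℂ) * _ = 0
    rw [hb0 x hx', Complex.ofReal_zero, zero_mul]
  · have h1 := coeFn_mulL (memLp_top_of_continuous hD (contDiff_rderiv hb i).continuous)
      (toEnergy D f).val
    have h2 := coeFn_mulL (memLp_top_of_continuous hD hb.continuous) ((toEnergy D f).gr i)
    have h3 : ((toEnergy D f).val : Eu d → ℂ) =ᵐ[vol D] _ := (C1c.memLp f.2 (vol D)).coeFn_toLp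
    have h4 : ((toEnergy D f).gr i : Eu d → ℂ) =ᵐ[vol D] _ :=
      (C1c.memLp_pderiv f.2 i (vol D)).coeFn_toLp
    have h5 : ((toEnergy D (mulC b hb1 f)).gr i : Eu d → ℂ) =ᵐ[vol D] _ :=
      (C1c.memLp_pderiv (mulC b hb1 f).2 i (vol D)).coeFn_toLp
    refine Lp.ext ?_
    have h6 := Lp.coeFn_add (mulL (memLp_top_of_continuous hD (contDiff_rderiv hb i).continuous)
      (toEnergy D f).val) (mulL (memLp_top_of_continuous hD hb.continuous) ((toEnergy D f).gr i))
    filter_upwards [h1, h2, h3, h4, h5, h6] with x h1 h2 h3 h4 h5 h6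
    refine Eq.trans h6 ?_
    rw [Pi.add_apply, h1, h2, h3, h4, h5]
    exact (pderiv_ofReal_mul hb1 f.2.1 i x).symm

/-- Testing with the product of a function `f` and the barrier `b`. By
`2 Re (∇(b f̄) · ∇f) = 2 b |∇f|² + ∇b · ∇|f|²` and integration by parts, the supersolution property
bounds the norm of `f` in `D` by the form and the boundary values of `f`. -/
lemma norm_val_sq_le_form (hD : IsC2Domain D) {b : Eu d → ℝ} (hb : ContDiff ℝ 2 b)
    (hbn : ∀ x ∈ D, 0 ≤ b x) {ℓ : ℝ}
    (hℓ : ∀ x ∈ D, 1 ≤ 2 * ℓ * b x - ∑ i, rderiv i (rderiv i b) x) :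
    ∃ C : ℝ, 0 ≤ C ∧ ∀ f : C1c d, ‖(toEnergy D f).val‖ ^ 2 ≤
      2 * (form ((ℓ : ℂ) • 1) 0 (toEnergy D (mulC b (hb.of_le (by norm_num)) f))
        (toEnergy D f)).re + C * ‖(toEnergy D f).tr‖ ^ 2 := by
  have hb1 : ContDiff ℝ 1 b := hb.of_le (by norm_num)
  obtain ⟨C, hC0, hC⟩ := exists_integral_pderiv_le hD
  obtain ⟨B, hB⟩ := hD.isCompact_closure.exists_bound_of_continuousOn
    (hb.continuous_fderiv (by simp)).continuousOn
  refine ⟨∑ _i : Fin d, C * |B|, by positivity, fun f => ?_⟩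
  have hf := C1c.memLp f.2 (vol D)
  have hf' := fun i => C1c.memLp_pderiv f.2 i (vol D)
  have hm := C1c.memLp (mulC b hb1 f).2 (vol D)
  have hm' := fun i => C1c.memLp_pderiv (mulC b hb1 f).2 i (vol D)
  let G : Fin d → C1c d := fun i => mulC (rderiv i b) (contDiff_rderiv hb i) (normSqC f)
  have hG : ∀ i, Integrable (pderiv i (G i : Eu d → ℂ)) (vol D) := fun i =>
    ((continuous_pderiv (G i).2.1 i).integrable_of_hasCompactSupport
      ((G i).2.2.fderiv_apply (𝕜 := ℝ) (EuclideanSpace.single i 1))).integrableOn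
  -- The boundary terms.
  have hGle : ∀ i, ‖∫ x in D, pderiv i (G i : Eu d → ℂ) x‖ ≤ C * |B| * ‖(toEnergy D f).tr‖ ^ 2 := by
    intro i
    have h1 := hC (G i) (G i).2 i
    have h2 : ∫⁻ x, ‖(G i : Eu d → ℂ) x‖ₑ ∂(surf D)
        ≤ ENNReal.ofReal |B| * ENNReal.ofReal (‖(toEnergy D f).tr‖ ^ 2) := by
      rw [ofReal_norm_tr_sq, ← lintegral_const_mul _ (f.2.1.continuous.measurable.enorm.pow_const 2)]
      refine lintegral_mono_ae ?_
      filter_upwards [ae_surf_mem_frontier D] with x hx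
      change ‖(rderiv i b x : ℂ) * (conj ((f : Eu d → ℂ) x) * (f : Eu d → ℂ) x)‖ₑ ≤ _
      rw [enorm_mul, enorm_mul, RCLike.enorm_conj, ← sq, ← ofReal_norm, Complex.norm_real]
      gcongr
      exact (abs_rderiv_le i b x).trans ((hB x (frontier_subset_closure hx)).trans (le_abs_self B))
    have h3 := h1.trans (mul_le_mul_right h2 _)
    rw [← ofReal_norm, ← ENNReal.ofReal_mul (abs_nonneg B), ← ENNReal.ofReal_mul hC0,
      ENNReal.ofReal_le_ofReal_iff (by positivity)] at h3
    rw [mul_assoc]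
    exact h3
  have hform : form ((ℓ : ℂ) • 1) 0 (toEnergy D (mulC b hb1 f)) (toEnergy D f)
      = ∫ x in D, (∑ i, conj (pderiv i (mulC b hb1 f : Eu d → ℂ) x) * pderiv i (f : Eu d → ℂ) x
        + ℓ * (conj ((mulC b hb1 f : Eu d → ℂ) x) * (f : Eu d → ℂ) x)) := by
    rw [integral_add (integrable_finsetSum _ fun i _ => integrable_conj_mul (hm' i) (hf' i))
      ((integrable_conj_mul hm hf).const_mul _), integral_finsetSum _ fun i _ =>
      integrable_conj_mul (hm' i) (hf' i), integral_const_mul, ← inner_toLp hm hf,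
      Finset.sum_congr rfl fun i _ => (inner_toLp (hm' i) (hf' i)).symm, form, zero_mul, sub_zero,
      PiLp.inner_apply, smul_apply, one_apply_eq_self, inner_smul_right]
    rfl
  set F : Eu d → ℂ := fun x =>
    ∑ i, conj (pderiv i (mulC b hb1 f : Eu d → ℂ) x) * pderiv i (f : Eu d → ℂ) x
        + ℓ * (conj ((mulC b hb1 f : Eu d → ℂ) x) * (f : Eu d → ℂ) x) with hF
  have hFi : Integrable F (vol D) :=
    (integrable_finsetSum _ fun i _ => integrable_conj_mul (hm' i) (hf' i)).add
      ((integrable_conj_mul hm hf).const_mul _)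
  have hval : ‖(toEnergy D f).val‖ ^ 2 = ∫ x in D, ‖(f : Eu d → ℂ) x‖ ^ 2 := by
    have h1 : inner ℂ (toEnergy D f).val (toEnergy D f).val
        = ∫ x in D, conj ((f : Eu d → ℂ) x) * (f : Eu d → ℂ) x := inner_toLp hf hf
    rw [inner_self_eq_norm_sq_to_K] at h1
    simp_rw [Complex.conj_mul'] at h1
    have h2 : ∫ x in D, ((‖(f : Eu d → ℂ) x‖ : ℂ) ^ 2)
        = ((∫ x in D, ‖(f : Eu d → ℂ) x‖ ^ 2 : ℝ) : ℂ) := by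
      rw [← integral_complex_ofReal]
      simp
    rw [h2] at h1
    exact Complex.ofReal_injective (by push_cast; exact h1)
  have hmain : ∫ x in D, ‖(f : Eu d → ℂ) x‖ ^ 2 ≤
      ∫ x in D, (2 * F x - ∑ i, pderiv i (G i : Eu d → ℂ) x).re := by
    have hi : Integrable (fun x => 2 * F x - ∑ i, pderiv i (G i : Eu d → ℂ) x) (vol D) :=
      (hFi.const_mul 2).sub (integrable_finsetSum _ fun i _ => hG i)
    refine setIntegral_mono_on ((memLp_two_iff_integrable_sq_norm hf.1).1 hf) hi.re hD.isOpen.measurableSet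
      fun x hx => ?_
    have h1 : ∀ i, pderiv i (mulC b hb1 f : Eu d → ℂ) x = _ := fun i =>
      pderiv_ofReal_mul hb1 f.2.1 i x
    have h2 : ∀ i, pderiv i (G i : Eu d → ℂ) x = _ := fun i =>
      pderiv_ofReal_mul (contDiff_rderiv hb i) (normSqC f).2.1 i x
    have h3 : 2 * F x - ∑ i, pderiv i (G i : Eu d → ℂ) x =
        2 * (∑ i, conj ((rderiv i b x : ℂ) * (f : Eu d → ℂ) x + b x * pderiv i (f : Eu d → ℂ) x)
          * pderiv i (f : Eu d → ℂ) x
          + ℓ * (conj ((b x : ℂ) * (f : Eu d → ℂ) x) * (f : Eu d → ℂ) x))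
        - ∑ i, ((rderiv i (rderiv i b) x : ℂ) * (conj ((f : Eu d → ℂ) x) * (f : Eu d → ℂ) x)
          + (rderiv i b x : ℂ) * (conj (pderiv i (f : Eu d → ℂ) x) * (f : Eu d → ℂ) x
            + conj ((f : Eu d → ℂ) x) * pderiv i (f : Eu d → ℂ) x)) := by
      simp only [hF, h1, h2, pderiv_normSqC]
      rfl
    rw [h3]
    refine le_trans ?_ (re_barrier_identity (b x) ℓ (fun i => rderiv i b x)
      (fun i => rderiv i (rderiv i b) x) ((f : Eu d → ℂ) x)
      (fun i => pderiv i (f : Eu d → ℂ) x)).ge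
    have h4 : 0 ≤ 2 * b x * ∑ i, ‖pderiv i (f : Eu d → ℂ) x‖ ^ 2 := by
      have := hbn x hx
      positivity
    have h5 := mul_le_mul_of_nonneg_right (hℓ x hx) (sq_nonneg ‖(f : Eu d → ℂ) x‖)
    linarith
  have hre : ∫ x in D, (2 * F x - ∑ i, pderiv i (G i : Eu d → ℂ) x).re
      = 2 * (∫ x in D, F x).re - ∑ i, (∫ x in D, pderiv i (G i : Eu d → ℂ) x).re := by
    have hi : Integrable (fun x => 2 * F x - ∑ i, pderiv i (G i : Eu d → ℂ) x) (vol D) :=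
      (hFi.const_mul 2).sub (integrable_finsetSum _ fun i _ => hG i)
    have h1 := integral_re hi
    refine Eq.trans h1 ?_
    rw [integral_sub (hFi.const_mul 2) (integrable_finsetSum _ fun i _ => hG i),
      integral_const_mul, integral_finsetSum _ fun i _ => hG i]
    simp
  have hsum : - ∑ i, (∫ x in D, pderiv i (G i : Eu d → ℂ) x).re
      ≤ (∑ _i : Fin d, C * |B|) * ‖(toEnergy D f).tr‖ ^ 2 := by
    rw [← Finset.sum_neg_distrib, Finset.sum_mul]
    refine Finset.sum_le_sum fun i _ => ?_
    exact ((neg_le_abs _).trans (Complex.abs_re_le_norm _)).trans (hGle i)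
  rw [hval, hform]
  linarith [hmain, hre, hsum]

/-- A linear form that is bounded by a linear map into a Hilbert space is the inner product with
some vector. -/
lemma exists_eq_inner_of_le {X B : Type*} [AddCommGroup X] [Module ℂ X] [NormedAddCommGroup B]
    [InnerProductSpace ℂ B] [CompleteSpace B] (T : X →ₗ[ℂ] B) (ℓ : X →ₗ[ℂ] ℂ) (C : ℝ)
    (h : ∀ x, ‖ℓ x‖ ≤ C * ‖T x‖) : ∃ y : B, ∀ x, ℓ x = inner ℂ y (T x) := by
  obtain ⟨s, hs⟩ := T.rangeRestrict.exists_rightInverse_of_surjective T.range_rangeRestrict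
  have hs' : ∀ p : LinearMap.range T, T (s p) = p := fun p =>
    congrArg Subtype.val (LinearMap.congr_fun hs p)
  let g : LinearMap.range T →L[ℂ] ℂ := (ℓ ∘ₗ s).mkContinuous C fun p => by
    have := h (s p)
    rw [hs'] at this
    exact this
  obtain ⟨G, hG, -⟩ := exists_extension_norm_eq (LinearMap.range T) g
  refine ⟨(InnerProductSpace.toDual ℂ B).symm G, fun x => ?_⟩
  rw [InnerProductSpace.toDual_symm_apply]
  have h1 := hG ⟨T x, LinearMap.mem_range_self T x⟩
  refine Eq.trans ?_ h1.symm
  change ℓ x = ℓ (s _)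
  have h2 := h (x - s ⟨T x, LinearMap.mem_range_self T x⟩)
  rw [map_sub, map_sub, hs', sub_self, norm_zero, mul_zero] at h2
  exact sub_eq_zero.1 (norm_le_zero_iff.1 h2)

lemma tr_eq_zero_of_mem (hD : IsOpen D) {W : Energy D}
    (hW : W ∈ energySpace D (interiorTests D)) : W.tr = 0 := by
  refine energySpace_induction (p := fun W : Energy D => W.tr = 0) ?_ (fun f hf => ?_) W hW
  · exact isClosed_eq Energy.tr.continuous continuous_const
  · rw [Lp.eq_zero_iff_ae_eq_zero]
    have h1 : ((toEnergy D f).tr : Eu d → ℂ) =ᵐ[surf D] _ :=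
      (C1c.memLp f.2 (surf D)).coeFn_toLp
    filter_upwards [h1, surf_ae_notMem hD] with x hx hx'
    rw [hx]
    exact image_eq_zero_of_notMem_tsupport fun h => hx' (hf.2 h)

/-- A weak solution `Z` with vanishing boundary values has a normal derivative in `L²(∂D)`. For this
the weak normal derivative has to be bounded by the `L²(∂D)` norm of the test function `U`. It does
not change if `U` is replaced by the solution `Φ` of `-ΔΦ + ℓΦ = 0` with the same boundary values,
where it becomes an inner product with `Φ` in `L²(D)`; and the barrier bounds `Φ` in `L²(D)` by its
boundary values. -/
lemma exists_normalDeriv (hD : IsC2Domain D) {Z : Energy D}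
    (hZ : Z ∈ energySpace D (interiorTests D)) (w : DomL2 D)
    (h : ∀ W ∈ energySpace D (interiorTests D), inner ℂ W.gr Z.gr + inner ℂ W.val w = 0) :
    ∃ y : BdryL2 D, ∀ U ∈ energySpace D (tests d),
      inner ℂ U.gr Z.gr + inner ℂ U.val w = inner ℂ U.tr y := by
  obtain ⟨b, hb, hb0, hbn, ℓ, hℓ0, hℓ⟩ := exists_barrier hD
  obtain ⟨C, hC0, hC⟩ := norm_val_sq_le_form hD hb hbn hℓ
  have hbarrier : ∀ U ∈ energySpace D (tests d),
      mulEnergy hD hb U ∈ energySpace D (interiorTests D) ∧ ‖U.val‖ ^ 2 ≤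
        2 * (form ((ℓ : ℂ) • 1) 0 (mulEnergy hD hb U) U).re + C * ‖U.tr‖ ^ 2 := by
    have hc := continuous_mulEnergy hD hb
    refine energySpace_induction ?_ fun f _ => ?_
    · have h1 : Continuous fun U : Energy D =>
          form ((ℓ : ℂ) • 1) 0 (mulEnergy hD hb U) U := by
        unfold form
        fun_prop
      have h2 : Continuous fun U : Energy D =>
          2 * (form ((ℓ : ℂ) • 1) 0 (mulEnergy hD hb U) U).re + C * ‖U.tr‖ ^ 2 :=
        (continuous_const.mul (Complex.continuous_re.comp h1)).add (by fun_prop)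
      have h3 : Continuous fun U : Energy D => ‖U.val‖ ^ 2 := by fun_prop
      exact ((Submodule.isClosed_topologicalClosure _).preimage hc).inter (isClosed_le h3 h2)
    · rw [mulEnergy_toEnergy hD hb hb0]
      refine ⟨toEnergy_mem_of_eq_zero hD fun x hx => ?_, hC f⟩
      change (b x : ℂ) * _ = 0
      rw [hb0 x hx, Complex.ofReal_zero, zero_mul]
  have hle := energySpace_mono (D := D) (interiorTests_le D)
  have hinj : ∀ U ∈ energySpace D (interiorTests D), (∀ W ∈ energySpace D (interiorTests D),
      form ((ℓ : ℂ) • 1) 0 W U = 0) → U = 0 := by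
    intro U hU hW
    have h1 := hW U hU
    rw [form, zero_mul, sub_zero, smul_apply, one_apply_eq_self, inner_smul_right,
      inner_self_eq_norm_sq_to_K, inner_self_eq_norm_sq_to_K] at h1
    have h2 : ‖U.gr‖ ^ 2 + ℓ * ‖U.val‖ ^ 2 = 0 :=
      Complex.ofReal_injective (by push_cast; exact h1)
    refine eq_zero_of_val_eq_zero hD (hle hU) ?_
    have h3 : ℓ * ‖U.val‖ ^ 2 = 0 := by
      have := sq_nonneg ‖U.gr‖
      have : 0 ≤ ℓ * ‖U.val‖ ^ 2 := by positivity
      linarith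
    rcases mul_eq_zero.1 h3 with h3 | h3
    · exact absurd h3 hℓ0.ne'
    · exact norm_eq_zero.1 (sq_eq_zero_iff.1 h3)
  have hbound : ∀ U ∈ energySpace D (tests d),
      ‖inner ℂ Z.gr U.gr + inner ℂ w U.val‖ ≤ (√C * ‖w - (ℓ : ℂ) • Z.val‖) * ‖U.tr‖ := by
    intro U hU
    -- `U - z` is the solution of `-ΔΦ + ℓΦ = 0` with the boundary values of `U`.
    obtain ⟨z, hz, hzW⟩ := exists_form_eq hD (interiorTests_le D) ((ℓ : ℂ) • 1) 0 hinj
      (Energy.mk ((ℓ : ℂ) • U.val) 0 (fun i => U.gr i))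
    have horth : ∀ W ∈ energySpace D (interiorTests D), form ((ℓ : ℂ) • 1) 0 W (U - z) = 0 := by
      intro W hW
      have h1 := hzW W hW
      have h2 : (Energy.mk ((ℓ : ℂ) • U.val) 0 (fun i => U.gr i)).gr = U.gr := by ext1 i; rfl
      rw [Energy.inner_eq, h2, Energy.val_mk, Energy.tr_mk, inner_zero_right, zero_add] at h1
      simp only [form, zero_mul, sub_zero, smul_apply, one_apply_eq_self] at h1 ⊢
      rw [map_sub, map_sub, inner_sub_right, smul_sub, inner_sub_right]
      linear_combination -h1
    have hmem : U - z ∈ energySpace D (tests d) := Submodule.sub_mem _ hU (hle hz)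
    obtain ⟨h1, h2⟩ := hbarrier _ hmem
    rw [horth _ h1, Complex.zero_re, mul_zero, zero_add, map_sub Energy.tr, tr_eq_zero_of_mem hD.isOpen hz, sub_zero]
      at h2
    have h3 : ‖(U - z).val‖ ≤ √C * ‖U.tr‖ := by
      refine le_of_sq_le_sq ?_ (by positivity)
      rw [mul_pow, Real.sq_sqrt hC0]
      exact h2
    have h4 := horth Z hZ
    simp only [form, zero_mul, sub_zero, smul_apply, one_apply_eq_self, inner_smul_right] at h4
    have h5 := congrArg conj (h z hz)
    rw [map_add, inner_conj_symm, inner_conj_symm, map_zero] at h5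
    have h6 : inner ℂ Z.gr U.gr + inner ℂ w U.val
        = inner ℂ (w - (ℓ : ℂ) • Z.val) (U - z).val := by
      rw [inner_sub_left, inner_smul_left, Complex.conj_ofReal]
      rw [map_sub, inner_sub_right] at h4 ⊢
      rw [map_sub Energy.val] at h4
      linear_combination h4 + h5
    rw [h6]
    calc _ ≤ ‖w - (ℓ : ℂ) • Z.val‖ * ‖(U - z).val‖ := norm_inner_le_norm _ _
      _ ≤ ‖w - (ℓ : ℂ) • Z.val‖ * (√C * ‖U.tr‖) := by gcongr
      _ = _ := by ring
  obtain ⟨y, hy⟩ := exists_eq_inner_of_le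
    ((Energy.tr : Energy D →L[ℂ] BdryL2 D).toLinearMap ∘ₗ (energySpace D (tests d)).subtype)
    (((innerSL ℂ Z.gr).comp Energy.gr + (innerSL ℂ w).comp Energy.val).toLinearMap ∘ₗ
      (energySpace D (tests d)).subtype) _ (fun U => hbound U U.2)
  refine ⟨y, fun U hU => ?_⟩
  have h1 : inner ℂ Z.gr U.gr + inner ℂ w U.val = inner ℂ y U.tr := hy ⟨U, hU⟩
  have h2 := congrArg conj h1
  rw [map_add, inner_conj_symm, inner_conj_symm, inner_conj_symm] at h2
  exact h2

end

end

/-! ### The impedance boundary value problem and Green's formula -/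

section

variable {d : ℕ} {D : Set (Eu d)}

section
variable [IsFiniteMeasure (surf D)]

/-- Green's formula for a regular solution and a point of the energy space. -/
lemma RegularSolution.green_energy {v : Eu d → ℂ} {E : ℝ} (ψ : RegularSolution D v E)
    {U : Energy D} (hU : U ∈ energySpace D (tests d)) :
    ∑ i, ∫ x, U.gr i x * ψ.grad i x ∂(vol D) + ∫ x, U.val x * ψ.lap x ∂(vol D)
      = ∫ x, U.tr x * ψ.normalDeriv x ∂(surf D) := by
  refine energySpace_induction (p := fun U : Energy D => ∑ i, ∫ x, U.gr i x * ψ.grad i x ∂(vol D)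
    + ∫ x, U.val x * ψ.lap x ∂(vol D) = ∫ x, U.tr x * ψ.normalDeriv x ∂(surf D))
    ?_ (fun f hf => ?_) U hU
  · refine isClosed_eq (Continuous.add (continuous_finsetSum _ fun i _ => ?_) ?_) ?_
    · exact (continuous_integral_mul (ψ.memLp_grad i)).comp
        ((PiLp.continuous_apply 2 _ i).comp Energy.gr.continuous)
    · exact (continuous_integral_mul ψ.memLp_lap).comp Energy.val.continuous
    · exact (continuous_integral_mul (Lp.memLp ψ.normalDeriv)).comp Energy.tr.continuous
  · have h1 : ((Impedance.toEnergy D f).val : Eu d → ℂ) =ᵐ[vol D] f :=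
      (C1c.memLp f.2 (vol D)).coeFn_toLp
    have h2 : ∀ i, ((Impedance.toEnergy D f).gr i : Eu d → ℂ) =ᵐ[vol D] pderiv i (f : Eu d → ℂ) := fun i =>
      (C1c.memLp_pderiv f.2 i (vol D)).coeFn_toLp
    have h3 : ((Impedance.toEnergy D f).tr : Eu d → ℂ) =ᵐ[surf D] f :=
      (C1c.memLp f.2 (surf D)).coeFn_toLp
    rw [integral_mul_congr_left h1, integral_mul_congr_left h3,
      Finset.sum_congr rfl fun i _ => integral_mul_congr_left (h2 i)]
    simp_rw [mul_comm ((f : Eu d → ℂ) _), mul_comm (pderiv _ (f : Eu d → ℂ) _)]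
    exact (ψ.hasNormalDeriv f hf).2

/-- The formula of `green_energy`, with inner products. -/
lemma RegularSolution.inner_green {v : Eu d → ℂ} {E : ℝ} (ψ : RegularSolution D v E)
    {W : Energy D} (hW : W ∈ energySpace D (tests d)) :
    inner ℂ W.gr ψ.toEnergy.gr + inner ℂ W.val (ψ.memLp_lap.toLp ψ.lap)
      = inner ℂ W.tr ψ.normalDeriv := by
  refine energySpace_induction (p := fun W : Energy D => inner ℂ W.gr ψ.toEnergy.gr
    + inner ℂ W.val (ψ.memLp_lap.toLp ψ.lap) = inner ℂ W.tr ψ.normalDeriv)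
    (isClosed_eq (by fun_prop) (by fun_prop)) (fun f hf => ?_) W hW
  have h1 : conjC (conjC f) = f := Subtype.ext (funext fun x => Complex.conj_conj _)
  have h2 : ∀ i, ∫ x, ψ.toEnergy.gr i x * pderiv i (conjC f : Eu d → ℂ) x ∂(vol D)
      = ∫ x, ψ.grad i x * pderiv i (conjC f : Eu d → ℂ) x ∂(vol D) := fun i =>
    integral_mul_congr_left (ψ.memLp_grad i).coeFn_toLp
  rw [← h1, inner_gr_conjC, inner_val_conjC, inner_tr_conjC,
    integral_mul_congr_left ψ.memLp_lap.coeFn_toLp, Finset.sum_congr rfl fun i _ => h2 i]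
  exact (ψ.hasNormalDeriv _ (conjC_mem_tests hf)).2

end

/-- The symmetric bilinear pairing `∫_{∂D} a b`. -/
noncomputable def pairing (D : Set (Eu d)) : BdryL2 D →L[ℂ] BdryL2 D →L[ℂ] ℂ :=
  (ContinuousLinearMap.mul ℂ ℂ).lpPairing (surf D) 2 2

lemma pairing_apply (a b : BdryL2 D) : pairing D a b = ∫ x, a x * b x ∂(surf D) :=
  (ContinuousLinearMap.mul ℂ ℂ).lpPairing_eq_integral a b

lemma pairing_comm (a b : BdryL2 D) : pairing D a b = pairing D b a := by
  simp_rw [pairing_apply, mul_comm]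

/-- Green's second formula, for solutions with two potentials. -/
lemma RegularSolution.integral_potential_sub (hD : IsC2Domain D) {v v' : Eu d → ℂ} {E : ℝ}
    (ψ : RegularSolution D v E) (ψ' : RegularSolution D v' E) :
    ∫ x in D, (v x - v' x) * ψ.toFun x * ψ'.toFun x
      = pairing D ψ.normalDeriv ψ'.trace - pairing D ψ.trace ψ'.normalDeriv := by
  have := isFiniteMeasure_surf hD
  have h1 := ψ.green_energy ψ'.toEnergy_mem
  have h2 := ψ'.green_energy ψ.toEnergy_mem
  have e1 : ∀ i, ∫ x, ψ'.toEnergy.gr i x * ψ.grad i x ∂(vol D)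
      = ∫ x, ψ'.grad i x * ψ.grad i x ∂(vol D) := fun i =>
    integral_mul_congr_left (ψ'.memLp_grad i).coeFn_toLp
  have e2 : ∀ i, ∫ x, ψ.toEnergy.gr i x * ψ'.grad i x ∂(vol D)
      = ∫ x, ψ'.grad i x * ψ.grad i x ∂(vol D) := fun i => by
    rw [integral_mul_congr_left (f := ψ.toEnergy.gr i) (ψ.memLp_grad i).coeFn_toLp]
    simp_rw [mul_comm]
  have e3 : ∫ x, ψ'.toEnergy.val x * ψ.lap x ∂(vol D) = ∫ x, ψ'.toFun x * ψ.lap x ∂(vol D) :=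
    integral_mul_congr_left ψ'.memLp_toFun.coeFn_toLp
  have e4 : ∫ x, ψ.toEnergy.val x * ψ'.lap x ∂(vol D) = ∫ x, ψ.toFun x * ψ'.lap x ∂(vol D) :=
    integral_mul_congr_left ψ.memLp_toFun.coeFn_toLp
  rw [Finset.sum_congr rfl fun i _ => e1 i, e3] at h1
  rw [Finset.sum_congr rfl fun i _ => e2 i, e4] at h2
  rw [pairing_comm, pairing_apply, pairing_apply]
  change _ = ∫ x, ψ'.toEnergy.tr x * _ ∂_ - ∫ x, ψ.toEnergy.tr x * _ ∂_
  rw [← h1, ← h2, add_sub_add_left_eq_sub]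
  refine Eq.trans (integral_congr_ae ?_) (integral_sub
    (ψ'.memLp_toFun.integrable_mul ψ.memLp_lap) (ψ.memLp_toFun.integrable_mul ψ'.memLp_lap))
  filter_upwards [ψ.equation, ψ'.equation] with x h3 h4
  linear_combination ψ'.toFun x * h3 - ψ.toFun x * h4

/-- Two boundary operators with orthogonal parameters turn Green's boundary terms into
impedance data. -/
lemma RegularSolution.pairing_bracket {v v' : Eu d → ℂ} {E : ℝ}
    (ψ : RegularSolution D v E) (ψ' : RegularSolution D v' E) (α : ℝ) :
    pairing D (ψ.bracket α) (ψ'.bracket (α - Real.pi / 2))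
      - pairing D (ψ.bracket (α - Real.pi / 2)) (ψ'.bracket α)
      = pairing D ψ.trace ψ'.normalDeriv - pairing D ψ.normalDeriv ψ'.trace := by
  simp only [bracket, Real.cos_sub_pi_div_two, Real.sin_sub_pi_div_two, map_sub, map_smul,
    sub_apply, smul_apply, smul_eq_mul, Complex.ofReal_neg]
  have h : ((Real.cos α : ℂ)) ^ 2 + (Real.sin α : ℂ) ^ 2 = 1 := by
    exact_mod_cast Real.cos_sq_add_sin_sq α
  linear_combination (pairing D ψ.trace ψ'.normalDeriv - pairing D ψ.normalDeriv ψ'.trace) * h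

lemma RegularSolution.bracket_eq_zero (hD : IsC2Domain D) {v : Eu d → ℂ} {E : ℝ}
    (ψ : RegularSolution D v E) (h0 : ψ.toFun =ᵐ[vol D] 0) (β : ℝ) : ψ.bracket β = 0 := by
  have := isFiniteMeasure_surf hD
  obtain ⟨h1, h2⟩ := ψ.eq_zero hD h0
  rw [bracket, h1, h2, smul_zero, smul_zero, sub_zero]

/-- The impedance boundary map is well defined if `E` is not an eigenvalue. -/
lemma impedanceMap_bracket (hD : IsC2Domain D) {v : Eu d → ℂ} {E α : ℝ}
    (hE : ¬ IsImpedanceEigenvalue D v α E) (ψ : RegularSolution D v E)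
    (h : ψ.bracket α ∈ (impedanceMap D v E α).domain) :
    impedanceMap D v E α ⟨ψ.bracket α, h⟩ = ψ.bracket (α - Real.pi / 2) := by
  have hwell : ∀ ψ : RegularSolution D v E, ψ.bracket α = 0 → ψ.bracket (α - Real.pi / 2) = 0 :=
    fun ψ h0 => ψ.bracket_eq_zero hD (not_not.1 fun hn => hE ⟨ψ, h0, hn⟩) _
  have hg : ∀ p ∈ impedanceGraph D v E α, p.1 = 0 → p.2 = 0 := by
    rintro _ ⟨ψ, rfl⟩ h0
    exact hwell ψ h0
  obtain ⟨φ, hφ⟩ := Submodule.mem_graph_toLinearPMap (fun p hp => hg p hp) ⟨ψ.bracket α, h⟩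
  rw [Prod.mk.injEq] at hφ
  have h1 := hwell (.comb (-1) φ ψ) (by rw [RegularSolution.bracket_comb, ← hφ.1]; simp)
  rw [RegularSolution.bracket_comb, ← hφ.2, neg_one_smul, neg_add_eq_zero] at h1
  exact h1

lemma bracket_mem_domain {v : Eu d → ℂ} {E : ℝ} (ψ : RegularSolution D v E) (α : ℝ) :
    ψ.bracket α ∈ (impedanceMap D v E α).domain :=
  ⟨(ψ.bracket α, ψ.bracket (α - Real.pi / 2)), ⟨ψ, rfl⟩, rfl⟩

section
variable [IsFiniteMeasure (surf D)]

/-- Multiplication by `v - E`. -/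
noncomputable def potential {v : Eu d → ℂ} (hv : MemLp v ⊤ (vol D)) (E : ℝ) :
    DomL2 D →L[ℂ] DomL2 D :=
  mulL hv - (E : ℂ) • 1

/-- A solution of the weak formulation with given normal derivative is a regular solution. -/
lemma exists_regularSolution_of_weak (hD : IsOpen D) {v : Eu d → ℂ} (hv : MemLp v ⊤ (vol D))
    {E : ℝ} {U : Energy D} (hU : U ∈ energySpace D (tests d)) (h : BdryL2 D)
    (hweak : ∀ W ∈ energySpace D (tests d),
      inner ℂ W.gr U.gr + inner ℂ W.val (potential hv E U.val) = inner ℂ W.tr h) :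
    ∃ ψ : RegularSolution D v E, ψ.toFun = U.val ∧ ψ.trace = U.tr ∧ ψ.normalDeriv = h := by
  refine ⟨RegularSolution.ofEnergy hD hU (potential hv E U.val) h (fun φ hφ => ?_) ?_,
    rfl, rfl, rfl⟩
  · have h1 := hweak _ (toEnergy_mem (conjC_mem_tests (f := ⟨φ, hφ.mem_C1c⟩) hφ))
    rw [inner_gr_conjC, inner_val_conjC, inner_tr_conjC] at h1
    exact h1
  · have h1 := Lp.coeFn_sub (mulL hv U.val) ((E : ℂ) • U.val)
    filter_upwards [h1, coeFn_mulL hv U.val, Lp.coeFn_smul (E : ℂ) U.val] with x h1 h2 h3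
    have h4 : (potential hv E U.val : Eu d → ℂ) x = v x * U.val x - E * U.val x := by
      refine Eq.trans h1 ?_
      rw [Pi.sub_apply, h2, h3]
      rfl
    rw [h4]
    ring

/-- If `E` is not an eigenvalue, a weak solution with vanishing impedance boundary values is
zero. -/
lemma eq_zero_of_weak (hD : IsC2Domain D) {v : Eu d → ℂ} (hv : MemLp v ⊤ (vol D)) {E α : ℝ}
    (hE : ¬ IsImpedanceEigenvalue D v α E) {U : Energy D} (hU : U ∈ energySpace D (tests d))
    (h : BdryL2 D) (hweak : ∀ W ∈ energySpace D (tests d),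
      inner ℂ W.gr U.gr + inner ℂ W.val (potential hv E U.val) = inner ℂ W.tr h)
    (hbr : (Real.cos α : ℂ) • U.tr - (Real.sin α : ℂ) • h = 0) : U = 0 := by
  obtain ⟨ψ, h1, h2, h3⟩ := exists_regularSolution_of_weak hD.isOpen hv hU h hweak
  refine eq_zero_of_val_eq_zero hD hU ((Lp.eq_zero_iff_ae_eq_zero).2 ?_)
  rw [← h1]
  by_contra hn
  exact hE ⟨ψ, by rw [RegularSolution.bracket, h2, h3]; exact hbr, hn⟩

/-- The impedance boundary value problem is solvable for boundary values in `L²(∂D)`, if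
`sin α ≠ 0`. -/
lemma exists_bracket_eq_of_sin_ne_zero (hD : IsC2Domain D) {v : Eu d → ℂ}
    (hv : MemLp v ⊤ (vol D)) {E α : ℝ} (hE : ¬ IsImpedanceEigenvalue D v α E)
    (hα : Real.sin α ≠ 0) (f : BdryL2 D) : ∃ ψ : RegularSolution D v E, ψ.bracket α = f := by
  have hs : (Real.sin α : ℂ) ≠ 0 := Complex.ofReal_ne_zero.2 hα
  set c : ℂ := Real.cos α / Real.sin α with hc
  have hform : ∀ W U : Energy D, inner ℂ W.gr U.gr + inner ℂ W.val (potential hv E U.val)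
      = form (potential hv E) c W U + inner ℂ W.tr (c • U.tr) := fun W U => by
    rw [form, inner_smul_right]; ring
  obtain ⟨U, hU, hUW⟩ := exists_form_eq hD (le_refl (tests d)) (potential hv E) c
    (fun U hU hW => eq_zero_of_weak hD hv hE hU (c • U.tr)
      (fun W hW' => by rw [hform, hW W hW', zero_add])
      (by rw [smul_smul, hc, mul_div_cancel₀ _ hs, sub_self]))
    (Energy.mk 0 (-(Real.sin α : ℂ)⁻¹ • f) (fun _ => 0))
  obtain ⟨ψ, -, h2, h3⟩ := exists_regularSolution_of_weak hD.isOpen hv hU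
    (-(Real.sin α : ℂ)⁻¹ • f + c • U.tr) (fun W hW => by
      have h4 : (Energy.mk (0 : DomL2 D) (-(Real.sin α : ℂ)⁻¹ • f) (fun _ => 0)).gr = 0 := by
        ext1 i; rfl
      rw [hform, hUW W hW, Energy.inner_eq, Energy.val_mk, Energy.tr_mk, h4, inner_zero_right,
        inner_zero_right, zero_add, add_zero, inner_add_right])
  refine ⟨ψ, ?_⟩
  rw [RegularSolution.bracket, h2, h3, smul_add, smul_smul, smul_smul, hc, mul_div_cancel₀ _ hs,
    mul_neg, mul_inv_cancel₀ hs, neg_one_smul]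
  abel

/-- If `sin α = 0`, the impedance boundary value problem is the Dirichlet problem. It is solvable
for the boundary values of a regular solution with another potential, by a correction that
vanishes on the boundary. -/
lemma exists_bracket_eq_of_sin_eq_zero (hD : IsC2Domain D) {v v' : Eu d → ℂ}
    (hv : MemLp v ⊤ (vol D)) {E α : ℝ} (hE : ¬ IsImpedanceEigenvalue D v α E)
    (hα : Real.sin α = 0) (ψ' : RegularSolution D v' E) :
    ∃ ψ : RegularSolution D v E, ψ.bracket α = ψ'.bracket α := by
  have hle := energySpace_mono (D := D) (interiorTests_le D)
  have hform : ∀ W U : Energy D, form (potential hv E) 0 W U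
      = inner ℂ W.gr U.gr + inner ℂ W.val (potential hv E U.val) := fun W U => by
    rw [form, zero_mul, sub_zero]
  obtain ⟨z, hz, hzW⟩ := exists_form_eq hD (interiorTests_le D) (potential hv E) 0
    (fun U hU hW => by
      obtain ⟨y, hy⟩ := exists_normalDeriv hD hU (potential hv E U.val)
        (fun W hW' => (hform W U).symm.trans (hW W hW'))
      refine eq_zero_of_weak hD hv hE (hle hU) y hy ?_
      rw [tr_eq_zero_of_mem hD.isOpen hU, hα, Complex.ofReal_zero, smul_zero, zero_smul, sub_zero])
    (-Energy.mk (potential hv E ψ'.toEnergy.val) 0 (fun i => ψ'.toEnergy.gr i))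
  -- The Laplacian of `z` is the difference of the Laplacians of `U` and `ψ'`.
  set U := ψ'.toEnergy + z with hU
  have hUm : U ∈ energySpace D (tests d) := Submodule.add_mem _ ψ'.toEnergy_mem (hle hz)
  have hz0 : ∀ W ∈ energySpace D (interiorTests D),
      inner ℂ W.gr z.gr + inner ℂ W.val (potential hv E U.val - ψ'.memLp_lap.toLp ψ'.lap) = 0 := by
    intro W hW
    have h1 := hzW W hW
    have h2 := ψ'.inner_green (hle hW)
    have h3 : (Energy.mk (potential hv E ψ'.toEnergy.val) 0 (fun i => ψ'.toEnergy.gr i)).gr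
        = ψ'.toEnergy.gr := by ext1 i; rfl
    rw [hform, inner_neg_right, Energy.inner_eq, h3, Energy.val_mk, Energy.tr_mk, inner_zero_right]
      at h1
    rw [tr_eq_zero_of_mem hD.isOpen hW, inner_zero_left] at h2
    rw [inner_sub_right, hU, map_add, map_add, inner_add_right]
    linear_combination h1 - h2
  obtain ⟨y, hy⟩ := exists_normalDeriv hD hz _ hz0
  obtain ⟨ψ, -, h2, h3⟩ := exists_regularSolution_of_weak hD.isOpen hv hUm (ψ'.normalDeriv + y)
    (fun W hW => by
      have h4 := ψ'.inner_green hW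
      have h5 := hy W hW
      rw [inner_sub_right] at h5
      rw [inner_add_right, ← h4, ← h5]
      have h6 : U.gr = ψ'.toEnergy.gr + z.gr := map_add _ _ _
      rw [h6, inner_add_right]
      ring)
  refine ⟨ψ, ?_⟩
  have h4 : U.tr = ψ'.trace := by
    rw [hU, map_add, tr_eq_zero_of_mem hD.isOpen hz, add_zero]
    rfl
  rw [RegularSolution.bracket, RegularSolution.bracket, h2, h4, hα, Complex.ofReal_zero, zero_smul,
    zero_smul]

end

end

end Impedance

theorem theorem3p1 {d : ℕ} (hd : 2 ≤ d) (D : Set (Impedance.Eu d)) (hD : Impedance.IsC2Domain D)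
    (v₁ v₂ : Impedance.Eu d → ℂ)
    (hv₁ : MemLp v₁ ∞ (Impedance.vol D)) (hv₂ : MemLp v₂ ∞ (Impedance.vol D))
    (E α : ℝ)
    (hE₁ : ¬ Impedance.IsImpedanceEigenvalue D v₁ α E)
    (hE₂ : ¬ Impedance.IsImpedanceEigenvalue D v₂ α E)
    (ψ₁ : Impedance.RegularSolution D v₁ E) (ψ₂ : Impedance.RegularSolution D v₂ E) :
    ∃ hdom : ψ₂.bracket α ∈
        (Impedance.impedanceMap D v₁ E α - Impedance.impedanceMap D v₂ E α).domain,
      ∫ x in D, (v₁ x - v₂ x) * ψ₁.toFun x * ψ₂.toFun x =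
        ∫ x, ψ₁.bracket α x *
          (Impedance.impedanceMap D v₁ E α - Impedance.impedanceMap D v₂ E α)
            ⟨ψ₂.bracket α, hdom⟩ x ∂(Impedance.surf D) := by
  obtain ⟨φ, hφ⟩ : ∃ φ : Impedance.RegularSolution D v₁ E, φ.bracket α = ψ₂.bracket α := by
    have := Impedance.isFiniteMeasure_surf hD
    by_cases hα : Real.sin α = 0
    · exact Impedance.exists_bracket_eq_of_sin_eq_zero hD hv₁ hE₁ hα ψ₂
    · exact Impedance.exists_bracket_eq_of_sin_ne_zero hD hv₁ hE₁ hα _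
  have h₁ : ψ₂.bracket α ∈ (Impedance.impedanceMap D v₁ E α).domain :=
    hφ ▸ Impedance.bracket_mem_domain φ α
  have h₂ := Impedance.bracket_mem_domain ψ₂ α
  refine ⟨⟨h₁, h₂⟩, ?_⟩
  have hM₁ : Impedance.impedanceMap D v₁ E α ⟨ψ₂.bracket α, h₁⟩
      = φ.bracket (α - Real.pi / 2) := by
    simp only [← hφ]
    exact Impedance.impedanceMap_bracket hD hE₁ φ _
  have hM₂ := Impedance.impedanceMap_bracket hD hE₂ ψ₂ h₂
  rw [← Impedance.pairing_apply, LinearPMap.sub_apply, hM₁, hM₂, map_sub,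
    ψ₁.integral_potential_sub hD ψ₂]
  have h := ψ₁.integral_potential_sub hD φ
  simp only [sub_self, zero_mul, integral_zero] at h
  have k₁ := ψ₁.pairing_bracket φ α
  have k₂ := ψ₁.pairing_bracket ψ₂ α
  rw [hφ] at k₁
  linear_combination k₂ - k₁ - h
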